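/- Let $V,H$ be complex Hilbert spaces such that $V$ is a dense subspace of $H$ with continuous inclusion, and let $V'$ be the antidual of $V$, so that $V\hookrightarrow H\hookrightarrow V'$ is a Gelfand triple with pivot space $H$. Let $\mathcal E\colon V\times V\to\mathbb C$ be a continuous sesquilinear form which is coercive, i.e. there is $\mu>0$ with $\operatorname{Re}\mathcal E(v,v)\ge\mu\|v\|_V^2$ for all $v\in V$, and let $\mathcal A\colon V\to V'$ be given by $\langle\mathcal Au,v\rangle_{V',V}=\mathcal E(u,v)$. Let $0<s<1$. For Hilbert spaces $Y\hookrightarrow X$ and $0<\theta<1$ let $W_\theta(X,Y)$ be the space of all $u\in L^1_{\rm loc}((0,\infty);Y)$ which have a weak derivative $u'\in L^1_{\rm loc}((0,\infty);X)$ and satisfy $\int_0^\infty\big(\|u(t)\|_Y^2+\|u'(t)\|_X^2\big)\,t^{2\theta-1}\,dt<\infty$. A function $u\in W_{1-s}(H,V)$ is called $s$-harmonic if $t^{1-2s}u'\in W_s(V',H)$ and $$-(t^{1-2s}u')'(t)+t^{1-2s}\mathcal Au(t)=0\quad\text{in }V'\text{ for a.e. }t\in(0,\infty).$$ Write $u(0)=\lim_{t\downarrow0}u(t)$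 (limit in $H$), and call $-\lim_{t\downarrow0}t^{1-2s}u'(t)$ (limit in $V'$) the $s$-normal derivative of $u$; the limits are those of the continuous representatives on $(0,\infty)$. Let $[H,V]_s$ and $[H,V']_s$ be the complex interpolation spaces. Then for every $x\in[H,V]_s$ there is a unique (up to equality almost everywhere) $s$-harmonic function $u$ with $u(0)=x$, its $s$-normal derivative exists and lies in $[H,V']_s$, and the Dirichlet-to-Neumann operator $$\mathcal D_s\colon[H,V]_s\to[H,V']_s,\qquad \mathcal D_sx=-\lim_{t\downarrow0}t^{1-2s}u'(t),$$ is a linear topological isomorphism from $[H,V]_s$ onto $[H,V']_s$. -/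

import Mathlib

namespace DtN

open MeasureTheory Set Filter Topology Complex
open scoped ContDiff

/-! ### Calderón's complex interpolation method -/

section Interpolation

variable {X₀ X₁ Z : Type*} [NormedAddCommGroup X₀] [NormedSpace ℂ X₀]
  [NormedAddCommGroup X₁] [NormedSpace ℂ X₁] [NormedAddCommGroup Z] [NormedSpace ℂ Z]

/-- `f` is an element of the Calderón space `ℱ(X₀, X₁)` of norm at most `M`. The couple is embedded
in `Z` by `j₀` and `j₁` (in all uses below `Z` is the sum `X₀ + X₁`, because it is one of the two
spaces). The function `f` is continuous and bounded on the closed strip `0 ≤ Re z ≤ 1` and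
holomorphic inside, and `t ↦ f (it)`, `t ↦ f (1 + it)` are continuous and bounded
by `M` as functions `g₀`, `g₁` with values in `X₀`, `X₁`. -/
structure IsCalderon (j₀ : X₀ →L[ℂ] Z) (j₁ : X₁ →L[ℂ] Z) (M : ℝ) (f : ℂ → Z) : Prop where
  continuousOn : ContinuousOn f (re ⁻¹' Icc 0 1)
  differentiableOn : DifferentiableOn ℂ f (re ⁻¹' Ioo 0 1)
  bounded : ∃ C : ℝ, ∀ z ∈ re ⁻¹' Icc (0 : ℝ) 1, ‖f z‖ ≤ C
  left : ∃ g₀ : ℝ → X₀, Continuous g₀ ∧ (∀ t : ℝ, f (t * I) = j₀ (g₀ t)) ∧ ∀ t, ‖g₀ t‖ ≤ M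
  right : ∃ g₁ : ℝ → X₁, Continuous g₁ ∧ (∀ t : ℝ, f (1 + t * I) = j₁ (g₁ t)) ∧ ∀ t, ‖g₁ t‖ ≤ M

variable {j₀ : X₀ →L[ℂ] Z} {j₁ : X₁ →L[ℂ] Z} {M N : ℝ} {f g : ℂ → Z}

theorem IsCalderon.nonneg (hf : IsCalderon j₀ j₁ M f) : 0 ≤ M := by
  obtain ⟨g₀, -, -, h⟩ := hf.left
  exact (norm_nonneg _).trans (h 0)

theorem IsCalderon.zero (j₀ : X₀ →L[ℂ] Z) (j₁ : X₁ →L[ℂ] Z) :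
    IsCalderon j₀ j₁ 0 (fun _ => 0) where
  continuousOn := continuousOn_const
  differentiableOn := differentiableOn_const _
  bounded := ⟨0, by simp⟩
  left := ⟨fun _ => 0, continuous_const, by simp, by simp⟩
  right := ⟨fun _ => 0, continuous_const, by simp, by simp⟩

theorem IsCalderon.add (hf : IsCalderon j₀ j₁ M f) (hg : IsCalderon j₀ j₁ N g) :
    IsCalderon j₀ j₁ (M + N) (fun z => f z + g z) where
  continuousOn := hf.continuousOn.add hg.continuousOn
  differentiableOn := hf.differentiableOn.add hg.differentiableOn
  bounded := by
    obtain ⟨C, hC⟩ := hf.bounded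
    obtain ⟨C', hC'⟩ := hg.bounded
    exact ⟨C + C', fun z hz => norm_add_le_of_le (hC z hz) (hC' z hz)⟩
  left := by
    obtain ⟨a, ha, ha', ha''⟩ := hf.left
    obtain ⟨b, hb, hb', hb''⟩ := hg.left
    exact ⟨fun t => a t + b t, ha.add hb, fun t => by simp [ha', hb'],
      fun t => norm_add_le_of_le (ha'' t) (hb'' t)⟩
  right := by
    obtain ⟨a, ha, ha', ha''⟩ := hf.right
    obtain ⟨b, hb, hb', hb''⟩ := hg.right
    exact ⟨fun t => a t + b t, ha.add hb, fun t => by simp [ha', hb'],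
      fun t => norm_add_le_of_le (ha'' t) (hb'' t)⟩

theorem IsCalderon.smul (c : ℂ) (hf : IsCalderon j₀ j₁ M f) :
    IsCalderon j₀ j₁ (‖c‖ * M) (fun z => c • f z) where
  continuousOn := hf.continuousOn.const_smul c
  differentiableOn := hf.differentiableOn.const_smul c
  bounded := by
    obtain ⟨C, hC⟩ := hf.bounded
    refine ⟨‖c‖ * C, fun z hz => ?_⟩
    rw [norm_smul]
    exact mul_le_mul_of_nonneg_left (hC z hz) (norm_nonneg c)
  left := by
    obtain ⟨a, ha, ha', ha''⟩ := hf.left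
    refine ⟨fun t => c • a t, ha.const_smul c, fun t => by simp [ha'], fun t => ?_⟩
    rw [norm_smul]
    exact mul_le_mul_of_nonneg_left (ha'' t) (norm_nonneg c)
  right := by
    obtain ⟨a, ha, ha', ha''⟩ := hf.right
    refine ⟨fun t => c • a t, ha.const_smul c, fun t => by simp [ha'], fun t => ?_⟩
    rw [norm_smul]
    exact mul_le_mul_of_nonneg_left (ha'' t) (norm_nonneg c)

/-- The maximum principle on the strip. -/
theorem IsCalderon.norm_le (hf : IsCalderon j₀ j₁ M f) {θ : ℝ} (hθ : θ ∈ Ioo (0 : ℝ) 1) :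
    ‖f θ‖ ≤ (‖j₀‖ + ‖j₁‖) * M := by
  have hM := hf.nonneg
  obtain ⟨C, hC⟩ := hf.bounded
  obtain ⟨a, -, ha', ha''⟩ := hf.left
  obtain ⟨b, -, hb', hb''⟩ := hf.right
  have hcl : closure (HadamardThreeLines.verticalStrip 0 1) = re ⁻¹' Icc 0 1 := by
    rw [HadamardThreeLines.verticalStrip, closure_preimage_re, closure_Ioo zero_ne_one]
  have hd : DiffContOnCl ℂ f (HadamardThreeLines.verticalStrip 0 1) :=
    ⟨hf.differentiableOn, by rw [hcl]; exact hf.continuousOn⟩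
  have key := HadamardThreeLines.norm_le_interp_of_mem_verticalClosedStrip₀₁' f
     (z := (θ : ℂ)) (a := (‖j₀‖ + ‖j₁‖) * M) (b := (‖j₀‖ + ‖j₁‖) * M)
    (by simpa [HadamardThreeLines.verticalClosedStrip] using ⟨hθ.1.le, hθ.2.le⟩) hd
    ⟨C, by rintro _ ⟨z, hz, rfl⟩; exact hC z hz⟩ ?_ ?_
  · refine key.trans (le_of_eq ?_)
    rcases (by positivity : 0 ≤ (‖j₀‖ + ‖j₁‖) * M).eq_or_lt with h0 | h0
    · rw [← h0, ofReal_re, Real.zero_rpow (by linarith [hθ.2]), zero_mul]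
    · rw [← Real.rpow_add h0]; simp
  · intro z hz
    have : z = (z.im : ℂ) * I := by
      apply Complex.ext <;> simp; simpa using hz
    rw [this, ha']
    calc ‖j₀ (a z.im)‖ ≤ ‖j₀‖ * M := j₀.le_opNorm_of_le (ha'' _)
      _ ≤ _ := by gcongr; simp
  · intro z hz
    have : z = 1 + (z.im : ℂ) * I := by
      apply Complex.ext <;> simp; simpa using hz
    rw [this, hb']
    calc ‖j₁ (b z.im)‖ ≤ ‖j₁‖ * M := j₁.le_opNorm_of_le (hb'' _)
      _ ≤ _ := by gcongr; simp

/-- The vector space `[X₀, X₁]_θ = {f(θ) : f ∈ ℱ(X₀, X₁)}`. -/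
def interpSubmodule (j₀ : X₀ →L[ℂ] Z) (j₁ : X₁ →L[ℂ] Z) (θ : Ioo (0 : ℝ) 1) : Submodule ℂ Z where
  carrier := {x | ∃ M f, IsCalderon j₀ j₁ M f ∧ f (θ : ℝ) = x}
  zero_mem' := ⟨0, _, IsCalderon.zero j₀ j₁, rfl⟩
  add_mem' := by
    rintro _ _ ⟨M, f, hf, rfl⟩ ⟨N, g, hg, rfl⟩
    exact ⟨_, _, hf.add hg, rfl⟩
  smul_mem' := by
    rintro c _ ⟨M, f, hf, rfl⟩
    exact ⟨_, _, hf.smul c, rfl⟩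

/-- The complex interpolation space `[X₀, X₁]_θ`, `0 < θ < 1`, which carries the norm
`‖x‖ = inf {‖f‖ : f ∈ ℱ(X₀, X₁), f(θ) = x}` below (not the norm of the ambient space `Z`). -/
def ComplexInterp (j₀ : X₀ →L[ℂ] Z) (j₁ : X₁ →L[ℂ] Z) (θ : Ioo (0 : ℝ) 1) : Type _ :=
  interpSubmodule j₀ j₁ θ

namespace ComplexInterp

variable {θ : Ioo (0 : ℝ) 1}

instance : AddCommGroup (ComplexInterp j₀ j₁ θ) :=
  inferInstanceAs (AddCommGroup (interpSubmodule j₀ j₁ θ))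

instance : Module ℂ (ComplexInterp j₀ j₁ θ) :=
  inferInstanceAs (Module ℂ (interpSubmodule j₀ j₁ θ))

/-- The inclusion of `[X₀, X₁]_θ` in the ambient space. -/
def incl (j₀ : X₀ →L[ℂ] Z) (j₁ : X₁ →L[ℂ] Z) (θ : Ioo (0 : ℝ) 1) :
    ComplexInterp j₀ j₁ θ →ₗ[ℂ] Z :=
  (interpSubmodule j₀ j₁ θ).subtype

theorem incl_injective : Function.Injective (incl j₀ j₁ θ) := Subtype.val_injective

/-- The norms (and their upper bounds) of the functions `f ∈ ℱ(X₀, X₁)` with `f(θ) = x`. -/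
def normSet (x : ComplexInterp j₀ j₁ θ) : Set ℝ :=
  {M | ∃ f, IsCalderon j₀ j₁ M f ∧ f (θ : ℝ) = incl j₀ j₁ θ x}

theorem normSet_nonempty (x : ComplexInterp j₀ j₁ θ) : (normSet x).Nonempty := by
  obtain ⟨M, f, hf⟩ := x.2
  exact ⟨M, f, hf⟩

theorem normSet_bddBelow (x : ComplexInterp j₀ j₁ θ) : BddBelow (normSet x) :=
  ⟨0, fun _ ⟨_, hf, _⟩ => hf.nonneg⟩

noncomputable instance : Norm (ComplexInterp j₀ j₁ θ) := ⟨fun x => sInf (normSet x)⟩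

theorem norm_def (x : ComplexInterp j₀ j₁ θ) : ‖x‖ = sInf (normSet x) := rfl

theorem norm_nonneg' (x : ComplexInterp j₀ j₁ θ) : 0 ≤ ‖x‖ :=
  le_csInf (normSet_nonempty x) fun _ ⟨_, hf, _⟩ => hf.nonneg

theorem norm_smul_le' (c : ℂ) (x : ComplexInterp j₀ j₁ θ) : ‖c • x‖ ≤ ‖c‖ * ‖x‖ := by
  refine le_of_forall_pos_le_add fun ε hε => ?_
  obtain ⟨M, ⟨f, hf, hfx⟩, hM⟩ := exists_lt_of_csInf_lt (normSet_nonempty x)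
    (show sInf (normSet x) < ‖x‖ + ε / (‖c‖ + 1) by
      have : 0 < ε / (‖c‖ + 1) := by positivity
      rw [← norm_def]; linarith)
  have h1 : ‖c • x‖ ≤ ‖c‖ * M :=
    csInf_le (normSet_bddBelow _) ⟨_, hf.smul c, by simp [hfx]⟩
  have h2 : ‖c‖ * M ≤ ‖c‖ * (‖x‖ + ε / (‖c‖ + 1)) :=
    mul_le_mul_of_nonneg_left hM.le (norm_nonneg c)
  have h3 : ‖c‖ * (ε / (‖c‖ + 1)) ≤ ε := by
    rw [mul_div_assoc', div_le_iff₀ (by positivity)]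
    nlinarith [norm_nonneg c]
  linarith

theorem norm_smul' (c : ℂ) (x : ComplexInterp j₀ j₁ θ) : ‖c • x‖ = ‖c‖ * ‖x‖ := by
  refine le_antisymm (norm_smul_le' c x) ?_
  rcases eq_or_ne c 0 with rfl | hc
  · simpa using norm_nonneg' _
  · have h := norm_smul_le' c⁻¹ (c • x)
    rw [inv_smul_smul₀ hc, norm_inv] at h
    rwa [← le_inv_mul_iff₀ (norm_pos_iff.2 hc)]

theorem norm_add_le' (x y : ComplexInterp j₀ j₁ θ) : ‖x + y‖ ≤ ‖x‖ + ‖y‖ := by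
  refine le_of_forall_pos_le_add fun ε hε => ?_
  obtain ⟨M, ⟨f, hf, hfx⟩, hM⟩ := exists_lt_of_csInf_lt (normSet_nonempty x)
    (show sInf (normSet x) < ‖x‖ + ε / 2 by rw [← norm_def]; linarith)
  obtain ⟨N, ⟨g, hg, hgy⟩, hN⟩ := exists_lt_of_csInf_lt (normSet_nonempty y)
    (show sInf (normSet y) < ‖y‖ + ε / 2 by rw [← norm_def]; linarith)
  have h1 : ‖x + y‖ ≤ M + N :=
    csInf_le (normSet_bddBelow _) ⟨_, hf.add hg, by simp [hfx, hgy]⟩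
  linarith

theorem eq_zero_of_norm_eq_zero' (x : ComplexInterp j₀ j₁ θ) (hx : ‖x‖ = 0) : x = 0 := by
  apply incl_injective
  rw [map_zero, ← norm_le_zero_iff]
  refine le_of_forall_pos_le_add fun ε hε => ?_
  have hK : 0 < ‖j₀‖ + ‖j₁‖ + 1 := by positivity
  obtain ⟨M, ⟨f, hf, hfx⟩, hM⟩ := exists_lt_of_csInf_lt (normSet_nonempty x)
    (show sInf (normSet x) < ε / (‖j₀‖ + ‖j₁‖ + 1) by rw [← norm_def, hx]; positivity)
  rw [← hfx, zero_add]
  have h := hf.norm_le θ.2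
  rw [lt_div_iff₀ hK] at hM
  nlinarith [hf.nonneg]

noncomputable instance : NormedAddCommGroup (ComplexInterp j₀ j₁ θ) :=
  NormedAddCommGroup.ofCore (𝕜 := ℂ)
    { norm_nonneg := norm_nonneg'
      norm_smul := norm_smul'
      norm_triangle := norm_add_le'
      norm_eq_zero_iff := fun x => ⟨eq_zero_of_norm_eq_zero' x, fun h => by
        simpa [h] using norm_smul' (0 : ℂ) x⟩ }

noncomputable instance : NormedSpace ℂ (ComplexInterp j₀ j₁ θ) where
  norm_smul_le := norm_smul_le'

end ComplexInterp

end Interpolation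

/-! ### Weighted Sobolev spaces on `(0, ∞)` -/

section Sobolev

variable {X Y : Type*} [NormedAddCommGroup X] [NormedSpace ℂ X]
  [NormedAddCommGroup Y] [NormedSpace ℂ Y]

/-- `u, v ∈ L¹_loc((0,∞); X)` and `v` is the weak derivative of `u`, with scalar test functions
`φ ∈ C_c^∞((0,∞))`. -/
structure HasWeakDeriv (u v : ℝ → X) : Prop where
  locallyIntegrableOn : LocallyIntegrableOn u (Ioi 0)
  locallyIntegrableOn_deriv : LocallyIntegrableOn v (Ioi 0)
  integral_eq : ∀ φ : ℝ → ℂ, ContDiff ℝ ∞ φ → HasCompactSupport φ → tsupport φ ⊆ Ioi 0 →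
    -∫ t in Ioi (0 : ℝ), deriv φ t • u t = ∫ t in Ioi (0 : ℝ), φ t • v t

/-- The measure `dt / t` on `(0, ∞)`. -/
noncomputable def haarIoi : Measure ℝ :=
  (volume.restrict (Ioi 0)).withDensity fun t => ENNReal.ofReal t⁻¹

/-- `u` belongs to the mixed Sobolev space `W_s(X, Y)`, where `Y` is embedded in `X` by `j`, and
`u'` is its weak derivative: `u ∈ L¹_loc(Y)`, `u' ∈ L¹_loc(X)`, and `t^s u`, `t^s u'` are in
`L²((0,∞), dt/t)` with values in `Y` and `X`. -/
structure MemSobolev (s : ℝ) (j : Y →L[ℂ] X) (u : ℝ → Y) (u' : ℝ → X) : Prop where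
  locallyIntegrableOn : LocallyIntegrableOn u (Ioi 0)
  hasWeakDeriv : HasWeakDeriv (fun t => j (u t)) u'
  memLp : MemLp (fun t => t ^ s • u t) 2 haarIoi
  memLp_deriv : MemLp (fun t => t ^ s • u' t) 2 haarIoi

/-- `lim_{t ↓ 0} u(t) = x` in `X`, for the continuous representative on `(0, ∞)` of
the almost everywhere defined function `u`. -/
def HasTrace (u : ℝ → X) (x : X) : Prop :=
  ∃ v : ℝ → X, ContinuousOn v (Ioi 0) ∧ v =ᵐ[volume.restrict (Ioi 0)] u ∧
    Tendsto v (𝓝[>] 0) (𝓝 x)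

end Sobolev

/-! ### The Gelfand triple, harmonic functions and normal derivatives -/

section Harmonic

variable {V H : Type*} [NormedAddCommGroup V] [InnerProductSpace ℂ V]
  [NormedAddCommGroup H] [InnerProductSpace ℂ H]

/-- The antidual of `V`: continuous antilinear functionals. -/
abbrev Antidual (V : Type*) [NormedAddCommGroup V] [NormedSpace ℂ V] : Type _ := V →L⋆[ℂ] ℂ

/-- The embedding `H → V'` with `H` as pivot space: `⟨x, v⟩_{V',V} = ⟨x, v⟩_H` (linear in `x`,
antilinear in `v`). -/
noncomputable def pivot (ι : V →L[ℂ] H) : H →L[ℂ] Antidual V :=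
  ((innerSL ℂ).comp ι).flip

theorem pivot_apply (ι : V →L[ℂ] H) (x : H) (v : V) : pivot ι x v = inner ℂ (ι v) x := rfl

/-- `u` is `(ℰ, s)`-harmonic: `u ∈ W_{1-s}(H, V)`, `t^{1-2s} u' ∈ W_s(V', H)` and
`-(t^{1-2s} u')' + t^{1-2s} 𝒜 u = 0` in `V'` almost everywhere on `(0, ∞)`. The operator
`𝒜 : V → V'`, `⟨𝒜 u, v⟩ = ℰ(u, v)`, is the curried form `u ↦ ℰ u` of `ℰ`. -/
def IsHarmonic (ι : V →L[ℂ] H) (ℰ : V →L[ℂ] V →L⋆[ℂ] ℂ) (s : ℝ) (u : ℝ → V) : Prop :=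
  ∃ (u' : ℝ → H) (w' : ℝ → Antidual V),
    MemSobolev (1 - s) ι u u' ∧
    MemSobolev s (pivot ι) (fun t => t ^ (1 - 2 * s) • u' t) w' ∧
    ∀ᵐ t ∂volume.restrict (Ioi (0 : ℝ)), -w' t + ((t ^ (1 - 2 * s) : ℝ) : ℂ) • ℰ (u t) = 0

/-- `y = -lim_{t ↓ 0} t^{1-2s} u'(t)` in `V'`: `y` is the `s`-normal derivative of `u`. -/
def HasNormalDeriv (ι : V →L[ℂ] H) (s : ℝ) (u : ℝ → V) (y : Antidual V) : Prop :=
  ∃ u' : ℝ → H, HasWeakDeriv (fun t => ι (u t)) u' ∧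
    HasTrace (fun t => -pivot ι (t ^ (1 - 2 * s) • u' t)) y

/-- The interpolation space `[H, V]_s`, inside `H = H + V`. -/
abbrev InterpHV (ι : V →L[ℂ] H) (s : Ioo (0 : ℝ) 1) : Type _ :=
  ComplexInterp (ContinuousLinearMap.id ℂ H) ι s

/-- The interpolation space `[H, V']_s`, inside `V' = H + V'`. -/
abbrev InterpHV' (ι : V →L[ℂ] H) (s : Ioo (0 : ℝ) 1) : Type _ :=
  ComplexInterp (pivot ι) (ContinuousLinearMap.id ℂ (Antidual V)) s

/-- `x ∈ [H, V]_s` as an element of `H`. -/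
def InterpHV.toH {ι : V →L[ℂ] H} {s : Ioo (0 : ℝ) 1} (x : InterpHV ι s) : H :=
  ComplexInterp.incl (ContinuousLinearMap.id ℂ H) ι s x

/-- `y ∈ [H, V']_s` as an element of `V'`. -/
noncomputable def InterpHV'.toAntidual {ι : V →L[ℂ] H} {s : Ioo (0 : ℝ) 1} (y : InterpHV' ι s) : Antidual V :=
  ComplexInterp.incl (pivot ι) (ContinuousLinearMap.id ℂ (Antidual V)) s y

end Harmonic

end DtN

/-!
# The Dirichlet-to-Neumann operator of an abstract degenerate elliptic equation

The polar decomposition of `ι` (`exists_polar`) turns the Gelfand triple into one Hilbert space `H`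
with a positive injective operator `T = (ι ι†) ^ (1 / 2)`: there are isometric isomorphisms
`U : H → V` and `Λ : H → V'` with `ι U = T` and `pivot ι = Λ T`. The form becomes a bounded coercive
operator `A = Λ⁻¹ ℰ U` on `H`, which need not commute with `T`. With `u = U v` and `g = u'` the
equation reads

* `(T v)' = g`,
* `(T (t ^ (1 - 2 s) g))' = t ^ (1 - 2 s) A v`,

where `t ^ (1 - s) v` and `t ^ (1 - s) g` are in `L²(dt / t)`.

*Interpolation spaces.* In this picture `[H, V]_s` is the range of `T ^ s` and `[H, V']_s` is the
image under `Λ` of the range of `T ^ (1 - s)`, with equivalent norms (`exists_equiv_interpHV`,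
`exists_equiv_interpHV'`). For one inclusion, `z ↦ (T + ε) ^ z h` converges to an element of the
Calderón space as `ε ↓ 0` (`exists_isCalderon_pw`); for the other, the maximum principle applies
to `z ↦ (T + ε) ^ (-z) f(z)` (`IsCalderon.exists_pw`). So it suffices to find an isomorphism `D`
of `H` such that the solution with trace `T ^ s h` has `-T ^ (1 - s) D h` as the limit of
`T (t ^ (1 - 2 s) g)`.

*Traces.* The pairs `(t ^ (1 - s) v, t ^ (1 - s) g)` with `(T v)' = g` form a closed subspace
`sobolevPairs T s` of `L²(dt / t) × L²(dt / t)`. Its traces are `T ^ s (τ z)` for a bounded operator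
`τ`, which has the bounded right inverse `h ↦ (t ↦ T ^ s (T + t)⁻¹ h)`
(`exists_trace_extension`). Boundedness comes from the square function estimate
`∫ ‖t ^ (1 - σ) T ^ σ (T + t)⁻¹ h‖² dt / t ≤ C ‖h‖²` (`integral_sq_le`), used with `σ = s`
for the extension and with `σ = 1 - s` for the trace.

*Existence.* The form `∫ (⟪·, A v⟫ + ⟪·, g⟫) t ^ (2 - 2 s) dt / t` on `sobolevPairs T s` is given by
a coercive operator `B`, and `τ B⁻¹ τ†` is again coercive because `τ` has a right inverse. Its inverse
is `D`, and `B⁻¹ τ† D h` is the solution (`exists_equiv_trace`). Testing with functions that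
do not vanish at `0` gives both the equation and the normal derivative
(`exists_dirichletToNeumann`).

*Uniqueness.* A solution with trace zero is tested with itself after smoothing by `T (T + ε)⁻¹`;
coercivity gives `v = 0` as `ε ↓ 0` (`ae_eq_zero_of_tendsto_zero`).
-/

namespace DtN

open MeasureTheory Set Filter Topology Complex
open scoped ContDiff InnerProductSpace

/-! ### Functional calculus of a positive operator -/

section FunctionalCalculus

variable {H : Type*} [NormedAddCommGroup H] [InnerProductSpace ℂ H] [CompleteSpace H]
  {T : H →L[ℂ] H} {f g : ℝ → ℂ}

/-- `f(T)` for a positive operator `T` and a function `f` on `[0, ∞)`, by the continuous functional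
calculus. -/
noncomputable def fc (T : H →L[ℂ] H) (f : ℝ → ℂ) : H →L[ℂ] H :=
  cfc (fun w : ℂ => f w.re) T

theorem mem_spectrum_of_nonneg (hT : 0 ≤ T) {w : ℂ} (hw : w ∈ spectrum ℂ T) :
    w.re ∈ Icc 0 ‖T‖ ∧ (w.re : ℂ) = w := by
  have hsa : IsSelfAdjoint T := .of_nonneg hT
  have h1 : w = (w.re : ℂ) := hsa.mem_spectrum_eq_re hw
  have h2 : w.re ∈ spectrum ℝ T := by
    rw [h1] at hw
    exact (spectrum.algebraMap_mem_iff ℂ).1 hw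
  refine ⟨⟨spectrum_nonneg_of_nonneg hT h2, ?_⟩, h1.symm⟩
  rcases subsingleton_or_nontrivial H with hH | hH
  · exact absurd hw (by simp [spectrum.of_subsingleton])
  · exact (re_le_norm w).trans (spectrum.norm_le_norm_of_mem hw)

theorem continuousOn_comp_re_spectrum (hT : 0 ≤ T) (hf : ContinuousOn f (Ici 0)) :
    ContinuousOn (fun w : ℂ => f w.re) (spectrum ℂ T) :=
  hf.comp continuous_re.continuousOn fun _ hw => (mem_spectrum_of_nonneg hT hw).1.1

theorem norm_fc_le (hT : 0 ≤ T) {c : ℝ} (hc : 0 ≤ c) (h : ∀ x ∈ Icc 0 ‖T‖, ‖f x‖ ≤ c) :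
    ‖fc T f‖ ≤ c :=
  norm_cfc_le hc fun _ hw => h _ (mem_spectrum_of_nonneg hT hw).1

theorem fc_congr (hT : 0 ≤ T) (h : ∀ x, 0 ≤ x → f x = g x) : fc T f = fc T g :=
  cfc_congr fun _ hw => h _ (mem_spectrum_of_nonneg hT hw).1.1

theorem fc_id (hT : 0 ≤ T) : fc T (fun x => x) = T := by
  have hn : IsStarNormal T := (IsSelfAdjoint.of_nonneg hT).isStarNormal
  rw [fc, cfc_congr (g := id) fun w hw => (mem_spectrum_of_nonneg hT hw).2, cfc_id ℂ T]

theorem fc_const (hT : 0 ≤ T) (c : ℂ) : fc T (fun _ => c) = c • 1 := by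
  have hn : IsStarNormal T := (IsSelfAdjoint.of_nonneg hT).isStarNormal
  rw [fc, cfc_const c T, Algebra.algebraMap_eq_smul_one]

theorem fc_mul (hT : 0 ≤ T) (hf : ContinuousOn f (Ici 0)) (hg : ContinuousOn g (Ici 0)) :
    fc T (fun x => f x * g x) = fc T f * fc T g :=
  cfc_mul (R := ℂ) _ _ T (continuousOn_comp_re_spectrum hT hf) (continuousOn_comp_re_spectrum hT hg)

theorem fc_add (hT : 0 ≤ T) (hf : ContinuousOn f (Ici 0)) (hg : ContinuousOn g (Ici 0)) :
    fc T (fun x => f x + g x) = fc T f + fc T g :=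
  cfc_add (R := ℂ) T _ _ (continuousOn_comp_re_spectrum hT hf) (continuousOn_comp_re_spectrum hT hg)

theorem fc_sub (hT : 0 ≤ T) (hf : ContinuousOn f (Ici 0)) (hg : ContinuousOn g (Ici 0)) :
    fc T (fun x => f x - g x) = fc T f - fc T g :=
  cfc_sub (R := ℂ) _ _ T (continuousOn_comp_re_spectrum hT hf) (continuousOn_comp_re_spectrum hT hg)

theorem fc_const_mul (hT : 0 ≤ T) (c : ℂ) (hf : ContinuousOn f (Ici 0)) :
    fc T (fun x => c * f x) = c • fc T f :=
  cfc_const_mul (R := ℂ) c _ T (continuousOn_comp_re_spectrum hT hf)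

theorem fc_adjoint (f : ℝ → ℂ) (hf : ∀ x, star (f x) = f x) : star (fc T f) = fc T f := by
  rw [fc, ← cfc_star]
  simp only [hf]

theorem fc_inner (f : ℝ → ℂ) (hf : ∀ x, star (f x) = f x) (x y : H) :
    ⟪fc T f x, y⟫_ℂ = ⟪x, fc T f y⟫_ℂ := by
  have h := fc_adjoint (T := T) f hf
  rw [ContinuousLinearMap.star_eq_adjoint] at h
  conv_lhs => rw [← h]
  exact ContinuousLinearMap.adjoint_inner_left _ _ _

theorem fc_exp (hT : 0 ≤ T) (hf : ContinuousOn f (Ici 0)) :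
    NormedSpace.exp (fc T f) = fc T (fun x => exp (f x)) := by
  have hn : IsStarNormal (fc T f) := cfc_predicate _ _
  have hn' : IsStarNormal T := (IsSelfAdjoint.of_nonneg hT).isStarNormal
  rw [← CFC.complex_exp_eq_normedSpace_exp hn, fc, fc]
  exact (cfc_comp' (R := ℂ) exp _ T (by fun_prop) (continuousOn_comp_re_spectrum hT hf)).symm

/-- Uniformly bounded operators that converge pointwise on a dense range converge pointwise. -/
theorem tendsto_of_tendsto_denseRange {ι E F G : Type*} [NormedAddCommGroup E] [NormedSpace ℂ E]
    [NormedAddCommGroup F] [NormedSpace ℂ F] {S : G → E} (hS : DenseRange S) {l : Filter ι}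
    {A : ι → E →L[ℂ] F} {B : E →L[ℂ] F} {C : ℝ} (hA : ∀ᶠ i in l, ‖A i‖ ≤ C)
    (h : ∀ y, Tendsto (fun i => A i (S y)) l (𝓝 (B (S y)))) (x : E) :
    Tendsto (fun i => A i x) l (𝓝 (B x)) := by
  rw [Metric.tendsto_nhds]
  intro ε hε
  have hK : 0 < |C| + ‖B‖ + 1 := by positivity
  obtain ⟨y, hy⟩ := hS.exists_dist_lt x (ε := ε / 2 / (|C| + ‖B‖ + 1)) (by positivity)
  rw [dist_eq_norm, lt_div_iff₀ hK] at hy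
  filter_upwards [hA, (Metric.tendsto_nhds.1 (h y)) (ε / 2) (by positivity)] with i hi hi'
  rw [dist_eq_norm] at hi' ⊢
  have e : A i x - B x = A i (x - S y) + (A i (S y) - B (S y)) - B (x - S y) := by
    simp only [map_sub]; abel
  have h1 : ‖A i (x - S y)‖ ≤ |C| * ‖x - S y‖ :=
    (A i).le_of_opNorm_le (hi.trans (le_abs_self C)) _
  have h2 := B.le_opNorm (x - S y)
  have h3 := norm_sub_le (A i (x - S y) + (A i (S y) - B (S y))) (B (x - S y))
  have h4 := norm_add_le (A i (x - S y)) (A i (S y) - B (S y))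
  rw [e]
  nlinarith [norm_nonneg (x - S y)]

/-! ### Powers and resolvents -/

/-- The power `T ^ σ`, for `σ > 0`. -/
noncomputable def pw (T : H →L[ℂ] H) (σ : ℝ) : H →L[ℂ] H :=
  fc T (fun x => ((x ^ σ : ℝ) : ℂ))

/-- The resolvent `(T + t)⁻¹`, for `t > 0`. -/
noncomputable def rs (T : H →L[ℂ] H) (t : ℝ) : H →L[ℂ] H :=
  fc T (fun x => (((x + t)⁻¹ : ℝ) : ℂ))

theorem continuousOn_pw {σ : ℝ} (hσ : 0 ≤ σ) :
    ContinuousOn (fun x : ℝ => ((x ^ σ : ℝ) : ℂ)) (Ici 0) :=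
  (continuous_ofReal.comp (Real.continuous_rpow_const hσ)).continuousOn

theorem continuousOn_rs {t : ℝ} (ht : 0 < t) :
    ContinuousOn (fun x : ℝ => (((x + t)⁻¹ : ℝ) : ℂ)) (Ici 0) := by
  refine continuous_ofReal.comp_continuousOn (ContinuousOn.inv₀ (by fun_prop) ?_)
  intro x hx
  have : (0 : ℝ) ≤ x := hx
  positivity

theorem pw_add (hT : 0 ≤ T) {σ τ : ℝ} (hσ : 0 < σ) (hτ : 0 < τ) :
    pw T (σ + τ) = pw T σ * pw T τ := by
  rw [pw, pw, pw, ← fc_mul hT (continuousOn_pw hσ.le) (continuousOn_pw hτ.le)]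
  refine fc_congr hT fun x hx => ?_
  rw [Real.rpow_add_of_nonneg hx hσ.le hτ.le]; push_cast; rfl

theorem pw_one (hT : 0 ≤ T) : pw T 1 = T := by
  simpa [pw] using fc_id hT

theorem pw_inner (σ : ℝ) (x y : H) : ⟪pw T σ x, y⟫_ℂ = ⟪x, pw T σ y⟫_ℂ :=
  fc_inner _ (fun x => by simp) x y

theorem rs_inner (t : ℝ) (x y : H) : ⟪rs T t x, y⟫_ℂ = ⟪x, rs T t y⟫_ℂ :=
  fc_inner _ (fun x => by simp) x y

theorem inner_of_nonneg (hT : 0 ≤ T) (x y : H) : ⟪T x, y⟫_ℂ = ⟪x, T y⟫_ℂ := by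
  simpa [pw_one hT] using pw_inner (T := T) 1 x y

theorem pw_injective (hT : 0 ≤ T) (hinj : Function.Injective T) {σ : ℝ} (hσ : σ ∈ Ioo (0 : ℝ) 1) :
    Function.Injective (pw T σ) := by
  have h : T = pw T (1 - σ) * pw T σ := by
    rw [← pw_add hT (by linarith [hσ.2]) hσ.1, sub_add_cancel, pw_one hT]
  intro x y hxy
  apply hinj
  rw [h]
  exact congrArg (pw T (1 - σ)) hxy

/-- A symmetric injective operator has dense range. -/
theorem denseRange_of_symmetric {S : H →L[ℂ] H} (hS : ∀ x y, ⟪S x, y⟫_ℂ = ⟪x, S y⟫_ℂ)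
    (hinj : Function.Injective S) : DenseRange S := by
  have h : (LinearMap.range S.toLinearMap).topologicalClosure = ⊤ := by
    rw [Submodule.topologicalClosure_eq_top_iff, Submodule.eq_bot_iff]
    intro x hx
    apply hinj
    rw [map_zero, ← inner_self_eq_zero (𝕜 := ℂ)]
    rw [hS]
    exact (Submodule.mem_orthogonal' _ _).1 hx _ ⟨S x, rfl⟩
  have := (Submodule.dense_iff_topologicalClosure_eq_top).2 h
  exact this

theorem pw_comm_rs {σ t : ℝ} (x : H) :
    pw T σ (rs T t x) = rs T t (pw T σ x) :=
  congrArg (fun A : H →L[ℂ] H => A x) (cfc_commute_cfc (R := ℂ) _ _ T).eq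

theorem T_comm_rs (hT : 0 ≤ T) {t : ℝ} (x : H) : T (rs T t x) = rs T t (T x) := by
  simpa [pw_one hT] using pw_comm_rs (T := T) (σ := 1) (t := t) x

theorem rs_add_smul (hT : 0 ≤ T) {t : ℝ} (ht : 0 < t) (x : H) :
    T (rs T t x) + (t : ℂ) • rs T t x = x := by
  have h : fc T (fun x : ℝ => ((x : ℂ) * ((x + t)⁻¹ : ℝ) + (t : ℂ) * ((x + t)⁻¹ : ℝ))) = 1 := by
    rw [fc_congr hT (g := fun _ => 1), fc_const hT, one_smul]
    intro y hy
    have : ((y : ℂ) + t) ≠ 0 := by exact_mod_cast (by positivity : y + t ≠ 0)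
    push_cast
    field_simp
  have hid : ContinuousOn (fun x : ℝ => (x : ℂ)) (Ici 0) := continuous_ofReal.continuousOn
  rw [fc_add hT (hid.fun_mul (continuousOn_rs ht)) (continuousOn_const.fun_mul (continuousOn_rs ht)),
    fc_mul hT hid (continuousOn_rs ht), fc_const_mul hT _ (continuousOn_rs ht), fc_id hT] at h
  exact congrArg (fun A : H →L[ℂ] H => A x) h

theorem norm_T_rs_le (hT : 0 ≤ T) {t : ℝ} (ht : 0 < t) : ‖T * rs T t‖ ≤ 1 := by
  have h : T * rs T t = fc T (fun x : ℝ => (x : ℂ) * ((x + t)⁻¹ : ℝ)) := by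
    rw [fc_mul hT continuous_ofReal.continuousOn (continuousOn_rs ht), fc_id hT]; rfl
  rw [h]
  refine norm_fc_le hT zero_le_one fun x hx => ?_
  have hx0 : 0 ≤ x := hx.1
  rw [← ofReal_mul, norm_real, Real.norm_of_nonneg (by positivity), ← div_eq_mul_inv]
  exact div_le_one_of_le₀ (by linarith) (by positivity)

/-- `T (T + t)⁻¹ → 1` strongly as `t ↓ 0`. -/
theorem tendsto_T_rs (hT : 0 ≤ T) (hinj : Function.Injective T) (x : H) :
    Tendsto (fun t => T (rs T t x)) (𝓝[>] 0) (𝓝 x) := by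
  refine tendsto_of_tendsto_denseRange (A := fun t => T * rs T t)
    (B := ContinuousLinearMap.id ℂ H) (C := 1)
    (denseRange_of_symmetric (inner_of_nonneg hT) hinj) ?_ ?_ x
  · filter_upwards [self_mem_nhdsWithin] with t ht using norm_T_rs_le hT ht
  -- on the range of `T` the error is `-t T (T + t)⁻¹ y`
  · intro y
    rw [tendsto_iff_norm_sub_tendsto_zero]
    have h0 : Tendsto (fun t : ℝ => t * ‖y‖) (𝓝[>] 0) (𝓝 0) := by
      have : Tendsto (fun t : ℝ => t * ‖y‖) (𝓝 0) (𝓝 (0 * ‖y‖)) := tendsto_id.mul_const _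
      rw [zero_mul] at this
      exact this.mono_left nhdsWithin_le_nhds
    refine squeeze_zero' (Eventually.of_forall fun _ => norm_nonneg _) ?_ h0
    filter_upwards [self_mem_nhdsWithin] with t ht
    have ht0 : (0 : ℝ) < t := ht
    have e : (T * rs T t) (T y) - (ContinuousLinearMap.id ℂ H) (T y)
        = -((t : ℂ) • (T * rs T t) y) := by
      have := rs_add_smul hT ht0 (T y)
      change T (rs T t (T y)) - T y = -((t : ℂ) • T (rs T t y))
      rw [T_comm_rs hT (t := t) y, sub_eq_iff_eq_add', ← sub_eq_add_neg, eq_sub_iff_add_eq]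
      exact this
    rw [e, norm_neg, norm_smul, norm_real, Real.norm_of_nonneg ht0.le]
    gcongr
    exact ((T * rs T t).le_of_opNorm_le (norm_T_rs_le hT ht0) y).trans (one_mul _).le

/-- The remainder is `(r - t)² (T + r)⁻¹ (T + t)⁻²`, by the functional calculus. -/
theorem hasDerivAt_rs (hT : 0 ≤ T) {t : ℝ} (ht : 0 < t) :
    HasDerivAt (fun r => rs T r) (-(rs T t * rs T t)) t := by
  rw [hasDerivAt_iff_isLittleO]
  have hO : (fun r => rs T r - rs T t - (r - t) • -(rs T t * rs T t))
      =O[𝓝 t] fun r => (r - t) * (r - t) := by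
    refine Asymptotics.IsBigO.of_bound ((t / 2)⁻¹ * t⁻¹ * t⁻¹) ?_
    filter_upwards [Ioi_mem_nhds (half_lt_self ht)] with r hr
    have hr' : t / 2 < r := hr
    have hr0 : 0 < r := by linarith
    have e : rs T r - rs T t - (r - t) • -(rs T t * rs T t)
        = fc T (fun x => ((((r - t) * (r - t)) * ((x + r)⁻¹ * (x + t)⁻¹ * (x + t)⁻¹) : ℝ) : ℂ)) := by
      have c1 := continuousOn_rs hr0
      have c2 := continuousOn_rs ht
      have h1 : (r - t) • -(rs T t * rs T t)
          = ((-(r - t) : ℝ) : ℂ) • fc T (fun x : ℝ => (((x + t)⁻¹ : ℝ) : ℂ) * ((x + t)⁻¹ : ℝ)) := by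
        rw [fc_mul hT c2 c2, smul_neg, coe_smul, neg_smul]; rfl
      rw [h1, ← fc_const_mul hT _ (c2.fun_mul c2), rs, rs, ← fc_sub hT c1 c2,
        ← fc_sub hT (c1.fun_sub c2) (continuousOn_const.fun_mul (c2.fun_mul c2))]
      refine fc_congr hT fun x hx => ?_
      have h1 : x + r ≠ 0 := by positivity
      have h2 : x + t ≠ 0 := by positivity
      rw [← ofReal_sub, ← ofReal_mul, ← ofReal_mul, ← ofReal_sub]
      congr 1
      field_simp
      ring
    rw [e]
    refine norm_fc_le hT (by positivity) fun x hx => ?_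
    have hx0 : 0 ≤ x := hx.1
    rw [norm_real, norm_mul, mul_comm ‖(r - t) * (r - t)‖]
    gcongr
    rw [Real.norm_of_nonneg (by positivity)]
    gcongr <;> linarith
  refine hO.trans_isLittleO ?_
  have : (fun r => r - t) =o[𝓝 t] fun _ => (1 : ℝ) := by
    rw [Asymptotics.isLittleO_one_iff]
    have : Tendsto (fun r => r - t) (𝓝 t) (𝓝 (t - t)) := tendsto_id.sub_const t
    rwa [sub_self] at this
  simpa using this.mul_isBigO (Asymptotics.isBigO_refl (fun r => r - t) (𝓝 t))

theorem continuousOn_rs_param (hT : 0 ≤ T) : ContinuousOn (fun t => rs T t) (Ioi 0) :=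
  fun _ ht => (hasDerivAt_rs hT ht).continuousAt.continuousWithinAt

end FunctionalCalculus

/-! ### Interpolation between a Hilbert space and the range of a positive operator -/

section InterpolationOfPowers

variable {H : Type*} [NormedAddCommGroup H] [InnerProductSpace ℂ H] [CompleteSpace H]
  {T : H →L[ℂ] H}

/-- The regularized complex power `(T + ε) ^ z`, which is entire in `z` for `ε > 0`. -/
noncomputable def epw (T : H →L[ℂ] H) (ε : ℝ) (z : ℂ) : H →L[ℂ] H :=
  NormedSpace.exp (z • fc T fun x => (Real.log (x + ε) : ℂ))

theorem continuousOn_log_add {ε : ℝ} (hε : 0 < ε) :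
    ContinuousOn (fun x : ℝ => (Real.log (x + ε) : ℂ)) (Ici 0) := by
  refine continuous_ofReal.comp_continuousOn (ContinuousOn.log (by fun_prop) ?_)
  intro x hx
  have : (0 : ℝ) ≤ x := hx
  positivity

theorem continuousOn_exp_log {ε : ℝ} (hε : 0 < ε) (z : ℂ) :
    ContinuousOn (fun x : ℝ => exp (z * (Real.log (x + ε) : ℂ))) (Ici 0) :=
  continuous_exp.comp_continuousOn (continuousOn_const.mul (continuousOn_log_add hε))

theorem epw_eq (hT : 0 ≤ T) {ε : ℝ} (hε : 0 < ε) (z : ℂ) :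
    epw T ε z = fc T fun x => exp (z * (Real.log (x + ε) : ℂ)) := by
  rw [epw, ← fc_const_mul hT _ (continuousOn_log_add hε),
    fc_exp hT (continuousOn_const.fun_mul (continuousOn_log_add hε))]

theorem differentiable_epw (ε : ℝ) : Differentiable ℂ (epw T ε) := fun z =>
  (hasDerivAt_exp_smul_const (𝕂 := ℂ) (fc T fun x => (Real.log (x + ε) : ℂ)) z).differentiableAt

theorem epw_mul (hT : 0 ≤ T) {ε : ℝ} (hε : 0 < ε) (z w : ℂ) :
    epw T ε (z + w) = epw T ε z * epw T ε w := by
  rw [epw_eq hT hε, epw_eq hT hε, epw_eq hT hε,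
    ← fc_mul hT (continuousOn_exp_log hε z) (continuousOn_exp_log hε w)]
  simp only [add_mul, exp_add]

theorem epw_zero (ε : ℝ) : epw T ε 0 = 1 := by simp [epw, NormedSpace.exp_zero]

theorem epw_one (hT : 0 ≤ T) {ε : ℝ} (hε : 0 < ε) : epw T ε 1 = T + (ε : ℂ) • 1 := by
  rw [epw_eq hT hε, fc_congr hT (g := fun x => (x : ℂ) + ε),
    fc_add hT continuous_ofReal.continuousOn continuousOn_const, fc_id hT, fc_const hT]
  intro x hx
  rw [one_mul, ← ofReal_exp, Real.exp_log (by positivity)]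
  push_cast; rfl

theorem norm_exp_mul_log_le {z : ℂ} (hz : z.re ∈ Icc (0 : ℝ) 1) {y K : ℝ} (hy : 0 < y)
    (hyK : y ≤ K) (hK : 1 ≤ K) : ‖exp (z * (Real.log y : ℂ))‖ ≤ K := by
  rw [norm_exp, re_mul_ofReal]
  have h0 : 0 ≤ Real.log K := Real.log_nonneg hK
  have h1 : Real.log y ≤ Real.log K := Real.log_le_log hy hyK
  calc Real.exp (z.re * Real.log y) ≤ Real.exp (Real.log K) := by
        gcongr
        nlinarith [hz.1, hz.2, mul_le_mul_of_nonneg_left h1 hz.1]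
    _ = K := Real.exp_log (by linarith)

theorem norm_epw_le (hT : 0 ≤ T) {ε : ℝ} (hε : ε ∈ Ioc (0 : ℝ) 1) {z : ℂ}
    (hz : z.re ∈ Icc (0 : ℝ) 1) : ‖epw T ε z‖ ≤ ‖T‖ + 1 := by
  rw [epw_eq hT hε.1]
  refine norm_fc_le hT (by positivity) fun x hx => ?_
  exact norm_exp_mul_log_le hz (by linarith [hx.1, hε.1]) (by linarith [hx.2, hε.2])
    (by linarith [norm_nonneg T])

theorem norm_epw_le_one (hT : 0 ≤ T) {ε : ℝ} (hε : 0 < ε) {z : ℂ} (hz : z.re = 0) :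
    ‖epw T ε z‖ ≤ 1 := by
  rw [epw_eq hT hε]
  refine norm_fc_le hT zero_le_one fun x _ => ?_
  rw [norm_exp, re_mul_ofReal, hz, zero_mul, Real.exp_zero]

theorem norm_epw_neg_mul_le (hT : 0 ≤ T) {ε : ℝ} (hε : 0 < ε) {z : ℂ} (hz : z.re = 1) :
    ‖epw T ε (-z) * T‖ ≤ 1 := by
  have e : epw T ε (-z) * T = fc T fun x => exp (-z * (Real.log (x + ε) : ℂ)) * x := by
    rw [fc_mul hT (continuousOn_exp_log hε _) continuous_ofReal.continuousOn, fc_id hT,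
      epw_eq hT hε]
  rw [e]
  refine norm_fc_le hT zero_le_one fun x hx => ?_
  have hx0 : 0 ≤ x := hx.1
  rw [norm_mul, norm_exp, re_mul_ofReal, neg_re, hz, neg_one_mul, Real.exp_neg,
    Real.exp_log (by positivity), norm_real, Real.norm_of_nonneg hx0, inv_mul_eq_div]
  exact div_le_one_of_le₀ (by linarith) (by positivity)

/-- The regularized powers depend continuously on `ε` after multiplication with `T`, uniformly for
`z` in bounded subsets of the closed strip. -/
theorem norm_epw_sub_mul_le (hT : 0 ≤ T) {ε δ : ℝ} (hε : ε ∈ Ioc (0 : ℝ) 1)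
    (hδ : δ ∈ Ioc (0 : ℝ) 1) {z : ℂ} (hz : z.re ∈ Icc (0 : ℝ) 1) :
    ‖(epw T ε z - epw T δ z) * T‖ ≤ ‖z‖ * (‖T‖ + 1) * |ε - δ| := by
  have e : (epw T ε z - epw T δ z) * T
      = fc T fun x => (exp (z * (Real.log (x + ε) : ℂ)) - exp (z * (Real.log (x + δ) : ℂ))) * x := by
    rw [fc_mul hT ((continuousOn_exp_log hε.1 _).fun_sub (continuousOn_exp_log hδ.1 _))
      continuous_ofReal.continuousOn, fc_id hT,
      fc_sub hT (continuousOn_exp_log hε.1 _) (continuousOn_exp_log hδ.1 _),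
      epw_eq hT hε.1, epw_eq hT hδ.1]
  rw [e]
  refine norm_fc_le hT (by positivity) fun x hx => ?_
  have hx0 : 0 ≤ x := hx.1
  have hd : ∀ r ∈ Ioc (0 : ℝ) 1,
      HasDerivWithinAt (fun r : ℝ => exp (z * (Real.log (x + r) : ℂ)) * x)
        (exp (z * (Real.log (x + r) : ℂ)) * (z * ((x + r)⁻¹ : ℝ)) * x) (Ioc 0 1) r := by
    intro r hr
    have h1 : HasDerivAt (fun r : ℝ => Real.log (x + r)) ((x + r)⁻¹) r := by
      simpa using ((hasDerivAt_id r).const_add x).log (by have := hr.1; positivity)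
    exact (((h1.ofReal_comp.const_mul z).cexp).mul_const (x : ℂ)).hasDerivWithinAt
  have hb : ∀ r ∈ Ioc (0 : ℝ) 1,
      ‖exp (z * (Real.log (x + r) : ℂ)) * (z * ((x + r)⁻¹ : ℝ)) * x‖ ≤ ‖z‖ * (‖T‖ + 1) := by
    intro r hr
    have hr0 := hr.1
    have h2 := norm_exp_mul_log_le hz (y := x + r) (K := ‖T‖ + 1) (by positivity)
      (by linarith [hx.2, hr.2]) (by linarith [norm_nonneg T])
    rw [norm_mul, norm_mul, norm_mul, norm_real, norm_real, Real.norm_of_nonneg hx0,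
      Real.norm_of_nonneg (by positivity)]
    have h3 : (x + r)⁻¹ * x ≤ 1 := by
      rw [inv_mul_eq_div]; exact div_le_one_of_le₀ (by linarith) (by positivity)
    calc ‖exp (z * (Real.log (x + r) : ℂ))‖ * (‖z‖ * (x + r)⁻¹) * x
        = (‖z‖ * ‖exp (z * (Real.log (x + r) : ℂ))‖) * ((x + r)⁻¹ * x) := by ring
      _ ≤ (‖z‖ * (‖T‖ + 1)) * 1 := by gcongr
      _ = _ := mul_one _
  have := (convex_Ioc (0 : ℝ) 1).norm_image_sub_le_of_norm_hasDerivWithin_le hd hb hδ hε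
  rwa [← sub_mul] at this

/-- Norm convergence, from `|(x + ε) ^ θ - x ^ θ| ≤ ε ^ θ` on `[0, ∞)`. -/
theorem tendsto_epw (hT : 0 ≤ T) {θ : ℝ} (hθ : θ ∈ Ioo (0 : ℝ) 1) :
    Tendsto (fun ε => epw T ε θ) (𝓝[>] 0) (𝓝 (pw T θ)) := by
  rw [tendsto_iff_norm_sub_tendsto_zero]
  have h0 : Tendsto (fun t : ℝ => t ^ θ) (𝓝[>] 0) (𝓝 0) := by
    have := (Real.continuous_rpow_const hθ.1.le).tendsto 0
    rw [Real.zero_rpow hθ.1.ne'] at this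
    exact this.mono_left nhdsWithin_le_nhds
  refine squeeze_zero' (Eventually.of_forall fun _ => norm_nonneg _) ?_ h0
  filter_upwards [self_mem_nhdsWithin] with ε hε
  have hε' : (0 : ℝ) < ε := hε
  rw [epw_eq hT hε', pw, ← fc_sub hT (continuousOn_exp_log hε' _) (continuousOn_pw hθ.1.le)]
  refine norm_fc_le hT (by positivity) fun x hx => ?_
  have hx0 : 0 ≤ x := hx.1
  have e : exp ((θ : ℂ) * (Real.log (x + ε) : ℂ)) = (((x + ε) ^ θ : ℝ) : ℂ) := by
    rw [Real.rpow_def_of_pos (by positivity)]; push_cast; rw [mul_comm]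
  rw [e, ← ofReal_sub, norm_real, Real.norm_of_nonneg]
  · have := Real.rpow_add_le_add_rpow hx0 hε'.le hθ.1.le hθ.2.le
    linarith
  · have : x ^ θ ≤ (x + ε) ^ θ := by gcongr; linarith [hθ.1]; linarith
    linarith

/-- A vector `x` with `|⟨x, k⟩| ≤ M ‖S k‖` lies in the range of the symmetric operator `S`: the
functional `S k ↦ ⟨x, k⟩` is bounded and extends to `H`. -/
theorem exists_preimage_of_norm_inner_le {S : H →L[ℂ] H} (hS : ∀ x y, ⟪S x, y⟫_ℂ = ⟪x, S y⟫_ℂ)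
    (hinj : Function.Injective S) {x : H} {M : ℝ} (hM : 0 ≤ M)
    (h : ∀ k, ‖⟪x, k⟫_ℂ‖ ≤ M * ‖S k‖) : ∃ y, ‖y‖ ≤ M ∧ S y = x := by
  let e := LinearEquiv.ofInjective S.toLinearMap hinj
  let φ : LinearMap.range S.toLinearMap →ₗ[ℂ] ℂ := (innerSL ℂ x).toLinearMap ∘ₗ e.symm.toLinearMap
  have hφ : ∀ z, ‖φ z‖ ≤ M * ‖z‖ := by
    intro z
    obtain ⟨k, rfl⟩ := e.surjective z
    simpa [φ, e] using h k
  obtain ⟨g, hg, hgn⟩ := exists_extension_norm_eq _ (φ.mkContinuous M hφ)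
  refine ⟨(InnerProductSpace.toDual ℂ H).symm g, ?_, ?_⟩
  · rw [LinearIsometryEquiv.norm_map, hgn]
    exact φ.mkContinuous_norm_le hM hφ
  · refine ext_inner_right ℂ fun k => ?_
    rw [hS, InnerProductSpace.toDual_symm_apply]
    have := hg (e k)
    simpa [φ, e] using this

/-- Elements of `[H, T H]_θ` lie in the range of `T ^ θ`: apply the maximum principle to
`(T + ε) ^ (-z) f(z)` and let `ε ↓ 0`. -/
theorem IsCalderon.exists_pw (hT : 0 ≤ T) (hinj : Function.Injective T) {M : ℝ} {f : ℂ → H}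
    (hf : IsCalderon (ContinuousLinearMap.id ℂ H) T M f) {θ : ℝ} (hθ : θ ∈ Ioo (0 : ℝ) 1) :
    ∃ h, ‖h‖ ≤ 2 * M ∧ pw T θ h = f θ := by
  have hM := hf.nonneg
  have key : ∀ ε ∈ Ioc (0 : ℝ) 1, ‖epw T ε (-θ) (f θ)‖ ≤ 2 * M := by
    intro ε hε
    have hd : Differentiable ℂ fun z => epw T ε (-z) :=
      (differentiable_epw (T := T) ε).comp (differentiable_id.neg : Differentiable ℂ fun z : ℂ => -z)
    obtain ⟨a, ha, ha', ha''⟩ := hf.left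
    obtain ⟨b, hb, hb', hb''⟩ := hf.right
    obtain ⟨C, hC⟩ := hf.bounded
    have hC0 : 0 ≤ C := (norm_nonneg _).trans (hC 0 (by simp))
    have hinv : ∀ z : ℂ, z.re ∈ Icc (0 : ℝ) 1 → ‖epw T ε (-z)‖ ≤ 1 + ε⁻¹ := by
      intro z hz
      rw [epw_eq hT hε.1]
      refine norm_fc_le hT (by have := hε.1; positivity) fun x hx => ?_
      have hx0 : 0 < x + ε := by linarith [hx.1, hε.1]
      have : exp (-z * (Real.log (x + ε) : ℂ)) = exp (z * (Real.log ((x + ε)⁻¹) : ℂ)) := by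
        rw [Real.log_inv]; push_cast; ring_nf
      rw [this]
      refine norm_exp_mul_log_le hz (by positivity) ?_ (by have := hε.1; simp; positivity)
      have : (x + ε)⁻¹ ≤ ε⁻¹ := inv_anti₀ hε.1 (by linarith [hx.1])
      linarith
    have hΦ : IsCalderon (ContinuousLinearMap.id ℂ H) (ContinuousLinearMap.id ℂ H) M
        (fun z => epw T ε (-z) (f z)) := by
      refine ⟨hd.continuous.continuousOn.clm_apply hf.continuousOn,
        hd.differentiableOn.clm_apply hf.differentiableOn, ⟨(1 + ε⁻¹) * C, fun z hz => ?_⟩,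
        ⟨fun t => epw T ε (-(t * I)) (a t), ?_, fun t => ?_, fun t => ?_⟩,
        ⟨fun t => (epw T ε (-(1 + t * I)) * T) (b t), ?_, fun t => ?_, fun t => ?_⟩⟩
      · exact (epw T ε (-z)).le_of_opNorm_le_of_le (hinv z hz) (hC z hz)
      · exact (hd.continuous.comp (by fun_prop : Continuous fun t : ℝ => (t : ℂ) * I)).clm_apply ha
      · simp only [ha']; rfl
      · refine ((epw T ε (-(t * I))).le_of_opNorm_le_of_le
          (norm_epw_le_one hT hε.1 (by simp)) (ha'' t)).trans (one_mul M).le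
      · have h1 := hd.continuous.comp (by fun_prop : Continuous fun t : ℝ => 1 + (t : ℂ) * I)
        exact h1.clm_apply (T.continuous.comp hb)
      · simp only [hb']; rfl
      · refine ((epw T ε (-(1 + t * I)) * T).le_of_opNorm_le_of_le
          (norm_epw_neg_mul_le hT hε.1 (by simp)) (hb'' t)).trans (one_mul M).le
    -- the maximum principle costs the factor `‖id‖ + ‖id‖ ≤ 2`
    refine (hΦ.norm_le hθ).trans ?_
    have : ‖ContinuousLinearMap.id ℂ H‖ ≤ 1 := ContinuousLinearMap.norm_id_le
    gcongr
    linarith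
  refine exists_preimage_of_norm_inner_le (pw_inner θ) (pw_injective hT hinj hθ) (by positivity)
    fun k => ?_
  have hlim : Tendsto (fun ε => 2 * M * ‖epw T ε θ k‖) (𝓝[>] 0) (𝓝 (2 * M * ‖pw T θ k‖)) := by
    have := ((ContinuousLinearMap.apply ℂ H k).continuous.tendsto _).comp (tendsto_epw hT hθ)
    exact this.norm.const_mul _
  refine ge_of_tendsto hlim ?_
  filter_upwards [Ioc_mem_nhdsGT zero_lt_one] with ε hε
  have e1 : f θ = epw T ε θ (epw T ε (-θ) (f θ)) := by
    have := epw_mul (T := T) hT hε.1 θ (-θ)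
    rw [add_neg_cancel, epw_zero] at this
    exact congrArg (fun A : H →L[ℂ] H => A (f θ)) this
  have e2 : ∀ x y, ⟪epw T ε θ x, y⟫_ℂ = ⟪x, epw T ε θ y⟫_ℂ := by
    rw [epw_eq hT hε.1]
    refine fc_inner _ fun x => ?_
    rw [← ofReal_mul, ← ofReal_exp]
    exact conj_ofReal _
  rw [e1, e2]
  refine (norm_inner_le_norm _ _).trans ?_
  gcongr
  exact key ε hε

/-- The functions `z ↦ (T + ε) ^ z h` converge locally uniformly on the closed strip as `ε ↓ 0`; the
limit is the function `z ↦ T ^ z h`, which witnesses that `T ^ θ h` lies in `[H, T H]_θ`. -/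
theorem exists_isCalderon_pw (hT : 0 ≤ T) (hinj : Function.Injective T) (h : H) {θ : ℝ}
    (hθ : θ ∈ Ioo (0 : ℝ) 1) :
    ∃ f, IsCalderon (ContinuousLinearMap.id ℂ H) T ‖h‖ f ∧ f θ = pw T θ h := by
  have hdense := denseRange_of_symmetric (inner_of_nonneg hT) hinj
  let ε : ℕ → ℝ := fun n => 1 / ((n : ℝ) + 1)
  have hε : ∀ n, ε n ∈ Ioc (0 : ℝ) 1 := fun n =>
    ⟨by positivity, div_le_one_of_le₀ (by simp) (by positivity)⟩
  have hε0 : Tendsto ε atTop (𝓝 0) := tendsto_one_div_add_atTop_nhds_zero_nat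
  have hε' : Tendsto ε atTop (𝓝[>] 0) :=
    tendsto_nhdsWithin_iff.2 ⟨hε0, Eventually.of_forall fun n => (hε n).1⟩
  let F : ℕ → ℂ → H := fun n z => epw T (ε n) z h
  let S : Set ℂ := re ⁻¹' Icc (0 : ℝ) 1
  have hC : ∀ R > 0, UniformCauchySeqOn F atTop (S ∩ Metric.ball 0 R) := by
    intro R hR
    rw [Metric.uniformCauchySeqOn_iff]
    intro η hη
    have hK : 0 < ‖T‖ + 1 := by positivity
    -- approximate `h` by `T y`, for which the powers are Lipschitz continuous in `ε`
    obtain ⟨y, hy⟩ := hdense.exists_dist_lt h (ε := η / 4 / (‖T‖ + 1)) (by positivity)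
    rw [dist_eq_norm, lt_div_iff₀ hK] at hy
    have hK' : 0 < R * (‖T‖ + 1) * ‖y‖ + 1 := by positivity
    obtain ⟨N, hN⟩ := (Metric.cauchySeq_iff.1 hε0.cauchySeq)
      (η / 4 / (R * (‖T‖ + 1) * ‖y‖ + 1)) (by positivity)
    refine ⟨N, fun m hm n hn z hz => ?_⟩
    have h1 := hN m hm n hn
    rw [Real.dist_eq, lt_div_iff₀ hK'] at h1
    have hzR : ‖z‖ ≤ R := (mem_ball_zero_iff.1 hz.2).le
    rw [dist_eq_norm]
    have e : F m z - F n z = epw T (ε m) z (h - T y) - epw T (ε n) z (h - T y)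
        + ((epw T (ε m) z - epw T (ε n) z) * T) y := by
      simp only [F, map_sub, mul_apply_eq_comp, sub_apply]
      abel
    have b1 := (epw T (ε m) z).le_of_opNorm_le (norm_epw_le hT (hε m) hz.1) (h - T y)
    have b2 := (epw T (ε n) z).le_of_opNorm_le (norm_epw_le hT (hε n) hz.1) (h - T y)
    have b3 := ((epw T (ε m) z - epw T (ε n) z) * T).le_of_opNorm_le
      (norm_epw_sub_mul_le hT (hε m) (hε n) hz.1) y
    have b4 : ‖z‖ * (‖T‖ + 1) * |ε m - ε n| * ‖y‖ ≤ R * (‖T‖ + 1) * ‖y‖ * |ε m - ε n| := by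
      calc ‖z‖ * (‖T‖ + 1) * |ε m - ε n| * ‖y‖ ≤ R * (‖T‖ + 1) * |ε m - ε n| * ‖y‖ := by gcongr
        _ = _ := by ring
    have b5 := norm_add_le (epw T (ε m) z (h - T y) - epw T (ε n) z (h - T y))
      (((epw T (ε m) z - epw T (ε n) z) * T) y)
    have b6 := norm_sub_le (epw T (ε m) z (h - T y)) (epw T (ε n) z (h - T y))
    rw [e]
    nlinarith [abs_nonneg (ε m - ε n)]
  have hlim : ∀ z, ∃ x, z ∈ S → Tendsto (fun n => F n z) atTop (𝓝 x) := by
    intro z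
    by_cases hz : z ∈ S
    · have hc : CauchySeq fun n => F n z := by
        refine (hC (‖z‖ + 1) (by positivity)).cauchySeq ⟨hz, ?_⟩
        simp
      obtain ⟨x, hx⟩ := cauchySeq_tendsto_of_complete hc
      exact ⟨x, fun _ => hx⟩
    · exact ⟨0, fun h => absurd h hz⟩
  choose f hf using hlim
  have hloc : TendstoLocallyUniformlyOn F f atTop S := by
    intro u hu z hz
    refine ⟨S ∩ Metric.ball 0 (‖z‖ + 1), inter_mem_nhdsWithin _
      (Metric.isOpen_ball.mem_nhds (by simp)), ?_⟩
    exact (hC (‖z‖ + 1) (by positivity)).tendstoUniformlyOn_of_tendsto (fun w hw => hf w hw.1) u hu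
  have hFd : ∀ n, Differentiable ℂ (F n) := fun n =>
    (differentiable_epw (ε n)).clm_apply (differentiable_const h)
  have hcont : ContinuousOn f S :=
    hloc.continuousOn (Frequently.of_forall fun n => (hFd n).continuous.continuousOn)
  have hS0 : ∀ t : ℝ, (t : ℂ) * I ∈ S := fun t => by simp [S]
  have hS1 : ∀ t : ℝ, 1 + (t : ℂ) * I ∈ S := fun t => by simp [S]
  have hg : Continuous fun t : ℝ => f (t * I) :=
    hcont.comp_continuous (by fun_prop) hS0
  have hgb : ∀ t : ℝ, ‖f (t * I)‖ ≤ ‖h‖ := by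
    intro t
    refine le_of_tendsto (hf _ (hS0 t)).norm (Eventually.of_forall fun n => ?_)
    exact ((epw T (ε n) _).le_of_opNorm_le (norm_epw_le_one hT (hε n).1 (by simp)) h).trans
      (one_mul _).le
  refine ⟨f, ⟨hcont, ?_, ⟨(‖T‖ + 1) * ‖h‖, ?_⟩, ⟨_, hg, fun t => rfl, hgb⟩,
    ⟨_, hg, fun t => ?_, hgb⟩⟩, ?_⟩
  · refine (hloc.mono (preimage_mono Ioo_subset_Icc_self)).differentiableOn
      (Eventually.of_forall fun n => (hFd n).differentiableOn) ?_
    exact isOpen_Ioo.preimage continuous_re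
  · intro z hz
    refine le_of_tendsto (hf z hz).norm (Eventually.of_forall fun n => ?_)
    exact (epw T (ε n) z).le_of_opNorm_le (norm_epw_le hT (hε n) hz) h
  · refine tendsto_nhds_unique (hf _ (hS1 t)) ?_
    -- on the right boundary `(T + ε) ^ (1 + it) h = (T + ε) (T + ε) ^ (it) h`
    have e : ∀ n, F n (1 + t * I) = T (F n (t * I)) + (ε n : ℂ) • F n (t * I) := by
      intro n
      simp only [F]
      rw [epw_mul hT (hε n).1, epw_one hT (hε n).1]
      rfl
    simp only [e]
    have h1 := (T.continuous.tendsto _).comp (hf _ (hS0 t))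
    have h2 := ((continuous_ofReal.tendsto _).comp hε0).smul (hf _ (hS0 t))
    simpa using h1.add h2
  · have hθS : (θ : ℂ) ∈ S := ⟨by simpa using hθ.1.le, by simpa using hθ.2.le⟩
    refine tendsto_nhds_unique (hf _ hθS) ?_
    exact ((ContinuousLinearMap.apply ℂ H h).continuous.tendsto _).comp
      ((tendsto_epw hT hθ).comp hε')

end InterpolationOfPowers

/-! ### Morphisms and reflection of Calderón spaces -/

section Transport

variable {X₀ X₁ Z Y₀ Y₁ W : Type*} [NormedAddCommGroup X₀] [NormedSpace ℂ X₀]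
  [NormedAddCommGroup X₁] [NormedSpace ℂ X₁] [NormedAddCommGroup Z] [NormedSpace ℂ Z]
  [NormedAddCommGroup Y₀] [NormedSpace ℂ Y₀] [NormedAddCommGroup Y₁] [NormedSpace ℂ Y₁]
  [NormedAddCommGroup W] [NormedSpace ℂ W]
  {j₀ : X₀ →L[ℂ] Z} {j₁ : X₁ →L[ℂ] Z} {k₀ : Y₀ →L[ℂ] W} {k₁ : Y₁ →L[ℂ] W} {M : ℝ} {f : ℂ → Z}

/-- Calderón spaces are functorial for contractive morphisms of couples. -/
theorem IsCalderon.map (hf : IsCalderon j₀ j₁ M f) (A₀ : X₀ →L[ℂ] Y₀) (A₁ : X₁ →L[ℂ] Y₁)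
    (A : Z →L[ℂ] W) (h₀ : ∀ x, A (j₀ x) = k₀ (A₀ x)) (h₁ : ∀ x, A (j₁ x) = k₁ (A₁ x))
    (hA₀ : ‖A₀‖ ≤ 1) (hA₁ : ‖A₁‖ ≤ 1) : IsCalderon k₀ k₁ M (fun z => A (f z)) where
  continuousOn := A.continuous.comp_continuousOn hf.continuousOn
  differentiableOn := A.differentiable.comp_differentiableOn hf.differentiableOn
  bounded := by
    obtain ⟨C, hC⟩ := hf.bounded
    exact ⟨‖A‖ * C, fun z hz => A.le_opNorm_of_le (hC z hz)⟩
  left := by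
    obtain ⟨a, ha, ha', ha''⟩ := hf.left
    exact ⟨fun t => A₀ (a t), A₀.continuous.comp ha, fun t => by rw [ha', h₀],
      fun t => (A₀.le_of_opNorm_le_of_le hA₀ (ha'' t)).trans (one_mul M).le⟩
  right := by
    obtain ⟨a, ha, ha', ha''⟩ := hf.right
    exact ⟨fun t => A₁ (a t), A₁.continuous.comp ha, fun t => by rw [ha', h₁],
      fun t => (A₁.le_of_opNorm_le_of_le hA₁ (ha'' t)).trans (one_mul M).le⟩

/-- The reflection `z ↦ 1 - z` of the strip exchanges the two spaces of the couple. -/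
theorem IsCalderon.swap (hf : IsCalderon j₀ j₁ M f) : IsCalderon j₁ j₀ M (fun z => f (1 - z)) where
  continuousOn := by
    refine hf.continuousOn.comp (by fun_prop) fun z hz => ?_
    simp only [mem_preimage, mem_Icc, sub_re, one_re] at hz ⊢
    constructor <;> linarith
  differentiableOn := by
    refine hf.differentiableOn.comp (by fun_prop) fun z hz => ?_
    simp only [mem_preimage, mem_Ioo, sub_re, one_re] at hz ⊢
    constructor <;> linarith
  bounded := by
    obtain ⟨C, hC⟩ := hf.bounded
    refine ⟨C, fun z hz => hC _ ?_⟩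
    simp only [mem_preimage, mem_Icc, sub_re, one_re] at hz ⊢
    constructor <;> linarith
  left := by
    obtain ⟨a, ha, ha', ha''⟩ := hf.right
    refine ⟨fun t => a (-t), by fun_prop, fun t => ?_, fun t => ha'' _⟩
    rw [← ha']; congr 1; push_cast; ring
  right := by
    obtain ⟨a, ha, ha', ha''⟩ := hf.left
    refine ⟨fun t => a (-t), by fun_prop, fun t => ?_, fun t => ha'' _⟩
    rw [← ha']; congr 1; push_cast; ring

end Transport

/-! ### Locally absolutely continuous functions on `(0, ∞)` -/

section Primitives

variable {E F G : Type*} [NormedAddCommGroup E] [NormedSpace ℂ E] [CompleteSpace E]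
  [NormedAddCommGroup F] [NormedSpace ℂ F] [CompleteSpace F]
  [NormedAddCommGroup G] [NormedSpace ℂ G] [CompleteSpace G]

/-- Fubini's theorem on the two triangles of the square `(a, b]²`; this is integration by parts for
the primitives of `f` and `g`. -/
theorem integral_triangles (L : E →L[ℝ] F →L[ℝ] G) {a b : ℝ} {f : ℝ → E} {g : ℝ → F}
    (hf : IntegrableOn f (Ioc a b)) (hg : IntegrableOn g (Ioc a b)) :
    IntegrableOn (fun t => L (f t) (∫ τ in Ioc a t, g τ)) (Ioc a b) ∧
    IntegrableOn (fun t => L (∫ τ in Ioc a t, f τ) (g t)) (Ioc a b) ∧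
    (∫ t in Ioc a b, L (f t) (∫ τ in Ioc a t, g τ)) +
      (∫ t in Ioc a b, L (∫ τ in Ioc a t, f τ) (g t)) =
      L (∫ t in Ioc a b, f t) (∫ t in Ioc a b, g t) := by
  set μ : Measure ℝ := volume.restrict (Ioc a b) with hμ
  let Φ : ℝ × ℝ → G := fun p => L (f p.1) (g p.2)
  have hΦ : Integrable Φ (μ.prod μ) :=
    hf.op_fst_snd (op := fun x y => L x y) (by fun_prop) ⟨‖L‖, L.le_opNorm₂⟩ hg
  let S : Set (ℝ × ℝ) := {p | p.2 ≤ p.1}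
  have hS : MeasurableSet S := measurableSet_le measurable_snd measurable_fst
  have i1 : ∀ t ∈ Ioc a b,
      ∫ τ, S.indicator Φ (t, τ) ∂μ = L (f t) (∫ τ in Ioc a t, g τ) := by
    intro t ht
    have e : (fun τ => S.indicator Φ (t, τ)) = (Iic t).indicator fun τ => L (f t) (g τ) := by
      ext τ; simp [indicator, S, Φ]
    rw [e, integral_indicator measurableSet_Iic, Measure.restrict_restrict measurableSet_Iic,
      inter_comm, Ioc_inter_Iic, min_eq_right ht.2]
    exact (L (f t)).integral_comp_comm (hg.mono_set (Ioc_subset_Ioc_right ht.2))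
  have i2 : ∀ τ ∈ Ioc a b,
      ∫ t, Sᶜ.indicator Φ (t, τ) ∂μ = L (∫ t in Ioc a τ, f t) (g τ) := by
    intro τ hτ
    have e : (fun t => Sᶜ.indicator Φ (t, τ)) = (Iio τ).indicator fun t => L (f t) (g τ) := by
      ext t; simp [indicator, S, Φ]
    have e' : Iio τ ∩ Ioc a b = Ioo a τ := by
      ext t
      simp only [mem_inter_iff, mem_Iio, mem_Ioc, mem_Ioo]
      exact ⟨fun h => ⟨h.2.1, h.1⟩, fun h => ⟨h.2, h.1, h.2.le.trans hτ.2⟩⟩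
    rw [e, integral_indicator measurableSet_Iio, Measure.restrict_restrict measurableSet_Iio, e',
      integral_Ioc_eq_integral_Ioo]
    exact (L.flip (g τ)).integral_comp_comm
      (hf.mono_set (Ioo_subset_Ioc_self.trans (Ioc_subset_Ioc_right hτ.2)))
  have hΦ1 := hΦ.indicator hS
  have hΦ2 := hΦ.indicator hS.compl
  have n1 : IntegrableOn (fun t => L (f t) (∫ τ in Ioc a t, g τ)) (Ioc a b) :=
    hΦ1.integral_prod_left.congr (ae_restrict_of_forall_mem measurableSet_Ioc i1)
  have n2 : IntegrableOn (fun t => L (∫ τ in Ioc a t, f τ) (g t)) (Ioc a b) :=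
    hΦ2.integral_prod_right.congr (ae_restrict_of_forall_mem measurableSet_Ioc i2)
  refine ⟨n1, n2, ?_⟩
  have s1 : ∫ t in Ioc a b, L (f t) (∫ τ in Ioc a t, g τ) = ∫ p, S.indicator Φ p ∂μ.prod μ := by
    rw [integral_prod _ hΦ1]
    exact setIntegral_congr_fun measurableSet_Ioc fun t ht => (i1 t ht).symm
  have s2 : ∫ t in Ioc a b, L (∫ τ in Ioc a t, f τ) (g t) = ∫ p, Sᶜ.indicator Φ p ∂μ.prod μ := by
    rw [integral_prod_symm _ hΦ2]
    exact setIntegral_congr_fun measurableSet_Ioc fun t ht => (i2 t ht).symm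
  rw [s1, s2, integral_indicator hS, integral_indicator hS.compl, integral_add_compl hS hΦ,
    integral_prod _ hΦ]
  have e1 : ∀ t, ∫ τ, Φ (t, τ) ∂μ = L (f t) (∫ τ in Ioc a b, g τ) := fun t =>
    (L (f t)).integral_comp_comm hg
  simp only [e1]
  exact (L.flip (∫ τ in Ioc a b, g τ)).integral_comp_comm hf

/-- `u` is locally absolutely continuous on `(0, ∞)` with derivative `v`, i.e. `u` is a primitive of
the locally integrable function `v`. -/
structure IsPrim (u v : ℝ → E) : Prop where
  locallyIntegrableOn : LocallyIntegrableOn v (Ioi 0)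
  sub_eq : ∀ a > 0, ∀ b > 0, u b - u a = ∫ t in a..b, v t

omit [NormedSpace ℂ E] [CompleteSpace E] in
theorem intervalIntegrable_of_Ioi {v : ℝ → E} (hv : LocallyIntegrableOn v (Ioi 0)) {a b : ℝ}
    (ha : 0 < a) (hb : 0 < b) : IntervalIntegrable v volume a b := by
  rw [intervalIntegrable_iff]
  refine (hv.integrableOn_compact_subset (t := uIcc a b) ?_ isCompact_uIcc).mono_set
    uIoc_subset_uIcc
  intro x hx
  exact (lt_min ha hb).trans_le hx.1

omit [CompleteSpace E] in
theorem IsPrim.continuousOn {u v : ℝ → E} (h : IsPrim u v) : ContinuousOn u (Ioi 0) := by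
  intro t ht
  have ht' : (0 : ℝ) < t := ht
  have hc : ContinuousOn (fun b => u (t / 2) + ∫ τ in (t / 2)..b, v τ) (uIcc (t / 2) (2 * t)) :=
    continuousOn_const.add (intervalIntegral.continuousOn_primitive_interval'
      (intervalIntegrable_of_Ioi h.locallyIntegrableOn (half_pos ht') (by positivity))
      left_mem_uIcc)
  have hn : uIcc (t / 2) (2 * t) ∈ 𝓝 t := by
    rw [uIcc_of_le (by linarith)]
    exact Icc_mem_nhds (by linarith) (by linarith)
  refine ((hc.continuousAt hn).congr ?_).continuousWithinAt
  filter_upwards [Ioi_mem_nhds ht'] with b hb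
  rw [← h.sub_eq _ (half_pos ht') _ hb, add_sub_cancel]

theorem IsPrim.of_hasDerivAt {u v : ℝ → E} (hu : ∀ t > 0, HasDerivAt u (v t) t)
    (hv : ContinuousOn v (Ioi 0)) : IsPrim u v where
  locallyIntegrableOn := hv.locallyIntegrableOn measurableSet_Ioi
  sub_eq := fun a ha b hb => by
    refine (intervalIntegral.integral_eq_sub_of_hasDerivAt (fun t ht => hu t ?_) ?_).symm
    · exact (lt_min ha hb).trans_le ht.1
    · exact intervalIntegrable_of_Ioi (hv.locallyIntegrableOn measurableSet_Ioi) ha hb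

omit [CompleteSpace E] [CompleteSpace F] in
theorem locallyIntegrableOn_clm_comp {v : ℝ → E} (hv : LocallyIntegrableOn v (Ioi 0))
    (A : E →L[ℂ] F) : LocallyIntegrableOn (fun t => A (v t)) (Ioi 0) := by
  intro x hx
  obtain ⟨s, hs, hs'⟩ := hv x hx
  exact ⟨s, hs, A.integrable_comp hs'⟩

theorem IsPrim.map {u v : ℝ → E} (h : IsPrim u v) (A : E →L[ℂ] F) :
    IsPrim (fun t => A (u t)) (fun t => A (v t)) where
  locallyIntegrableOn := locallyIntegrableOn_clm_comp h.locallyIntegrableOn A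
  sub_eq := fun a ha b hb => by
    rw [← map_sub, h.sub_eq a ha b hb,
      A.intervalIntegral_comp_comm (intervalIntegrable_of_Ioi h.locallyIntegrableOn ha hb)]

omit [CompleteSpace E] in
theorem IsPrim.sub {u v u₂ v₂ : ℝ → E} (h : IsPrim u v) (h₂ : IsPrim u₂ v₂) :
    IsPrim (fun t => u t - u₂ t) (fun t => v t - v₂ t) where
  locallyIntegrableOn := h.locallyIntegrableOn.sub h₂.locallyIntegrableOn
  sub_eq := fun a ha b hb => by
    rw [intervalIntegral.integral_sub (intervalIntegrable_of_Ioi h.locallyIntegrableOn ha hb)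
      (intervalIntegrable_of_Ioi h₂.locallyIntegrableOn ha hb), ← h.sub_eq a ha b hb,
      ← h₂.sub_eq a ha b hb]
    abel

/-- The product rule for locally absolutely continuous functions. -/
theorem IsPrim.bilinear {u v : ℝ → E} {p q : ℝ → F} (h : IsPrim u v) (h' : IsPrim p q)
    (L : E →L[ℝ] F →L[ℝ] G) : IsPrim (fun t => L (u t) (p t)) (fun t => L (v t) (p t) + L (u t) (q t))
    := by
  have key : ∀ a > 0, ∀ b, a ≤ b →
      IntegrableOn (fun t => L (v t) (p t) + L (u t) (q t)) (Ioc a b) ∧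
      L (u b) (p b) - L (u a) (p a) = ∫ t in a..b, (L (v t) (p t) + L (u t) (q t)) := by
    intro a ha b hab
    have hb : 0 < b := ha.trans_le hab
    have hv : IntegrableOn v (Ioc a b) := (intervalIntegrable_iff_integrableOn_Ioc_of_le hab).1
      (intervalIntegrable_of_Ioi h.locallyIntegrableOn ha hb)
    have hq : IntegrableOn q (Ioc a b) := (intervalIntegrable_iff_integrableOn_Ioc_of_le hab).1
      (intervalIntegrable_of_Ioi h'.locallyIntegrableOn ha hb)
    obtain ⟨n1, n2, e⟩ := integral_triangles L hv hq
    have hu : ∀ t, a ≤ t → u t = u a + ∫ τ in Ioc a t, v τ := fun t ht => by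
      rw [← intervalIntegral.integral_of_le ht, ← h.sub_eq a ha t (ha.trans_le ht)]; abel
    have hp : ∀ t, a ≤ t → p t = p a + ∫ τ in Ioc a t, q τ := fun t ht => by
      rw [← intervalIntegral.integral_of_le ht, ← h'.sub_eq a ha t (ha.trans_le ht)]; abel
    have m1 : IntegrableOn (fun t => L (v t) (p a)) (Ioc a b) := (L.flip (p a)).integrable_comp hv
    have m2 : IntegrableOn (fun t => L (u a) (q t)) (Ioc a b) := (L (u a)).integrable_comp hq
    have hD : EqOn (fun t => (L (v t) (p a) + L (v t) (∫ τ in Ioc a t, q τ)) +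
        (L (u a) (q t) + L (∫ τ in Ioc a t, v τ) (q t)))
        (fun t => L (v t) (p t) + L (u t) (q t)) (Ioc a b) := by
      intro t ht
      simp only
      rw [hu t ht.1.le, hp t ht.1.le, map_add, map_add]
      rfl
    refine ⟨((m1.add n1).add (m2.add n2)).congr_fun hD measurableSet_Ioc, ?_⟩
    have e0 := integral_add (m1.fun_add n1) (m2.fun_add n2)
    rw [integral_add m1 n1, integral_add m2 n2] at e0
    rw [intervalIntegral.integral_of_le hab, ← setIntegral_congr_fun measurableSet_Ioc hD, e0]
    have e1 : ∫ t in Ioc a b, L (v t) (p a) = L (∫ t in Ioc a b, v t) (p a) :=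
      (L.flip (p a)).integral_comp_comm hv
    have e2 : ∫ t in Ioc a b, L (u a) (q t) = L (u a) (∫ t in Ioc a b, q t) :=
      (L (u a)).integral_comp_comm hq
    have e3 : ∀ A B C D : G, (A + B) + (C + D) = A + C + (B + D) := fun A B C D => by abel
    rw [e3, e, e1, e2, hu b hab, hp b hab]
    simp only [map_add, add_apply]
    abel
  constructor
  · intro t ht
    have ht' : (0 : ℝ) < t := ht
    refine ⟨Ioc (t / 2) (2 * t), mem_nhdsWithin_of_mem_nhds (Ioc_mem_nhds ?_ ?_),
      (key (t / 2) (half_pos ht') (2 * t) (by linarith)).1⟩ <;> linarith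
  · intro a ha b hb
    rcases le_total a b with hab | hab
    · exact (key a ha b hab).2
    · rw [intervalIntegral.integral_symm, ← (key b hb a hab).2]; abel

omit [NormedSpace ℂ G] [CompleteSpace G] in
/-- A function that is integrable at infinity can only have the limit zero there. -/
theorem eq_zero_of_tendsto_of_integrableOn {Q : ℝ → G} {m : G} (hQ : IntegrableOn Q (Ioi 1))
    (hm : Tendsto Q atTop (𝓝 m)) : m = 0 := by
  by_contra hne
  have hpos : 0 < ‖m‖ / 2 := by have := norm_pos_iff.2 hne; positivity
  have hev : ∀ᶠ t in atTop, ‖m‖ / 2 < ‖Q t‖ :=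
    hm.norm.eventually_const_lt (by linarith)
  obtain ⟨N, hN⟩ := (hev.and (eventually_gt_atTop 1)).exists_forall_of_atTop
  have h1 : IntegrableOn (fun _ : ℝ => ‖m‖ / 2) (Ioi N) := by
    refine (hQ.mono_set fun t ht => (hN t (le_of_lt ht)).2).norm.mono' (by fun_prop) ?_
    refine ae_restrict_of_forall_mem measurableSet_Ioi fun t ht => ?_
    rw [Real.norm_of_nonneg hpos.le]
    exact (hN t (le_of_lt ht)).1.le
  rw [integrableOn_const_iff] at h1
  simp [hpos.ne'] at h1

omit [CompleteSpace G] in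
/-- If `Q' = D` is integrable on `(0, ∞)` and `Q` is integrable at infinity,
then `∫ D = -lim_{t ↓ 0} Q(t)`. -/
theorem IsPrim.integral_Ioi {Q D : ℝ → G} (h : IsPrim Q D) (hD : IntegrableOn D (Ioi 0))
    (hQ : IntegrableOn Q (Ioi 1)) {l : G} (hl : Tendsto Q (𝓝[>] 0) (𝓝 l)) :
    ∫ t in Ioi 0, D t = -l := by
  have h1 : ∀ a > 0, ∫ t in Ioi a, D t = -Q a := by
    intro a ha
    have hDa : IntegrableOn D (Ioi a) := hD.mono_set (Ioi_subset_Ioi (le_of_lt ha))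
    have hlim := (intervalIntegral_tendsto_integral_Ioi a hDa tendsto_id).const_add (Q a)
    have hQlim : Tendsto Q atTop (𝓝 (Q a + ∫ t in Ioi a, D t)) := by
      refine hlim.congr' ?_
      filter_upwards [eventually_gt_atTop 0] with b hb
      rw [id, ← h.sub_eq a ha b hb, add_sub_cancel]
    exact (neg_eq_of_add_eq_zero_right (eq_zero_of_tendsto_of_integrableOn hQ hQlim)).symm
  have hD' : Integrable ((Ioi 0).indicator D) := (integrable_indicator_iff measurableSet_Ioi).2 hD
  have hc := intervalIntegral.continuous_primitive
    (fun a b => hD'.intervalIntegrable (a := a) (b := b)) 0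
  have h2 : Tendsto (fun a => ∫ t in (0 : ℝ)..a, (Ioi 0).indicator D t) (𝓝[>] 0) (𝓝 0) := by
    have := hc.tendsto 0
    rw [intervalIntegral.integral_same] at this
    exact this.mono_left nhdsWithin_le_nhds
  refine tendsto_nhds_unique ?_ (hl.neg.add h2) |>.trans (add_zero _)
  refine tendsto_const_nhds.congr' ?_
  filter_upwards [self_mem_nhdsWithin] with a ha
  have ha' : (0 : ℝ) < a := ha
  rw [← h1 a ha', intervalIntegral.integral_of_le ha'.le,
    setIntegral_indicator measurableSet_Ioi, inter_eq_left.2 (fun x hx => hx.1), add_comm,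
    ← setIntegral_union (Ioc_disjoint_Ioi le_rfl) measurableSet_Ioi
    (hD.mono_set Ioc_subset_Ioi_self) (hD.mono_set (Ioi_subset_Ioi ha'.le)),
    Ioc_union_Ioi_eq_Ioi ha'.le]

omit [CompleteSpace E] in
theorem isPrim_const_add_integral {v : ℝ → E} (hv : ∀ b, IntegrableOn v (Ioc 0 b)) (c : E) :
    IsPrim (fun t => c + ∫ τ in (0 : ℝ)..t, v τ) v ∧
      Tendsto (fun t => c + ∫ τ in (0 : ℝ)..t, v τ) (𝓝[>] 0) (𝓝 c) := by
  have hi : ∀ b ≥ 0, IntervalIntegrable v volume 0 b := fun b hb =>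
    (intervalIntegrable_iff_integrableOn_Ioc_of_le hb).2 (hv b)
  refine ⟨⟨fun t ht => ?_, fun a ha b hb => ?_⟩, ?_⟩
  · have ht' : (0 : ℝ) < t := ht
    exact ⟨Ioc 0 (2 * t), mem_nhdsWithin_of_mem_nhds (Ioc_mem_nhds ht' (by linarith)), hv _⟩
  · rw [add_sub_add_left_eq_sub,
      intervalIntegral.integral_interval_sub_left (hi b (le_of_lt hb)) (hi a (le_of_lt ha))]
  · have hc : ContinuousOn (fun t => ∫ τ in (0 : ℝ)..t, v τ) (uIcc 0 1) :=
      intervalIntegral.continuousOn_primitive_interval' (hi 1 zero_le_one) left_mem_uIcc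
    have h0 := (hc 0 left_mem_uIcc).tendsto
    rw [intervalIntegral.integral_same, uIcc_of_le zero_le_one] at h0
    have h1 := (h0.mono_left (nhdsWithin_le_iff.2
      (mem_of_superset (Ioc_mem_nhdsGT zero_lt_one) Ioc_subset_Icc_self))).const_add c
    rwa [add_zero] at h1

omit [CompleteSpace E] in
theorem IsPrim.exists_tendsto {u v : ℝ → E} (h : IsPrim u v) (hv : ∀ b, IntegrableOn v (Ioc 0 b)) :
    ∃ x, Tendsto u (𝓝[>] 0) (𝓝 x) := by
  obtain ⟨h1, h2⟩ := isPrim_const_add_integral hv (u 1 - ∫ τ in (0 : ℝ)..1, v τ)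
  refine ⟨_, h2.congr' ?_⟩
  filter_upwards [self_mem_nhdsWithin] with t ht
  have e1 := h1.sub_eq 1 one_pos t ht
  rw [← h.sub_eq 1 one_pos t ht, sub_add_cancel] at e1
  exact sub_left_injective e1

end Primitives

/-! ### Weak derivatives -/

section WeakDerivatives

variable {E F : Type*} [NormedAddCommGroup E] [NormedSpace ℂ E] [CompleteSpace E]
  [NormedAddCommGroup F] [NormedSpace ℂ F] [CompleteSpace F]

omit [CompleteSpace E] in
theorem integrable_smul_of_tsupport_subset {φ : ℝ → ℂ} {w : ℝ → E} (hφ : Continuous φ)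
    (hc : HasCompactSupport φ) (hs : tsupport φ ⊆ Ioi 0) (hw : LocallyIntegrableOn w (Ioi 0)) :
    Integrable (fun t => φ t • w t) := by
  have h1 : IntegrableOn (fun t => φ t • w t) (tsupport φ) :=
    (hw.integrableOn_compact_subset hs hc).continuousOn_smul hφ.continuousOn hc
  refine (integrableOn_iff_integrable_of_support_subset ?_).1 h1
  exact (Function.support_smul_subset_left _ _).trans (subset_tsupport φ)

theorem isPrim_of_contDiff {φ : ℝ → ℂ} (hφ : ContDiff ℝ 1 φ) : IsPrim φ (deriv φ) :=
  IsPrim.of_hasDerivAt (fun t _ => (hφ.differentiable one_ne_zero t).hasDerivAt)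
    (hφ.continuous_deriv le_rfl).continuousOn

theorem IsPrim.hasWeakDeriv {u v : ℝ → E} (h : IsPrim u v) : HasWeakDeriv u v where
  locallyIntegrableOn := h.continuousOn.locallyIntegrableOn measurableSet_Ioi
  locallyIntegrableOn_deriv := h.locallyIntegrableOn
  integral_eq := fun φ hφ hc hs => by
    have hφ1 : ContDiff ℝ 1 φ := hφ.of_le (by exact_mod_cast le_top)
    have hu := h.continuousOn.locallyIntegrableOn (μ := volume) measurableSet_Ioi
    have i1 : Integrable (fun t => deriv φ t • u t) := integrable_smul_of_tsupport_subset
      (hφ1.continuous_deriv le_rfl) hc.deriv (tsupport_deriv_subset.trans hs) hu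
    have i2 : Integrable (fun t => φ t • v t) := integrable_smul_of_tsupport_subset
      hφ1.continuous hc hs h.locallyIntegrableOn
    have i3 : Integrable (fun t => φ t • u t) := integrable_smul_of_tsupport_subset
      hφ1.continuous hc hs hu
    have hl : Tendsto (fun t => φ t • u t) (𝓝[>] 0) (𝓝 0) := by
      have h0 : ∀ᶠ t in 𝓝 (0 : ℝ), φ t = 0 := by
        have : (tsupport φ)ᶜ ∈ 𝓝 (0 : ℝ) :=
          (isClosed_tsupport φ).isOpen_compl.mem_nhds fun h => lt_irrefl (0 : ℝ) (hs h)
        filter_upwards [this] with t ht using image_eq_zero_of_notMem_tsupport ht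
      refine tendsto_const_nhds.congr' ?_
      filter_upwards [nhdsWithin_le_nhds h0] with t ht
      rw [ht, zero_smul]
    have key := ((isPrim_of_contDiff hφ1).bilinear h
      (ContinuousLinearMap.lsmul ℝ ℂ : ℂ →L[ℝ] E →L[ℝ] E)).integral_Ioi
      (i1.add i2).integrableOn i3.integrableOn hl
    simp only [ContinuousLinearMap.lsmul_apply, neg_zero] at key
    rw [integral_add i1.integrableOn i2.integrableOn] at key
    exact neg_eq_of_add_eq_zero_right key

omit [CompleteSpace E] in
theorem HasWeakDeriv.congr {u u₂ v v₂ : ℝ → E} (h : HasWeakDeriv u v)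
    (hu : u =ᵐ[volume.restrict (Ioi 0)] u₂) (hv : v =ᵐ[volume.restrict (Ioi 0)] v₂) :
    HasWeakDeriv u₂ v₂ where
  locallyIntegrableOn := h.locallyIntegrableOn.congr hu
  locallyIntegrableOn_deriv := h.locallyIntegrableOn_deriv.congr hv
  integral_eq := fun φ hφ hc hs => by
    rw [← integral_congr_ae (hu.mono fun t ht => by simp only [ht] : (fun t => deriv φ t • u t)
        =ᵐ[volume.restrict (Ioi 0)] fun t => deriv φ t • u₂ t),
      ← integral_congr_ae (hv.mono fun t ht => by simp only [ht] : (fun t => φ t • v t)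
        =ᵐ[volume.restrict (Ioi 0)] fun t => φ t • v₂ t)]
    exact h.integral_eq φ hφ hc hs

theorem hasDerivAt_integral_of_continuous {ξ : ℝ → ℝ} (hξ : Continuous ξ) (t : ℝ) :
    HasDerivAt (fun t => ∫ τ in (0 : ℝ)..t, ξ τ) (ξ t) t :=
  intervalIntegral.integral_hasDerivAt_right (hξ.intervalIntegrable _ _)
    (hξ.stronglyMeasurableAtFilter _ _) hξ.continuousAt

theorem contDiff_integral {ξ : ℝ → ℝ} (hξ : ContDiff ℝ ∞ ξ) :
    ContDiff ℝ ∞ (fun t => ∫ τ in (0 : ℝ)..t, ξ τ) := by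
  rw [contDiff_infty_iff_deriv]
  have hd := hasDerivAt_integral_of_continuous hξ.continuous
  refine ⟨fun t => (hd t).differentiableAt, ?_⟩
  rwa [funext fun t => (hd t).deriv]

/-- The lemma of du Bois-Reymond: a function with a weak derivative is almost everywhere equal to
a locally absolutely continuous function. -/
theorem HasWeakDeriv.exists_isPrim {u v : ℝ → E} (h : HasWeakDeriv u v) :
    ∃ w, w =ᵐ[volume.restrict (Ioi 0)] u ∧ IsPrim w v := by
  have hP : IsPrim (fun t => ∫ τ in (1 : ℝ)..t, v τ) v := by
    refine ⟨h.locallyIntegrableOn_deriv, fun a ha b hb => ?_⟩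
    rw [intervalIntegral.integral_interval_sub_left
      (intervalIntegrable_of_Ioi h.locallyIntegrableOn_deriv one_pos hb)
      (intervalIntegrable_of_Ioi h.locallyIntegrableOn_deriv one_pos ha)]
  set P : ℝ → E := fun t => ∫ τ in (1 : ℝ)..t, v τ with hPdef
  have hPw := hP.hasWeakDeriv
  let z : ℝ → E := fun t => u t - P t
  have hz : LocallyIntegrableOn z (Ioi 0) := h.locallyIntegrableOn.sub hPw.locallyIntegrableOn
  -- `z` has weak derivative zero
  have hz0 : ∀ χ : ℝ → ℝ, ContDiff ℝ ∞ χ → HasCompactSupport χ → tsupport χ ⊆ Ioi 0 →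
      ∫ t in Ioi (0 : ℝ), deriv χ t • z t = 0 := by
    intro χ hχ hc hs
    let φ : ℝ → ℂ := fun t => χ t
    have hφ : ContDiff ℝ ∞ φ := ofRealCLM.contDiff.comp hχ
    have hφc : HasCompactSupport φ := hc.comp_left ofReal_zero
    have hts : tsupport φ ⊆ tsupport χ := closure_mono fun t ht hχt => ht (by simp [φ, hχt])
    have hφs : tsupport φ ⊆ Ioi 0 := hts.trans hs
    have hd : ∀ t, deriv φ t = ((deriv χ t : ℝ) : ℂ) := fun t =>
      ((hχ.differentiable (by simp) t).hasDerivAt.ofReal_comp).deriv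
    have i1 := (integrable_smul_of_tsupport_subset (hφ.continuous_deriv (by simp)) hφc.deriv
      (tsupport_deriv_subset.trans hφs) h.locallyIntegrableOn).integrableOn (s := Ioi 0)
    have i2 := (integrable_smul_of_tsupport_subset (hφ.continuous_deriv (by simp)) hφc.deriv
      (tsupport_deriv_subset.trans hφs) hPw.locallyIntegrableOn).integrableOn (s := Ioi 0)
    have e1 := h.integral_eq φ hφ hφc hφs
    have e2 := hPw.integral_eq φ hφ hφc hφs
    have e3 : (fun t => deriv χ t • z t) = fun t => deriv φ t • u t - deriv φ t • P t := by
      ext t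
      rw [hd, coe_smul, coe_smul, ← smul_sub]
    rw [e3, integral_sub i1 i2, neg_eq_iff_eq_neg.1 e1, neg_eq_iff_eq_neg.1 e2, sub_self]
  let β : ContDiffBump (1 : ℝ) := ⟨1 / 4, 1 / 2, by norm_num, by norm_num⟩
  let ψ : ℝ → ℝ := β.normed volume
  have hψ : ContDiff ℝ ∞ ψ := β.contDiff_normed
  have hψs : tsupport ψ = Icc (1 / 2) (3 / 2) := by
    rw [show tsupport ψ = Metric.closedBall 1 (1 / 2) from β.tsupport_normed_eq,
      Real.closedBall_eq_Icc]
    norm_num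
  have hψc : HasCompactSupport ψ := β.hasCompactSupport_normed
  have hψ1 : ∫ t, ψ t = 1 := β.integral_normed
  have hψi : Integrable ψ := hψ.continuous.integrable_of_hasCompactSupport hψc
  let c : E := ∫ t in Ioi (0 : ℝ), ψ t • z t
  have hsm : ∀ η : ℝ → ℝ, Continuous η → HasCompactSupport η → tsupport η ⊆ Ioi 0 →
      Integrable (fun t => η t • z t) := by
    intro η hη hc hs
    have hts : tsupport (fun t => (η t : ℂ)) ⊆ tsupport η :=
      closure_mono fun t ht hηt => ht (by simp [hηt])
    have := integrable_smul_of_tsupport_subset (φ := fun t => (η t : ℂ))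
      (continuous_ofReal.comp hη) (hc.comp_left ofReal_zero) (hts.trans hs) hz
    simpa only [coe_smul] using this
  have hae : ∀ᵐ t, t ∈ Ioi (0 : ℝ) → z t - c = 0 := by
    refine IsOpen.ae_eq_zero_of_integral_contDiff_smul_eq_zero isOpen_Ioi
      (hz.sub (locallyIntegrableOn_const c)) fun η hη hc hs => ?_
    have hηi : Integrable η := hη.continuous.integrable_of_hasCompactSupport hc
    -- subtract a multiple of the bump to get a test function with integral zero
    let k : ℝ := ∫ t, η t
    let ξ : ℝ → ℝ := fun t => η t - k * ψ t
    have hξ : ContDiff ℝ ∞ ξ := hη.sub (contDiff_const.mul hψ)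
    obtain ⟨a, b, ha, hab1, hab2⟩ : ∃ a b : ℝ, 0 < a ∧ tsupport η ⊆ Icc a b ∧
        tsupport ψ ⊆ Icc a b := by
      obtain ⟨b, hb⟩ := hc.isCompact.bddAbove
      have : ∃ a > 0, ∀ x ∈ tsupport η, a ≤ x := by
        rcases (tsupport η).eq_empty_or_nonempty with he | hne
        · exact ⟨1, one_pos, by simp [he]⟩
        · obtain ⟨a, ha, ha'⟩ := hc.isCompact.exists_isLeast hne
          exact ⟨a, hs ha, ha'⟩
      obtain ⟨a, ha, ha'⟩ := this
      refine ⟨min a (1 / 2), max b (3 / 2), lt_min ha (by norm_num), fun x hx =>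
        ⟨(min_le_left _ _).trans (ha' x hx), (hb hx).trans (le_max_left _ _)⟩, ?_⟩
      rw [hψs]
      exact Icc_subset_Icc (min_le_right _ _) (le_max_right _ _)
    have hξ0 : ∀ t ∉ Icc a b, ξ t = 0 := fun t ht => by
      simp only [ξ]
      rw [image_eq_zero_of_notMem_tsupport fun h => ht (hab1 h),
        image_eq_zero_of_notMem_tsupport fun h => ht (hab2 h), mul_zero, sub_zero]
    let χ : ℝ → ℝ := fun t => ∫ τ in (0 : ℝ)..t, ξ τ
    have hχd : ∀ t, deriv χ t = ξ t := fun t =>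
      (hasDerivAt_integral_of_continuous hξ.continuous t).deriv
    have hξi : ∫ t, ξ t = 0 := by
      simp only [ξ]
      rw [integral_sub hηi (hψi.const_mul k), integral_const_mul, hψ1, mul_one, sub_self]
    have hχ0 : ∀ t ∉ Icc a b, χ t = 0 := by
      intro t ht
      rcases lt_or_ge t a with hta | hta
      · refine intervalIntegral.integral_zero_ae (Eventually.of_forall fun τ hτ => hξ0 τ ?_)
        intro hτ'
        have : τ ≤ max 0 t := hτ.2
        exact absurd (hτ'.1.trans this) (not_le.2 (max_lt ha hta))
      · have htb : b < t := not_le.1 fun h => ht ⟨hta, h⟩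
        rw [← hξi]
        refine intervalIntegral.integral_eq_integral_of_support_subset fun τ hτ => ?_
        by_contra hτ'
        refine hτ (hξ0 τ fun hτ'' => hτ' ⟨ha.trans_le hτ''.1, hτ''.2.trans htb.le⟩)
    have hχs : tsupport χ ⊆ Icc a b :=
      closure_minimal (fun t ht => by_contra fun h => ht (hχ0 t h)) isClosed_Icc
    have hχc : HasCompactSupport χ := HasCompactSupport.of_support_subset_isCompact isCompact_Icc
      ((subset_tsupport χ).trans hχs)
    have h0 := hz0 χ (contDiff_integral hξ) hχc (hχs.trans fun t ht => ha.trans_le ht.1)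
    have hψs0 : tsupport ψ ⊆ Ioi 0 := hab2.trans fun t ht => ha.trans_le ht.1
    have j1 := (hsm η hη.continuous hc hs).integrableOn (s := Ioi 0)
    have j2 := (hsm ψ hψ.continuous hψc hψs0).integrableOn (s := Ioi 0)
    have h1 : ∫ t in Ioi (0 : ℝ), η t • z t = k • c := by
      have e : (fun t => deriv χ t • z t) = fun t => η t • z t - k • (ψ t • z t) := by
        ext t
        rw [hχd, smul_smul, ← sub_smul]
      rw [e, integral_sub j1 (j2.fun_smul k), integral_smul] at h0
      exact sub_eq_zero.1 h0
    have e2 : ∫ t, η t • (z t - c) = ∫ t in Ioi (0 : ℝ), η t • (z t - c) := by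
      refine (setIntegral_eq_integral_of_forall_compl_eq_zero fun t ht => ?_).symm
      rw [image_eq_zero_of_notMem_tsupport fun h => ht (hs h), zero_smul]
    have e3 : ∫ t in Ioi (0 : ℝ), η t = k :=
      setIntegral_eq_integral_of_forall_compl_eq_zero fun t ht =>
        image_eq_zero_of_notMem_tsupport fun h => ht (hs h)
    simp only [smul_sub] at e2 ⊢
    rw [e2, integral_sub j1 (hηi.integrableOn.smul_const c), h1, integral_smul_const, e3, sub_self]
  refine ⟨fun t => c + P t, ?_, ⟨hP.locallyIntegrableOn, fun a ha b hb => ?_⟩⟩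
  · rw [EventuallyEq, ae_restrict_iff' measurableSet_Ioi]
    filter_upwards [hae] with t ht ht0
    rw [← sub_eq_zero.1 (ht ht0), sub_add_cancel]
  · rw [add_sub_add_left_eq_sub]; exact hP.sub_eq a ha b hb

theorem HasWeakDeriv.sub {u u₂ v v₂ : ℝ → E} (h : HasWeakDeriv u v) (h₂ : HasWeakDeriv u₂ v₂) :
    HasWeakDeriv (fun t => u t - u₂ t) (fun t => v t - v₂ t) := by
  obtain ⟨w, hw, hw'⟩ := h.exists_isPrim
  obtain ⟨w₂, hw₂, hw₂'⟩ := h₂.exists_isPrim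
  refine (hw'.sub hw₂').hasWeakDeriv.congr ?_ EventuallyEq.rfl
  filter_upwards [hw, hw₂] with t ht ht₂
  rw [ht, ht₂]

end WeakDerivatives

/-! ### The weighted space `L²(dt / t)` -/

section WeightedL2

variable {E : Type*} [NormedAddCommGroup E] [NormedSpace ℝ E]

theorem measurable_ofReal_inv : Measurable fun t : ℝ => ENNReal.ofReal t⁻¹ := by fun_prop

theorem ae_haarIoi_iff {p : ℝ → Prop} :
    (∀ᵐ t ∂haarIoi, p t) ↔ ∀ᵐ t ∂volume.restrict (Ioi (0 : ℝ)), p t := by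
  rw [haarIoi, ae_withDensity_iff measurable_ofReal_inv]
  refine eventually_congr ?_
  filter_upwards [ae_restrict_mem measurableSet_Ioi] with t ht
  have ht' : (0 : ℝ) < t := ht
  simp [ht']

theorem ae_haarIoi_of_forall {p : ℝ → Prop} (h : ∀ t > 0, p t) : ∀ᵐ t ∂haarIoi, p t :=
  ae_haarIoi_iff.2 (ae_restrict_of_forall_mem measurableSet_Ioi h)

omit [NormedSpace ℝ E] in
theorem aestronglyMeasurable_haarIoi {f : ℝ → E} :
    AEStronglyMeasurable f haarIoi ↔ AEStronglyMeasurable f (volume.restrict (Ioi 0)) := by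
  constructor
  · intro h
    exact ⟨h.mk f, h.stronglyMeasurable_mk, ae_haarIoi_iff.1 h.ae_eq_mk⟩
  · intro h
    exact ⟨h.mk f, h.stronglyMeasurable_mk, ae_haarIoi_iff.2 h.ae_eq_mk⟩

theorem toReal_ofReal_inv_ae :
    ∀ᵐ t ∂volume.restrict (Ioi (0 : ℝ)), (ENNReal.ofReal t⁻¹).toReal = t⁻¹ :=
  ae_restrict_of_forall_mem measurableSet_Ioi fun _ ht =>
    ENNReal.toReal_ofReal (inv_nonneg.2 (le_of_lt ht))

theorem integrable_haarIoi_iff {f : ℝ → E} :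
    Integrable f haarIoi ↔ IntegrableOn (fun t => t⁻¹ • f t) (Ioi 0) := by
  rw [haarIoi, integrable_withDensity_iff_integrable_smul' measurable_ofReal_inv
    (Eventually.of_forall fun _ => ENNReal.ofReal_lt_top)]
  exact integrable_congr (toReal_ofReal_inv_ae.mono fun t ht => by simp only [ht])

theorem integral_haarIoi (f : ℝ → E) : ∫ t, f t ∂haarIoi = ∫ t in Ioi (0 : ℝ), t⁻¹ • f t := by
  rw [haarIoi, integral_withDensity_eq_integral_toReal_smul measurable_ofReal_inv
    (Eventually.of_forall fun _ => ENNReal.ofReal_lt_top)]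
  exact integral_congr_ae (toReal_ofReal_inv_ae.mono fun t ht => by simp only [ht])

theorem memLp_indicator_rpow {σ : ℝ} (hσ : 0 < σ) (b : ℝ) :
    MemLp ((Ioc 0 b).indicator fun t : ℝ => t ^ σ) 2 haarIoi := by
  have hm : Measurable ((Ioc 0 b).indicator fun t : ℝ => t ^ σ) :=
    Measurable.indicator (by fun_prop) measurableSet_Ioc
  rw [memLp_two_iff_integrable_sq hm.aestronglyMeasurable, integrable_haarIoi_iff]
  have h1 : IntegrableOn (fun t : ℝ => t ^ (2 * σ - 1)) (Ioc 0 b) := by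
    rcases le_or_gt 0 b with hb | hb
    · rw [← intervalIntegrable_iff_integrableOn_Ioc_of_le hb]
      exact intervalIntegral.intervalIntegrable_rpow' (by linarith)
    · rw [Ioc_eq_empty (by linarith)]; simp
  have h2 := ((integrable_indicator_iff measurableSet_Ioc).2 h1).integrableOn (s := Ioi 0)
  refine h2.congr_fun (fun t ht => ?_) measurableSet_Ioi
  have ht' : (0 : ℝ) < t := ht
  simp only [indicator]
  split_ifs
  · rw [smul_eq_mul, Real.rpow_sub ht', Real.rpow_one, two_mul, Real.rpow_add ht']; ring
  · simp

/-- Functions of the weighted space are integrable near `0`. -/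
theorem integrableOn_Ioc_of_memLp {σ : ℝ} (hσ : σ < 1) {f : ℝ → E}
    (hf : MemLp (fun t => t ^ σ • f t) 2 haarIoi) (b : ℝ) : IntegrableOn f (Ioc 0 b) := by
  have h1 := (memLp_indicator_rpow (sub_pos.2 hσ) b)
  have h2 : MemLp (((Ioc 0 b).indicator fun t : ℝ => t ^ (1 - σ)) • fun t => t ^ σ • f t) 1 haarIoi :=
    hf.smul h1
  rw [memLp_one_iff_integrable, integrable_haarIoi_iff] at h2
  refine (h2.mono_set Ioc_subset_Ioi_self).congr_fun (fun t ht => ?_) measurableSet_Ioc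
  have ht' : (0 : ℝ) < t := ht.1
  simp only [Pi.smul_apply', indicator_of_mem ht, smul_smul]
  rw [← Real.rpow_add ht', sub_add_cancel, Real.rpow_one, inv_mul_cancel₀ ht'.ne',
    one_smul]

theorem locallyIntegrableOn_of_memLp {σ : ℝ} (hσ : σ < 1) {f : ℝ → E}
    (hf : MemLp (fun t => t ^ σ • f t) 2 haarIoi) : LocallyIntegrableOn f (Ioi 0) := fun t ht =>
  have ht' : (0 : ℝ) < t := ht
  ⟨Ioc 0 (2 * t), mem_nhdsWithin_of_mem_nhds (Ioc_mem_nhds ht' (by linarith)),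
    integrableOn_Ioc_of_memLp hσ hf _⟩

theorem memLp_of_continuousOn {σ : ℝ} (hσ : 0 < σ) {f : ℝ → E} (hf : Continuous f) {R : ℝ}
    (hR : ∀ t, R ≤ t → f t = 0) : MemLp (fun t => t ^ σ • f t) 2 haarIoi := by
  obtain ⟨K, hK⟩ := (isCompact_Icc (a := 0) (b := R)).exists_bound_of_continuousOn hf.continuousOn
  have hm : AEStronglyMeasurable (fun t => t ^ σ • f t) haarIoi :=
    (by fun_prop : Measurable fun t : ℝ => t ^ σ).aestronglyMeasurable.smul hf.aestronglyMeasurable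
  refine ((memLp_indicator_rpow hσ R).const_mul K).mono hm (ae_haarIoi_of_forall fun t ht => ?_)
  rw [norm_smul, norm_mul]
  by_cases htR : t ∈ Ioc 0 R
  · rw [indicator_of_mem htR, mul_comm]
    gcongr
    exact (hK t ⟨htR.1.le, htR.2⟩).trans (le_abs_self K)
  · have : R ≤ t := le_of_not_ge fun h => htR ⟨ht, h⟩
    rw [hR t this]; simp; positivity

omit [NormedSpace ℝ E] in
theorem toLp_eq_of_ae {μ : Measure ℝ} {f : ℝ → E} (hf : MemLp f 2 μ) {F : Lp E 2 μ}
    (h : f =ᵐ[μ] F) : hf.toLp f = F := Lp.ext (hf.coeFn_toLp.trans h)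

variable {H : Type*} [NormedAddCommGroup H] [InnerProductSpace ℂ H]

/-- The weights `t ^ σ` and `t ^ (1 - σ)` cancel the density `t⁻¹`, so the unweighted pairing on
`(0, ∞)` is the inner product of `L²(dt / t)`. -/
theorem integral_inner_of_memLp {σ : ℝ} {F G : ℝ → H} (hF : MemLp (fun t => t ^ σ • F t) 2 haarIoi)
    (hG : MemLp (fun t => t ^ (1 - σ) • G t) 2 haarIoi) :
    IntegrableOn (fun t => ⟪F t, G t⟫_ℂ) (Ioi 0) ∧
      ∫ t in Ioi (0 : ℝ), ⟪F t, G t⟫_ℂ = ⟪hF.toLp _, hG.toLp _⟫_ℂ := by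
  have hae : (fun t => ⟪hF.toLp _ t, hG.toLp _ t⟫_ℂ) =ᵐ[haarIoi]
      fun t => ⟪t ^ σ • F t, t ^ (1 - σ) • G t⟫_ℂ := by
    filter_upwards [hF.coeFn_toLp, hG.coeFn_toLp] with t h1 h2
    rw [h1, h2]
  have hI := (L2.integrable_inner (𝕜 := ℂ) (hF.toLp _) (hG.toLp _)).congr hae
  have hpt : EqOn (fun t : ℝ => t⁻¹ • ⟪t ^ σ • F t, t ^ (1 - σ) • G t⟫_ℂ)
      (fun t => ⟪F t, G t⟫_ℂ) (Ioi 0) := by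
    intro t ht
    have ht' : (0 : ℝ) < t := ht
    simp only
    rw [← coe_smul (t ^ σ), ← coe_smul (t ^ (1 - σ)), inner_smul_left, inner_smul_right, conj_ofReal,
      ← mul_assoc, ← ofReal_mul, ← Real.rpow_add ht', add_sub_cancel, Real.rpow_one, real_smul,
      ← mul_assoc, ← ofReal_mul, inv_mul_cancel₀ ht'.ne', ofReal_one, one_mul]
  rw [integrable_haarIoi_iff] at hI
  refine ⟨hI.congr_fun hpt measurableSet_Ioi, ?_⟩
  rw [L2.inner_def, integral_congr_ae hae, integral_haarIoi]
  exact (setIntegral_congr_fun measurableSet_Ioi hpt).symm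

theorem norm_toLp_sq {f : ℝ → H} (hf : MemLp f 2 haarIoi) :
    ‖hf.toLp f‖ ^ 2 = ∫ t in Ioi (0 : ℝ), t⁻¹ * ‖f t‖ ^ 2 := by
  have h : ((‖hf.toLp f‖ ^ 2 : ℝ) : ℂ) = ∫ t, ((‖f t‖ ^ 2 : ℝ) : ℂ) ∂haarIoi := by
    have := inner_self_eq_norm_sq_to_K (𝕜 := ℂ) (hf.toLp f)
    rw [L2.inner_def] at this
    push_cast
    refine this.symm.trans (integral_congr_ae ?_)
    filter_upwards [hf.coeFn_toLp] with t ht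
    rw [ht, inner_self_eq_norm_sq_to_K]; rfl
  rw [integral_complex_ofReal] at h
  exact (ofReal_injective h).trans (integral_haarIoi _)

end WeightedL2

/-! ### A square function estimate -/

section SquareFunction

/-- The antiderivative `(t / (x + t)) ^ (2 - 2σ) / (2 - 2σ) - (x / (x + t)) ^ (2σ) / (2σ)` takes
values in a bounded interval and its derivative dominates `t ^ (1 - 2σ) x ^ (2σ) / (x + t)²`. -/
theorem integral_kernel_le {σ : ℝ} (hσ : σ ∈ Ioo (0 : ℝ) 1) {x a b : ℝ} (hx : 0 ≤ x) (ha : 0 < a)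
    (hab : a ≤ b) :
    ∫ t in a..b, t ^ (1 - 2 * σ) * (x ^ (2 * σ) * ((x + t)⁻¹ * (x + t)⁻¹))
      ≤ 1 / (2 - 2 * σ) + 1 / (2 * σ) := by
  have h2σ : 0 < 2 * σ := by linarith [hσ.1]
  have h2σ' : 0 < 2 - 2 * σ := by linarith [hσ.2]
  rcases hx.eq_or_lt with rfl | hx
  · simp only [Real.zero_rpow h2σ.ne', zero_mul, mul_zero, intervalIntegral.integral_zero]
    positivity
  let g : ℝ → ℝ := fun t =>
    (t / (x + t)) ^ (2 - 2 * σ) / (2 - 2 * σ) - (x / (x + t)) ^ (2 * σ) / (2 * σ)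
  let g' : ℝ → ℝ := fun t =>
    x / (x + t) ^ 2 * ((t / (x + t)) ^ (1 - 2 * σ) + (x / (x + t)) ^ (2 * σ - 1))
  have hg : ∀ t > 0, HasDerivAt g (g' t) t := by
    intro t ht
    have hxt : x + t ≠ 0 := by positivity
    have d1 : HasDerivAt (fun t : ℝ => t / (x + t)) (x / (x + t) ^ 2) t := by
      refine ((hasDerivAt_id' t).fun_div ((hasDerivAt_id' t).const_add x) hxt).congr_deriv ?_
      ring
    have d2 : HasDerivAt (fun t : ℝ => x / (x + t)) (-(x / (x + t) ^ 2)) t := by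
      refine ((hasDerivAt_const t x).fun_div ((hasDerivAt_id' t).const_add x) hxt).congr_deriv ?_
      ring
    have d3 := (d1.rpow_const (p := 2 - 2 * σ) (Or.inl (by positivity))).div_const (2 - 2 * σ)
    have d4 := (d2.rpow_const (p := 2 * σ) (Or.inl (by positivity))).div_const (2 * σ)
    refine (d3.fun_sub d4).congr_deriv ?_
    simp only [g']
    rw [show 2 - 2 * σ - 1 = 1 - 2 * σ by ring, mul_right_comm, mul_div_cancel_right₀ _ h2σ'.ne',
      mul_right_comm, mul_div_cancel_right₀ _ h2σ.ne']
    ring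
  have hle : ∀ t ∈ Ioo a b, t ^ (1 - 2 * σ) * (x ^ (2 * σ) * ((x + t)⁻¹ * (x + t)⁻¹)) ≤ g' t := by
    intro t ht
    have ht0 : 0 < t := ha.trans ht.1
    have hxt : 0 < x + t := by positivity
    have e : t ^ (1 - 2 * σ) * (x ^ (2 * σ) * ((x + t)⁻¹ * (x + t)⁻¹))
        = x / (x + t) ^ 2 * ((t / (x + t)) ^ (1 - 2 * σ) * (x / (x + t)) ^ (2 * σ - 1)) := by
      rw [Real.div_rpow ht0.le hxt.le, Real.div_rpow hx.le hxt.le, Real.rpow_sub_one hx.ne',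
        show 2 * σ - 1 = -(1 - 2 * σ) by ring, Real.rpow_neg hxt.le]
      have := (Real.rpow_pos_of_pos hxt (1 - 2 * σ)).ne'
      field_simp
    rw [e]
    refine mul_le_mul_of_nonneg_left ?_ (by positivity)
    have p1 : 0 < (t / (x + t)) ^ (1 - 2 * σ) := by positivity
    have p2 : 0 < (x / (x + t)) ^ (2 * σ - 1) := by positivity
    have q1 : t / (x + t) ≤ 1 := div_le_one_of_le₀ (by linarith) hxt.le
    have q2 : x / (x + t) ≤ 1 := div_le_one_of_le₀ (by linarith) hxt.le
    rcases le_total 0 (1 - 2 * σ) with h | h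
    · have := Real.rpow_le_one (by positivity) q1 h
      nlinarith
    · have := Real.rpow_le_one (by positivity) q2 (by linarith : 0 ≤ 2 * σ - 1)
      nlinarith
  have hint : IntegrableOn (fun t => t ^ (1 - 2 * σ) * (x ^ (2 * σ) * ((x + t)⁻¹ * (x + t)⁻¹)))
      (Icc a b) := by
    refine ContinuousOn.integrableOn_Icc fun t ht => ?_
    have ht0 : 0 < t := ha.trans_le ht.1
    have c1 : ContinuousAt (fun t : ℝ => t ^ (1 - 2 * σ)) t :=
      Real.continuousAt_rpow_const _ _ (Or.inl ht0.ne')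
    have c2 : ContinuousAt (fun t : ℝ => (x + t)⁻¹) t :=
      ContinuousAt.inv₀ (by fun_prop) (by positivity)
    exact (c1.mul (continuousAt_const.mul (c2.mul c2))).continuousWithinAt
  refine (intervalIntegral.integral_le_sub_of_hasDeriv_right_of_le hab
    (fun t ht => (hg t (ha.trans_le ht.1)).continuousAt.continuousWithinAt)
    (fun t ht => (hg t (ha.trans ht.1)).hasDerivWithinAt) hint hle).trans ?_
  have hb : 0 < b := ha.trans_le hab
  have b1 : (b / (x + b)) ^ (2 - 2 * σ) ≤ 1 := Real.rpow_le_one (by positivity)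
    (div_le_one_of_le₀ (by linarith) (by positivity)) h2σ'.le
  have b2 : (x / (x + a)) ^ (2 * σ) ≤ 1 := Real.rpow_le_one (by positivity)
    (div_le_one_of_le₀ (by linarith) (by positivity)) h2σ.le
  have b3 : 0 ≤ (a / (x + a)) ^ (2 - 2 * σ) / (2 - 2 * σ) := by positivity
  have b4 : 0 ≤ (x / (x + b)) ^ (2 * σ) / (2 * σ) := by positivity
  have b5 : (b / (x + b)) ^ (2 - 2 * σ) / (2 - 2 * σ) ≤ 1 / (2 - 2 * σ) := by gcongr
  have b6 : (x / (x + a)) ^ (2 * σ) / (2 * σ) ≤ 1 / (2 * σ) := by gcongr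
  simp only [g]
  linarith

variable {H : Type*} [NormedAddCommGroup H] [InnerProductSpace ℂ H] [CompleteSpace H]
  {T : H →L[ℂ] H}

/-- The operator `t ^ (1 - σ) T ^ σ (T + t)⁻¹`. -/
noncomputable def sq (T : H →L[ℂ] H) (σ t : ℝ) : H →L[ℂ] H := t ^ (1 - σ) • (pw T σ * rs T t)

theorem continuousOn_sq (hT : 0 ≤ T) (σ : ℝ) : ContinuousOn (sq T σ) (Ioi 0) := by
  refine ContinuousOn.smul (f := fun t : ℝ => t ^ (1 - σ)) (g := fun t => pw T σ * rs T t)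
    (fun t ht => ?_) (continuousOn_const.mul (continuousOn_rs_param hT))
  exact (Real.continuousAt_rpow_const _ _ (Or.inl (ne_of_gt ht))).continuousWithinAt

/-- The integrand of the square function as the quadratic form of a function of `T`. -/
theorem inv_mul_norm_sq_sq (hT : 0 ≤ T) {σ : ℝ} (hσ : σ ∈ Ioo (0 : ℝ) 1) {t : ℝ} (ht : 0 < t)
    (h : H) : t⁻¹ * ‖sq T σ t h‖ ^ 2 = (⟪h, fc T (fun x =>
      ((t ^ (1 - 2 * σ) * (x ^ (2 * σ) * ((x + t)⁻¹ * (x + t)⁻¹)) : ℝ) : ℂ)) h⟫_ℂ).re := by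
  have e1 : fc T (fun x => ((t ^ (1 - 2 * σ) * (x ^ (2 * σ) * ((x + t)⁻¹ * (x + t)⁻¹)) : ℝ) : ℂ))
      = ((t ^ (1 - 2 * σ) : ℝ) : ℂ) • (pw T σ * rs T t) * (pw T σ * rs T t) := by
    have c1 := continuousOn_pw hσ.1.le
    have c2 := continuousOn_rs ht
    rw [pw, rs, ← fc_mul hT c1 c2, smul_mul_assoc, ← fc_mul hT (c1.fun_mul c2) (c1.fun_mul c2),
      ← fc_const_mul hT _ ((c1.fun_mul c2).fun_mul (c1.fun_mul c2))]
    refine fc_congr hT fun x hx => ?_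
    rw [two_mul σ, Real.rpow_add_of_nonneg hx hσ.1.le hσ.1.le]
    push_cast
    ring
  have e2 : ∀ x y, ⟪x, (pw T σ * rs T t) y⟫_ℂ = ⟪(pw T σ * rs T t) x, y⟫_ℂ := by
    intro x y
    change ⟪x, pw T σ (rs T t y)⟫_ℂ = ⟪pw T σ (rs T t x), y⟫_ℂ
    rw [← pw_inner, ← rs_inner, pw_comm_rs]
  rw [e1, sq]
  change t⁻¹ * ‖t ^ (1 - σ) • (pw T σ * rs T t) h‖ ^ 2
    = (⟪h, ((t ^ (1 - 2 * σ) : ℝ) : ℂ) • (pw T σ * rs T t) ((pw T σ * rs T t) h)⟫_ℂ).re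
  rw [inner_smul_right, e2, inner_self_eq_norm_sq_to_K, norm_smul, Real.norm_of_nonneg (by positivity)]
  have hc : ∀ r : ℝ, (RCLike.ofReal r : ℂ) = (r : ℂ) := fun _ => rfl
  rw [hc, ← ofReal_pow, ← ofReal_mul, ofReal_re, mul_pow, ← mul_assoc]
  congr 1
  rw [← Real.rpow_neg_one, ← Real.rpow_natCast, ← Real.rpow_mul ht.le, ← Real.rpow_add ht]
  congr 1
  push_cast
  ring

/-- The scalar estimate `integral_kernel_le`, integrated under the functional calculus. -/
theorem integral_sq_Icc_le (hT : 0 ≤ T) {σ : ℝ} (hσ : σ ∈ Ioo (0 : ℝ) 1) {a b : ℝ} (ha : 0 < a)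
    (hab : a ≤ b) (h : H) :
    ∫ t in Icc a b, t⁻¹ * ‖sq T σ t h‖ ^ 2 ≤ (1 / (2 - 2 * σ) + 1 / (2 * σ)) * ‖h‖ ^ 2 := by
  have hn : IsStarNormal T := (IsSelfAdjoint.of_nonneg hT).isStarNormal
  set C : ℝ := 1 / (2 - 2 * σ) + 1 / (2 * σ) with hC
  have h2σ : 0 < 2 * σ := by linarith [hσ.1]
  have h2σ' : 0 < 2 - 2 * σ := by linarith [hσ.2]
  have hC0 : 0 ≤ C := by positivity
  let k : ℝ → ℝ → ℝ := fun t x => t ^ (1 - 2 * σ) * (x ^ (2 * σ) * ((x + t)⁻¹ * (x + t)⁻¹))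
  have hcont : ContinuousOn (fun p : ℝ × ℝ => k p.1 p.2) (Icc a b ×ˢ Icc 0 ‖T‖) := by
    rintro ⟨t, x⟩ ⟨ht, hx⟩
    have ht0 : 0 < t := ha.trans_le ht.1
    have hx0 : 0 ≤ x := hx.1
    have c1 : ContinuousAt (fun p : ℝ × ℝ => p.1 ^ (1 - 2 * σ)) (t, x) :=
      ContinuousAt.rpow_const (by fun_prop) (Or.inl ht0.ne')
    have c2 : ContinuousAt (fun p : ℝ × ℝ => p.2 ^ (2 * σ)) (t, x) :=
      ContinuousAt.rpow_const (by fun_prop) (Or.inr h2σ.le)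
    have c3 : ContinuousAt (fun p : ℝ × ℝ => (p.2 + p.1)⁻¹) (t, x) :=
      ContinuousAt.inv₀ (by fun_prop) (by positivity)
    exact (c1.mul (c2.mul (c3.mul c3))).continuousWithinAt
  obtain ⟨K, hK⟩ := (isCompact_Icc.prod isCompact_Icc).exists_bound_of_continuousOn hcont
  let f : ℝ → ℂ → ℂ := fun t w => (k t w.re : ℂ)
  have hf : ContinuousOn (Function.uncurry f) (Icc a b ×ˢ spectrum ℂ T) := by
    refine continuous_ofReal.comp_continuousOn (hcont.comp (f := fun p : ℝ × ℂ => (p.1, p.2.re))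
      (by fun_prop) ?_)
    exact fun p hp => ⟨hp.1, (mem_spectrum_of_nonneg hT hp.2).1⟩
  have hb : ∀ᵐ t ∂volume.restrict (Icc a b), ∀ w ∈ spectrum ℂ T, ‖f t w‖ ≤ K :=
    ae_restrict_of_forall_mem measurableSet_Icc fun t ht w hw => by
      rw [norm_real]
      exact hK (t, w.re) ⟨ht, (mem_spectrum_of_nonneg hT hw).1⟩
  have hfin : HasFiniteIntegral (fun _ : ℝ => K) (volume.restrict (Icc a b)) :=
    (integrable_const K).2
  have hI := integrableOn_cfc measurableSet_Icc f (fun _ => K) T hf hb hfin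
  have hE := cfc_setIntegral measurableSet_Icc f (fun _ => K) T hf hb hfin
  have hA : ∫ t in Icc a b, t⁻¹ * ‖sq T σ t h‖ ^ 2 = (⟪h, (∫ t in Icc a b, cfc (f t) T) h⟫_ℂ).re := by
    have e1 : (∫ t in Icc a b, cfc (f t) T) h = ∫ t in Icc a b, cfc (f t) T h :=
      ((ContinuousLinearMap.apply ℂ H h).integral_comp_comm hI).symm
    have hI' : IntegrableOn (fun t => cfc (f t) T h) (Icc a b) :=
      (ContinuousLinearMap.apply ℂ H h).integrable_comp hI
    have e2 : ⟪h, ∫ t in Icc a b, cfc (f t) T h⟫_ℂ = ∫ t in Icc a b, ⟪h, cfc (f t) T h⟫_ℂ :=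
      (integral_inner hI' h).symm
    rw [e1, e2]
    have e3 := integral_re (𝕜 := ℂ) (hI'.const_inner h)
    refine Eq.trans ?_ e3
    exact setIntegral_congr_fun measurableSet_Icc fun t ht =>
      inv_mul_norm_sq_sq hT hσ (ha.trans_le ht.1) h
  rw [hA, ← hE]
  have hnorm : ‖cfc (fun w => ∫ t in Icc a b, f t w) T‖ ≤ C := by
    refine norm_cfc_le hC0 fun w hw => ?_
    have hx := (mem_spectrum_of_nonneg hT hw).1.1
    simp only [f]
    rw [integral_complex_ofReal, norm_real, Real.norm_of_nonneg, integral_Icc_eq_integral_Ioc,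
      ← intervalIntegral.integral_of_le hab]
    · exact integral_kernel_le hσ hx ha hab
    · refine setIntegral_nonneg measurableSet_Icc fun t ht => ?_
      have := ha.trans_le ht.1
      simp only [k]
      positivity
  refine (re_le_norm _).trans ((norm_inner_le_norm _ _).trans ?_)
  have := ContinuousLinearMap.le_of_opNorm_le _ hnorm h
  nlinarith [norm_nonneg h]

theorem integral_sq_le (hT : 0 ≤ T) {σ : ℝ} (hσ : σ ∈ Ioo (0 : ℝ) 1) (h : H) :
    IntegrableOn (fun t => t⁻¹ * ‖sq T σ t h‖ ^ 2) (Ioi 0) ∧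
    ∫ t in Ioi (0 : ℝ), t⁻¹ * ‖sq T σ t h‖ ^ 2 ≤ (1 / (2 - 2 * σ) + 1 / (2 * σ)) * ‖h‖ ^ 2 := by
  have hcov : AECover (volume.restrict (Ioi (0 : ℝ))) atTop
      fun n : ℕ => Icc (1 / ((n : ℝ) + 1)) ((n : ℝ) + 1) := by
    refine ⟨?_, fun n => measurableSet_Icc⟩
    refine ae_restrict_of_forall_mem measurableSet_Ioi fun t ht => ?_
    have h1 : ∀ᶠ n : ℕ in atTop, 1 / ((n : ℝ) + 1) < t :=
      tendsto_one_div_add_atTop_nhds_zero_nat.eventually_lt_const ht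
    filter_upwards [h1, eventually_ge_atTop ⌈t⌉₊] with n hn hn'
    have := Nat.le_of_ceil_le hn'
    exact ⟨hn.le, by linarith⟩
  have hpos : ∀ n : ℕ, 0 < 1 / ((n : ℝ) + 1) := fun n => by positivity
  have hle : ∀ n : ℕ, 1 / ((n : ℝ) + 1) ≤ (n : ℝ) + 1 := fun n => by
    rw [div_le_iff₀ (by positivity)]
    nlinarith [(Nat.cast_nonneg n : (0 : ℝ) ≤ n)]
  have hsub : ∀ n : ℕ, Icc (1 / ((n : ℝ) + 1)) ((n : ℝ) + 1) ⊆ Ioi 0 :=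
    fun n t ht => (hpos n).trans_le ht.1
  have hcont : ContinuousOn (fun t => t⁻¹ * ‖sq T σ t h‖ ^ 2) (Ioi 0) :=
    (continuousOn_inv₀.mono fun t ht => ne_of_gt ht).mul
      (((continuousOn_sq hT σ).clm_apply continuousOn_const).norm.pow 2)
  have hres : ∀ n : ℕ, (volume.restrict (Ioi (0 : ℝ))).restrict
      (Icc (1 / ((n : ℝ) + 1)) ((n : ℝ) + 1)) = volume.restrict (Icc (1 / ((n : ℝ) + 1)) ((n : ℝ) + 1)) :=
    fun n => by rw [Measure.restrict_restrict measurableSet_Icc, inter_eq_left.2 (hsub n)]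
  have hbd : ∀ n : ℕ, ∫ t in Icc (1 / ((n : ℝ) + 1)) ((n : ℝ) + 1), t⁻¹ * ‖sq T σ t h‖ ^ 2
      ∂volume.restrict (Ioi 0) ≤ (1 / (2 - 2 * σ) + 1 / (2 * σ)) * ‖h‖ ^ 2 := fun n => by
    rw [hres n]
    exact integral_sq_Icc_le hT hσ (hpos n) (hle n) h
  have hint : Integrable (fun t => t⁻¹ * ‖sq T σ t h‖ ^ 2) (volume.restrict (Ioi 0)) := by
    refine hcov.integrable_of_integral_bounded_of_nonneg_ae _ (fun n => ?_)
      (ae_restrict_of_forall_mem measurableSet_Ioi fun t ht => ?_) (Eventually.of_forall hbd)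
    · rw [IntegrableOn, hres n]
      exact (hcont.mono (hsub n)).integrableOn_Icc
    · have : (0 : ℝ) < t := ht
      positivity
  exact ⟨hint, le_of_tendsto (hcov.integral_tendsto_of_countably_generated hint)
    (Eventually.of_forall hbd)⟩

end SquareFunction

/-! ### The weighted Sobolev space as a space of pairs -/

section SobolevPairs

variable {H : Type*} [NormedAddCommGroup H] [InnerProductSpace ℂ H]

/-- Pairs `(V, G)` of elements of `L²((0, ∞), dt / t)`. The pair `(t ^ (1 - s) v, t ^ (1 - s) g)`
represents the function `T v` with derivative `g`. -/
abbrev PairSpace (H : Type*) [NormedAddCommGroup H] [InnerProductSpace ℂ H] : Type _ :=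
  WithLp 2 (Lp H 2 haarIoi × Lp H 2 haarIoi)

theorem rpow_smul_rpow_smul_ae {E : Type*} [NormedAddCommGroup E] [NormedSpace ℝ E] {σ τ ρ : ℝ}
    (h : σ + τ = ρ) (f : ℝ → E) :
    (fun t : ℝ => t ^ σ • t ^ τ • f t) =ᵐ[haarIoi] fun t => t ^ ρ • f t :=
  ae_haarIoi_of_forall fun t ht => by
    simp only [smul_smul, ← Real.rpow_add ht, h]

theorem rpow_smul_rpow_smul_ae_self {E : Type*} [NormedAddCommGroup E] [NormedSpace ℝ E] {σ τ : ℝ}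
    (h : σ + τ = 0) (f : ℝ → E) : (fun t : ℝ => t ^ σ • t ^ τ • f t) =ᵐ[haarIoi] f :=
  (rpow_smul_rpow_smul_ae h f).trans (Eventually.of_forall fun t => by
    simp only [Real.rpow_zero, one_smul])

theorem memLp_rpow_smul_clm {E F : Type*} [NormedAddCommGroup E] [NormedSpace ℂ E]
    [NormedAddCommGroup F] [NormedSpace ℂ F] {σ : ℝ} (B : E →L[ℂ] F) {u : ℝ → E}
    (hu : MemLp (fun t => t ^ σ • u t) 2 haarIoi) : MemLp (fun t => t ^ σ • B (u t)) 2 haarIoi := by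
  refine (memLp_congr_ae (Eventually.of_forall fun t => ?_)).1 (B.comp_memLp' hu)
  simp only [Function.comp, ContinuousLinearMap.map_smul_of_tower]

theorem memLp_unweight (s : ℝ) (F : Lp H 2 haarIoi) :
    MemLp (fun t : ℝ => t ^ (1 - s) • t ^ (s - 1) • F t) 2 haarIoi :=
  (memLp_congr_ae (rpow_smul_rpow_smul_ae_self (by ring) _)).2 (Lp.memLp F)

theorem toLp_unweight (s : ℝ) (F : Lp H 2 haarIoi) : (memLp_unweight s F).toLp _ = F :=
  toLp_eq_of_ae _ (rpow_smul_rpow_smul_ae_self (by ring) _)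

theorem exists_forall_ge_eq_zero {E : Type*} [NormedAddCommGroup E] {f : ℝ → E}
    (hc : HasCompactSupport f) : ∃ R, ∀ t, R ≤ t → f t = 0 := by
  obtain ⟨b, hb⟩ := hc.isCompact.bddAbove
  refine ⟨b + 1, fun t ht => image_eq_zero_of_notMem_tsupport fun h => ?_⟩
  linarith [hb h]

variable [CompleteSpace H] {T : H →L[ℂ] H}

/-- The pairs `(t ^ s φ' T k, t ^ s φ k)` for test functions `φ` and vectors `k`; testing against
them is the definition of the weak derivative. -/
def testPairs (T : H →L[ℂ] H) (s : ℝ) : Set (PairSpace H) :=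
  {p | ∃ (φ : ℝ → ℂ) (k : H), ContDiff ℝ ∞ φ ∧ HasCompactSupport φ ∧ tsupport φ ⊆ Ioi 0 ∧
    p.fst =ᵐ[haarIoi] (fun t => t ^ s • deriv φ t • T k) ∧
    p.snd =ᵐ[haarIoi] (fun t => t ^ s • φ t • k)}

/-- The Hilbert space of all pairs `(t ^ (1 - s) v, t ^ (1 - s) g)` in `L²(dt / t)` such that `g` is
the weak derivative of `T v`. -/
noncomputable def sobolevPairs (T : H →L[ℂ] H) (s : ℝ) : Submodule ℂ (PairSpace H) :=
  (Submodule.span ℂ (testPairs T s))ᗮ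

omit [CompleteSpace H] in
theorem exists_testPair {s : ℝ} (hs : s ∈ Ioo (0 : ℝ) 1) {φ : ℝ → ℂ} (hφ : ContDiff ℝ ∞ φ)
    (hc : HasCompactSupport φ) (hsupp : tsupport φ ⊆ Ioi 0) (k : H) :
    ∃ p ∈ testPairs T s, p.fst =ᵐ[haarIoi] (fun t => t ^ s • deriv φ t • T k) ∧
      p.snd =ᵐ[haarIoi] (fun t => t ^ s • φ t • k) := by
  have hφ' : Continuous (deriv φ) := hφ.continuous_deriv (by simp)
  have hφ0 : Continuous φ := hφ.continuous
  obtain ⟨R, hR⟩ := exists_forall_ge_eq_zero hc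
  obtain ⟨R', hR'⟩ := exists_forall_ge_eq_zero hc.deriv
  have m1 : MemLp (fun t => t ^ s • deriv φ t • T k) 2 haarIoi :=
    memLp_of_continuousOn hs.1 (by fun_prop) fun t ht => by rw [hR' t ht, zero_smul]
  have m2 : MemLp (fun t => t ^ s • φ t • k) 2 haarIoi :=
    memLp_of_continuousOn hs.1 (by fun_prop) fun t ht => by rw [hR t ht, zero_smul]
  exact ⟨WithLp.toLp 2 (m1.toLp _, m2.toLp _), ⟨φ, k, hφ, hc, hsupp, m1.coeFn_toLp, m2.coeFn_toLp⟩,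
    m1.coeFn_toLp, m2.coeFn_toLp⟩

/-- The inner product with a test pair is the defect in the definition of the weak derivative. -/
theorem inner_testPair {s : ℝ} (hs : s ∈ Ioo (0 : ℝ) 1) {φ : ℝ → ℂ} (hφ : ContDiff ℝ ∞ φ)
    (hc : HasCompactSupport φ) (hsupp : tsupport φ ⊆ Ioi 0) {k : H} {p : PairSpace H}
    (h1 : p.fst =ᵐ[haarIoi] (fun t => t ^ s • deriv φ t • T k))
    (h2 : p.snd =ᵐ[haarIoi] (fun t => t ^ s • φ t • k)) (hT : 0 ≤ T) (z : PairSpace H) :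
    ⟪p, z⟫_ℂ = ⟪k, (∫ t in Ioi (0 : ℝ), star (deriv φ t) • T (t ^ (s - 1) • z.fst t)) +
      ∫ t in Ioi (0 : ℝ), star (φ t) • t ^ (s - 1) • z.snd t⟫_ℂ := by
  have hs' : 1 - s < 1 := by linarith [hs.1]
  have hφ' : Continuous (deriv φ) := hφ.continuous_deriv (by simp)
  have hts : tsupport (fun t => star (φ t)) ⊆ tsupport φ :=
    closure_mono fun t ht h => ht (by simp [h])
  have hts' : tsupport (fun t => star (deriv φ t)) ⊆ tsupport (deriv φ) :=
    closure_mono fun t ht h => ht (by simp [h])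
  have l1 : LocallyIntegrableOn (fun t => T (t ^ (s - 1) • z.fst t)) (Ioi 0) :=
    locallyIntegrableOn_clm_comp (locallyIntegrableOn_of_memLp hs' (memLp_unweight s z.fst)) T
  have l2 := locallyIntegrableOn_of_memLp hs' (memLp_unweight s z.snd)
  have i1 := (integrable_smul_of_tsupport_subset (φ := fun t => star (deriv φ t)) (by fun_prop)
    (hc.deriv.comp_left (star_zero ℂ)) (hts'.trans (tsupport_deriv_subset.trans hsupp))
    l1).integrableOn (s := Ioi 0)
  have i2 := (integrable_smul_of_tsupport_subset (φ := fun t => star (φ t))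
    (by have := hφ.continuous; fun_prop)
    (hc.comp_left (star_zero ℂ)) (hts.trans hsupp) l2).integrableOn (s := Ioi 0)
  have m1 : MemLp (fun t => t ^ s • deriv φ t • T k) 2 haarIoi :=
    (memLp_congr_ae h1).1 (Lp.memLp p.fst)
  have m2 : MemLp (fun t => t ^ s • φ t • k) 2 haarIoi := (memLp_congr_ae h2).1 (Lp.memLp p.snd)
  have e1 := (integral_inner_of_memLp m1 (memLp_unweight s z.fst)).2
  have e2 := (integral_inner_of_memLp m2 (memLp_unweight s z.snd)).2
  rw [toLp_eq_of_ae m1 h1.symm, toLp_unweight] at e1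
  rw [toLp_eq_of_ae m2 h2.symm, toLp_unweight] at e2
  have e0 : ⟪p, z⟫_ℂ = ⟪p.fst, z.fst⟫_ℂ + ⟪p.snd, z.snd⟫_ℂ := WithLp.prod_inner_apply p z
  rw [e0, ← e1, ← e2, inner_add_right, ← integral_inner i1,
    ← integral_inner i2]
  congr 1
  · refine integral_congr_ae (Eventually.of_forall fun t => ?_)
    simp only
    rw [inner_smul_left, inner_smul_right, inner_of_nonneg hT]; rfl
  · refine integral_congr_ae (Eventually.of_forall fun t => ?_)
    simp only
    rw [inner_smul_left, inner_smul_right]; rfl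

theorem mem_sobolevPairs_iff (hT : 0 ≤ T) {s : ℝ} (hs : s ∈ Ioo (0 : ℝ) 1) {z : PairSpace H} :
    z ∈ sobolevPairs T s ↔
      HasWeakDeriv (fun t => T (t ^ (s - 1) • z.fst t)) (fun t => t ^ (s - 1) • z.snd t) := by
  have hs' : 1 - s < 1 := by linarith [hs.1]
  constructor
  · intro hz
    refine ⟨locallyIntegrableOn_clm_comp
      (locallyIntegrableOn_of_memLp hs' (memLp_unweight s z.fst)) T,
      locallyIntegrableOn_of_memLp hs' (memLp_unweight s z.snd), fun φ hφ hc hsupp => ?_⟩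
    have hts : tsupport (fun t => star (φ t)) ⊆ tsupport φ :=
      closure_mono fun t ht h => ht (by simp [h])
    rw [neg_eq_iff_add_eq_zero]
    refine ext_inner_left ℂ fun k => ?_
    have hφ' : ContDiff ℝ ∞ fun t => star (φ t) :=
      (starL' ℝ : ℂ ≃L[ℝ] ℂ).contDiff.comp hφ
    have hc' : HasCompactSupport fun t => star (φ t) := hc.comp_left (star_zero ℂ)
    obtain ⟨p, hp, h1, h2⟩ := exists_testPair (T := T) hs hφ' hc' (hts.trans hsupp) k
    have := inner_testPair hs hφ' hc' (hts.trans hsupp) h1 h2 hT z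
    rw [(Submodule.mem_orthogonal _ _).1 hz p (Submodule.subset_span hp)] at this
    simp only [deriv.star, star_star] at this
    rw [inner_zero_right]
    exact this.symm
  · intro h
    rw [sobolevPairs, Submodule.mem_orthogonal]
    intro p hp
    induction hp using Submodule.span_induction with
    | mem p hp =>
      obtain ⟨φ, k, hφ, hc, hsupp, h1, h2⟩ := hp
      have hts : tsupport (fun t => star (φ t)) ⊆ tsupport φ :=
        closure_mono fun t ht h => ht (by simp [h])
      have := h.integral_eq (fun t => star (φ t)) ((starL' ℝ : ℂ ≃L[ℝ] ℂ).contDiff.comp hφ)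
        (hc.comp_left (star_zero ℂ)) (hts.trans hsupp)
      simp only [deriv.star] at this
      rw [inner_testPair hs hφ hc hsupp h1 h2 hT z, ← this, add_neg_cancel, inner_zero_right]
    | zero => exact inner_zero_left _
    | add x y _ _ hx hy => rw [inner_add_left, hx, hy, add_zero]
    | smul c x _ hx => rw [inner_smul_left, hx, mul_zero]

/-! ### Extension and trace -/

omit [CompleteSpace H] in
/-- A square function estimate for the family `K t` gives a bounded operator `x ↦ (t ↦ K t x)`
into `L²(dt / t)`. -/
theorem exists_clm_of_integral_le {K : ℝ → H →L[ℂ] H} (hK : ContinuousOn K (Ioi 0)) {C : ℝ}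
    (h : ∀ x, IntegrableOn (fun t => t⁻¹ * ‖K t x‖ ^ 2) (Ioi 0) ∧
      ∫ t in Ioi (0 : ℝ), t⁻¹ * ‖K t x‖ ^ 2 ≤ C * ‖x‖ ^ 2) :
    ∃ R : H →L[ℂ] Lp H 2 haarIoi, ∀ x, R x =ᵐ[haarIoi] fun t => K t x := by
  have hm : ∀ x, MemLp (fun t => K t x) 2 haarIoi := fun x => by
    have : AEStronglyMeasurable (fun t => K t x) haarIoi := aestronglyMeasurable_haarIoi.2
      ((hK.clm_apply continuousOn_const).aestronglyMeasurable measurableSet_Ioi)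
    rw [memLp_two_iff_integrable_sq_norm this, integrable_haarIoi_iff]
    exact (h x).1
  let R : H →ₗ[ℂ] Lp H 2 haarIoi :=
    { toFun := fun x => (hm x).toLp _
      map_add' := fun x y => by
        rw [← MemLp.toLp_add]; congr 1; ext t; simp
      map_smul' := fun c x => by
        rw [RingHom.id_apply, ← MemLp.toLp_const_smul]; congr 1; ext t; simp }
  refine ⟨R.mkContinuous (√|C|) fun x => ?_, fun x => (hm x).coeFn_toLp⟩
  refine le_of_sq_le_sq ?_ (by positivity)
  rw [mul_pow, Real.sq_sqrt (abs_nonneg C)]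
  refine (norm_toLp_sq (hm x)).le.trans ((h x).2.trans ?_)
  gcongr
  exact le_abs_self C

/-- The derivative of the extension `t ↦ T ^ (1 + σ) (T + t)⁻¹`, multiplied by `t ^ (1 - σ)`. -/
noncomputable def sqDeriv (T : H →L[ℂ] H) (σ t : ℝ) : H →L[ℂ] H := -((T * rs T t) * sq T σ t)

theorem exists_sq_clm (hT : 0 ≤ T) {σ : ℝ} (hσ : σ ∈ Ioo (0 : ℝ) 1) :
    (∃ R : H →L[ℂ] Lp H 2 haarIoi, ∀ x, R x =ᵐ[haarIoi] fun t => sq T σ t x) ∧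
    ∃ R : H →L[ℂ] Lp H 2 haarIoi, ∀ x, R x =ᵐ[haarIoi] fun t => sqDeriv T σ t x := by
  have hc := continuousOn_sq hT σ
  have hc' : ContinuousOn (sqDeriv T σ) (Ioi 0) :=
    ((continuousOn_const.mul (continuousOn_rs_param hT)).mul hc).neg
  refine ⟨exists_clm_of_integral_le hc fun x => integral_sq_le hT hσ x,
    exists_clm_of_integral_le (C := 1 / (2 - 2 * σ) + 1 / (2 * σ)) hc' fun x => ?_⟩
  obtain ⟨h1, h2⟩ := integral_sq_le hT hσ x
  have hle : ∀ t ∈ Ioi (0 : ℝ), t⁻¹ * ‖sqDeriv T σ t x‖ ^ 2 ≤ t⁻¹ * ‖sq T σ t x‖ ^ 2 := by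
    intro t ht
    have ht' : (0 : ℝ) < t := ht
    have : ‖sqDeriv T σ t x‖ ≤ ‖sq T σ t x‖ := by
      refine (norm_neg _).le.trans ?_
      exact ((T * rs T t).le_of_opNorm_le (norm_T_rs_le hT ht') _).trans (one_mul _).le
    gcongr
  have hcont : ContinuousOn (fun t => t⁻¹ * ‖sqDeriv T σ t x‖ ^ 2) (Ioi 0) :=
    (continuousOn_inv₀.mono fun t ht => ne_of_gt ht).mul
      ((hc'.clm_apply continuousOn_const).norm.pow 2)
  have hint : IntegrableOn (fun t => t⁻¹ * ‖sqDeriv T σ t x‖ ^ 2) (Ioi 0) := by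
    refine h1.mono' (hcont.aestronglyMeasurable measurableSet_Ioi)
      (ae_restrict_of_forall_mem measurableSet_Ioi fun t ht => ?_)
    have ht' : (0 : ℝ) < t := ht
    rw [Real.norm_of_nonneg (by positivity)]
    exact hle t ht
  exact ⟨hint, (setIntegral_mono_on hint h1 measurableSet_Ioi hle).trans h2⟩

theorem hasDerivAt_rs_apply (hT : 0 ≤ T) {t : ℝ} (ht : 0 < t) (A : H →L[ℂ] H) (x : H) :
    HasDerivAt (fun r => A (rs T r x)) (-(A (rs T t (rs T t x)))) t := by
  let B : (H →L[ℂ] H) →L[ℝ] H :=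
    (A.comp (ContinuousLinearMap.apply ℂ H x)).restrictScalars ℝ
  have h := B.hasFDerivAt.comp_hasDerivAt t (hasDerivAt_rs hT ht)
  rw [map_neg] at h
  exact h

theorem isPrim_rs_apply (hT : 0 ≤ T) (A : H →L[ℂ] H) (x : H) :
    IsPrim (fun t => A (rs T t x)) (fun t => -(A (rs T t (rs T t x)))) := by
  refine IsPrim.of_hasDerivAt (fun t ht => hasDerivAt_rs_apply hT ht A x) ?_
  have := continuousOn_rs_param hT
  exact (A.continuous.comp_continuousOn (this.clm_apply (this.clm_apply continuousOn_const))).neg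

/-- The trace operator and a bounded right inverse: `T ^ s (τ z)` is the trace at `0` of the
function represented by `z`. The trace is the pairing with the extension operator for
the parameter `1 - s`, by integration by parts. -/
theorem exists_trace_extension (hT : 0 ≤ T) (hinj : Function.Injective T) {s : ℝ}
    (hs : s ∈ Ioo (0 : ℝ) 1) :
    ∃ (τ : PairSpace H →L[ℂ] H) (e : H →L[ℂ] PairSpace H), (∀ h, e h ∈ sobolevPairs T s) ∧
      (∀ z ∈ sobolevPairs T s, ∃ w, IsPrim w (fun t => t ^ (s - 1) • z.snd t) ∧
        w =ᵐ[volume.restrict (Ioi 0)] (fun t => T (t ^ (s - 1) • z.fst t)) ∧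
        Tendsto w (𝓝[>] 0) (𝓝 (pw T s (τ z)))) ∧ ∀ h, τ (e h) = h := by
  have hs1 : 1 - s ∈ Ioo (0 : ℝ) 1 := ⟨by linarith [hs.2], by linarith [hs.1]⟩
  obtain ⟨⟨R, hR⟩, ⟨R', hR'⟩⟩ := exists_sq_clm hT hs1
  obtain ⟨⟨S, hS⟩, ⟨S', hS'⟩⟩ := exists_sq_clm hT hs
  let τ : PairSpace H →L[ℂ] H :=
    -(R.adjoint ∘L WithLp.sndL 2 ℂ _ _ + R'.adjoint ∘L WithLp.fstL 2 ℂ _ _)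
  have hτ : ∀ k z, ⟪k, τ z⟫_ℂ = -(⟪R k, z.snd⟫_ℂ + ⟪R' k, z.fst⟫_ℂ) := by
    intro k z
    simp only [← ContinuousLinearMap.adjoint_inner_right, ← inner_add_right, ← inner_neg_right]
    rfl
  let e : H →L[ℂ] PairSpace H :=
    (WithLp.prodContinuousLinearEquiv 2 ℂ _ _).symm.toContinuousLinearMap ∘L (S.prod S')
  have he1 : ∀ h, (e h).fst = S h := fun h => rfl
  have he2 : ∀ h, (e h).snd = S' h := fun h => rfl
  have htrace : ∀ z ∈ sobolevPairs T s, ∃ w, IsPrim w (fun t => t ^ (s - 1) • z.snd t) ∧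
        w =ᵐ[volume.restrict (Ioi 0)] (fun t => T (t ^ (s - 1) • z.fst t)) ∧
        Tendsto w (𝓝[>] 0) (𝓝 (pw T s (τ z))) := by
    intro z hz
    have hw := (mem_sobolevPairs_iff hT hs).1 hz
    obtain ⟨w, hwu, hw⟩ := hw.exists_isPrim
    refine ⟨w, hw, hwu, ?_⟩
    obtain ⟨x, hx⟩ := hw.exists_tendsto
      (integrableOn_Ioc_of_memLp (by linarith [hs.1]) (memLp_unweight s z.snd))
    suffices pw T s (τ z) = x by rwa [this]
    refine ext_inner_left ℂ fun k => ?_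
    rw [← pw_inner, hτ]
    -- integrate the derivative of `⟪p, w⟫`, where `p(t) = T (T + t)⁻¹ k → k` as `t ↓ 0`
    let p : ℝ → H := fun t => T (rs T t k)
    let p' : ℝ → H := fun t => -(T (rs T t (rs T t k)))
    have hp : IsPrim p p' := isPrim_rs_apply hT T k
    have hpw : ∀ y, pw T (1 - s) (pw T s y) = T y := fun y => by
      have := pw_add hT hs1.1 hs.1
      rw [sub_add_cancel, pw_one hT] at this
      exact (congrArg (fun A : H →L[ℂ] H => A y) this).symm
    have r1 : (fun t => t ^ s • p t) =ᵐ[haarIoi] R (pw T s k) := by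
      refine EventuallyEq.trans (Eventually.of_forall fun t => ?_) (hR (pw T s k)).symm
      change t ^ s • T (rs T t k) = t ^ (1 - (1 - s)) • pw T (1 - s) (rs T t (pw T s k))
      rw [pw_comm_rs, hpw, sub_sub_cancel, T_comm_rs hT]
    have r2 : (fun t => t ^ s • -(T (T (rs T t (rs T t k))))) =ᵐ[haarIoi] R' (pw T s k) := by
      refine EventuallyEq.trans (Eventually.of_forall fun t => ?_) (hR' (pw T s k)).symm
      change t ^ s • -(T (T (rs T t (rs T t k)))) =
        -(T (rs T t (t ^ (1 - (1 - s)) • pw T (1 - s) (rs T t (pw T s k)))))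
      rw [pw_comm_rs, hpw, sub_sub_cancel]
      simp only [T_comm_rs hT, ContinuousLinearMap.map_smul_of_tower, smul_neg]
    have mp : MemLp (fun t => t ^ s • p t) 2 haarIoi := (memLp_congr_ae r1).2 (Lp.memLp _)
    have mp' : MemLp (fun t => t ^ s • -(T (T (rs T t (rs T t k))))) 2 haarIoi :=
      (memLp_congr_ae r2).2 (Lp.memLp _)
    obtain ⟨j1, k1⟩ := integral_inner_of_memLp mp (memLp_unweight s z.snd)
    obtain ⟨j2, k2⟩ := integral_inner_of_memLp mp' (memLp_unweight s z.fst)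
    rw [toLp_eq_of_ae mp r1, toLp_unweight] at k1
    rw [toLp_eq_of_ae mp' r2, toLp_unweight] at k2
    let L : H →L[ℝ] H →L[ℝ] ℂ := (isBoundedBilinearMap_inner (𝕜 := ℂ) (E := H)).toContinuousLinearMap
    have hQ := hp.bilinear hw L
    have hD : (fun t => ⟪-(T (T (rs T t (rs T t k)))), t ^ (s - 1) • z.fst t⟫_ℂ
        + ⟪p t, t ^ (s - 1) • z.snd t⟫_ℂ) =ᵐ[volume.restrict (Ioi 0)]
        fun t => L (p' t) (w t) + L (p t) (t ^ (s - 1) • z.snd t) := by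
      filter_upwards [hwu] with t ht
      change _ = ⟪p' t, w t⟫_ℂ + ⟪p t, _⟫_ℂ
      rw [ht, ← inner_of_nonneg hT]
      simp only [p', map_neg]
    have mTv := memLp_rpow_smul_clm T (memLp_unweight s z.fst)
    have hQi : IntegrableOn (fun t => L (p t) (w t)) (Ioi 1) := by
      have h1 := (integral_inner_of_memLp mp mTv).1
      refine IntegrableOn.mono_set (h1.congr ?_) (Ioi_subset_Ioi zero_le_one)
      filter_upwards [hwu] with t ht
      rw [← ht]; rfl
    have hl : Tendsto (fun t => L (p t) (w t)) (𝓝[>] 0) (𝓝 ⟪k, x⟫_ℂ) :=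
      (tendsto_T_rs hT hinj k).inner hx
    have key := hQ.integral_Ioi ((j2.add j1).congr hD) hQi hl
    rw [← integral_congr_ae hD, integral_add j2 j1, k1, k2] at key
    rw [add_comm, key, neg_neg]
  have hmem : ∀ h, e h ∈ sobolevPairs T s ∧
      (fun t => T (pw T s (rs T t h))) =ᵐ[volume.restrict (Ioi 0)]
        fun t => T (t ^ (s - 1) • (e h).fst t) := by
    intro h
    have hprim := isPrim_rs_apply hT (T * pw T s) h
    have e1 : (fun t => (T * pw T s) (rs T t h)) =ᵐ[volume.restrict (Ioi 0)]
        fun t => T (t ^ (s - 1) • (e h).fst t) := by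
      filter_upwards [ae_haarIoi_iff.1 (hS h), ae_restrict_mem measurableSet_Ioi] with t ht ht0
      have ht0' : (0 : ℝ) < t := ht0
      rw [he1, ht]
      change T (pw T s (rs T t h)) = T (t ^ (s - 1) • t ^ (1 - s) • pw T s (rs T t h))
      rw [smul_smul, ← Real.rpow_add ht0', sub_add_sub_cancel, sub_self, Real.rpow_zero, one_smul]
    have e2 : (fun t => -((T * pw T s) (rs T t (rs T t h)))) =ᵐ[volume.restrict (Ioi 0)]
        fun t => t ^ (s - 1) • (e h).snd t := by
      filter_upwards [ae_haarIoi_iff.1 (hS' h), ae_restrict_mem measurableSet_Ioi] with t ht ht0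
      have ht0' : (0 : ℝ) < t := ht0
      rw [he2, ht]
      change -(T (pw T s (rs T t (rs T t h)))) =
        t ^ (s - 1) • -(T (rs T t (t ^ (1 - s) • pw T s (rs T t h))))
      rw [ContinuousLinearMap.map_smul_of_tower, ContinuousLinearMap.map_smul_of_tower,
        ← smul_neg, smul_smul, ← Real.rpow_add ht0', sub_add_sub_cancel, sub_self, Real.rpow_zero, one_smul, pw_comm_rs]
    exact ⟨(mem_sobolevPairs_iff hT hs).2 (hprim.hasWeakDeriv.congr e1 e2), e1⟩
  -- the trace of `T T ^ s (T + t)⁻¹ h` is `T ^ s h`, and `T ^ s` is injective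
  refine ⟨τ, e, fun h => (hmem h).1, htrace, fun h => ?_⟩
  apply pw_injective hT hinj hs
  obtain ⟨w, hw, hwu, hl⟩ := htrace (e h) (hmem h).1
  have hc : ContinuousOn (fun t => T (pw T s (rs T t h))) (Ioi 0) :=
    (isPrim_rs_apply hT (T * pw T s) h).continuousOn
  have heq : EqOn w (fun t => T (pw T s (rs T t h))) (Ioi 0) :=
    Measure.eqOn_open_of_ae_eq (hwu.trans (hmem h).2.symm) isOpen_Ioi hw.continuousOn hc
  refine tendsto_nhds_unique (hl.congr' (eventually_nhdsWithin_of_forall heq)) ?_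
  simp only [pw_comm_rs]
  exact tendsto_T_rs hT hinj (pw T s h)

end SobolevPairs

/-! ### The Lax–Milgram lemma and abstract trace problems -/

section LaxMilgram

variable {K H : Type*} [NormedAddCommGroup K] [InnerProductSpace ℂ K] [CompleteSpace K]
  [NormedAddCommGroup H] [InnerProductSpace ℂ H] [CompleteSpace H]

/-- The Lax–Milgram lemma for complex Hilbert spaces. -/
theorem exists_equiv_of_coercive (A : K →L[ℂ] K) {μ : ℝ} (hμ : 0 < μ)
    (hA : ∀ x, μ * ‖x‖ ^ 2 ≤ (⟪x, A x⟫_ℂ).re) : ∃ e : K ≃L[ℂ] K, ∀ x, e x = A x := by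
  have hb : ∀ x, μ * ‖x‖ ≤ ‖A x‖ := by
    intro x
    rcases eq_or_ne x 0 with rfl | hx
    · simp
    have h1 : (⟪x, A x⟫_ℂ).re ≤ ‖x‖ * ‖A x‖ := (re_le_norm _).trans (norm_inner_le_norm _ _)
    refine le_of_mul_le_mul_left ?_ (norm_pos_iff.2 hx)
    calc ‖x‖ * (μ * ‖x‖) = μ * ‖x‖ ^ 2 := by ring
      _ ≤ _ := (hA x).trans h1
  have hanti : AntilipschitzWith (μ⁻¹).toNNReal A := by
    refine A.antilipschitz_of_bound fun x => ?_
    rw [Real.coe_toNNReal _ (inv_pos.2 hμ).le, inv_mul_eq_div, le_div_iff₀' hμ]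
    exact hb x
  have hcl : IsClosed (A.range : Set K) := hanti.isClosed_range A.uniformContinuous
  have htop : A.range = ⊤ := by
    have := hcl.completeSpace_coe
    rw [← A.range.orthogonal_orthogonal, Submodule.eq_top_iff']
    intro v w hw
    have h0 : ⟪w, A w⟫_ℂ = 0 := (Submodule.mem_orthogonal' _ _).1 hw _ ⟨w, rfl⟩
    have h1 := hA w
    rw [h0, zero_re] at h1
    have : ‖w‖ = 0 := by
      by_contra h
      have : 0 < μ * ‖w‖ ^ 2 := by positivity
      linarith
    rw [norm_eq_zero.1 this, inner_zero_left]
  exact ⟨ContinuousLinearEquiv.ofBijective A (LinearMap.ker_eq_bot.2 hanti.injective) htop,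
    fun x => rfl⟩

/-- If `B` is coercive on `K` and the trace `τ` has a bounded right inverse, then each `h` is the
trace of a solution `z` of `⟪φ, B z⟫ = ⟪τ φ, D h⟫` for all `φ`, and `D` is an isomorphism: its
inverse `τ B⁻¹ τ†` is coercive. -/
theorem exists_equiv_trace (τ : K →L[ℂ] H) (e : H →L[ℂ] K) (hτ : ∀ h, τ (e h) = h) (B : K →L[ℂ] K)
    {μ : ℝ} (hμ : 0 < μ) (hB : ∀ x, μ * ‖x‖ ^ 2 ≤ (⟪x, B x⟫_ℂ).re) :
    ∃ D : H ≃L[ℂ] H, ∀ h, ∃ z, τ z = h ∧ ∀ φ, ⟪φ, B z⟫_ℂ = ⟪τ φ, D h⟫_ℂ := by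
  obtain ⟨b, hb⟩ := exists_equiv_of_coercive B hμ hB
  have hBb : ∀ y, B (b.symm y) = y := fun y => by rw [← hb, b.apply_symm_apply]
  let M : H →L[ℂ] H := τ ∘L b.symm.toContinuousLinearMap ∘L τ.adjoint
  have hM : ∀ q, M q = τ (b.symm (τ.adjoint q)) := fun q => rfl
  set C : ℝ := ‖e.adjoint‖ * ‖B‖ + 1 with hC
  have hC0 : 0 < C := by positivity
  have hcoer : ∀ q, μ / C ^ 2 * ‖q‖ ^ 2 ≤ (⟪q, M q⟫_ℂ).re := by
    intro q
    set z := b.symm (τ.adjoint q) with hz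
    have h1 : ⟪q, M q⟫_ℂ = ⟪B z, z⟫_ℂ := by
      rw [hM, hBb, ContinuousLinearMap.adjoint_inner_left]
    have h2 : q = e.adjoint (B z) := by
      rw [hBb]
      refine ext_inner_left ℂ fun k => ?_
      rw [ContinuousLinearMap.adjoint_inner_right, ContinuousLinearMap.adjoint_inner_right, hτ]
    have h3 : ‖q‖ ≤ C * ‖z‖ := by
      calc ‖q‖ = ‖e.adjoint (B z)‖ := by rw [← h2]
        _ ≤ ‖e.adjoint‖ * (‖B‖ * ‖z‖) := e.adjoint.le_opNorm_of_le (B.le_opNorm z)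
        _ ≤ C * ‖z‖ := by rw [hC]; nlinarith [norm_nonneg z]
    rw [h1, ← inner_conj_symm, conj_re]
    refine le_trans ?_ (hB z)
    rw [div_mul_eq_mul_div, div_le_iff₀ (by positivity)]
    calc μ * ‖q‖ ^ 2 ≤ μ * (C * ‖z‖) ^ 2 := by gcongr
      _ = _ := by ring
  obtain ⟨D, hD⟩ := exists_equiv_of_coercive M (by positivity) hcoer
  refine ⟨D.symm, fun h => ⟨b.symm (τ.adjoint (D.symm h)), ?_, fun φ => ?_⟩⟩
  · rw [← hM, ← hD, D.apply_symm_apply]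
  · rw [hBb, ContinuousLinearMap.adjoint_inner_right]

/-- The preceding lemma for the restriction of a coercive form to a closed subspace. -/
theorem exists_equiv_trace_submodule (X : Submodule ℂ K) [CompleteSpace X] (τ : K →L[ℂ] H)
    (e : H →L[ℂ] K) (he : ∀ h, e h ∈ X) (hτ : ∀ h, τ (e h) = h) (B : K →L[ℂ] K) {μ : ℝ} (hμ : 0 < μ)
    (hB : ∀ x, μ * ‖x‖ ^ 2 ≤ (⟪x, B x⟫_ℂ).re) :
    ∃ D : H ≃L[ℂ] H, ∀ h, ∃ z ∈ X, τ z = h ∧ ∀ p ∈ X, ⟪p, B z⟫_ℂ = ⟪τ p, D h⟫_ℂ := by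
  let J : X →L[ℂ] K := X.subtypeL
  let B' : X →L[ℂ] X := J.adjoint ∘L B ∘L J
  have hB' : ∀ p z : X, ⟪p, B' z⟫_ℂ = ⟪J p, B (J z)⟫_ℂ := fun p z =>
    J.adjoint_inner_right p (B (J z))
  obtain ⟨D, hD⟩ := exists_equiv_trace (τ ∘L J) (e.codRestrict X he) hτ B' hμ fun x => by
    rw [hB']; exact hB (J x)
  refine ⟨D, fun h => ?_⟩
  obtain ⟨z, hz, hz'⟩ := hD h
  exact ⟨z, z.2, hz, fun p hp => (hB' ⟨p, hp⟩ z).symm.trans (hz' ⟨p, hp⟩)⟩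

end LaxMilgram

/-! ### Weak equations with an initial condition -/

section WeakEquation

variable {E : Type*} [NormedAddCommGroup E] [NormedSpace ℂ E] [CompleteSpace E]

omit [CompleteSpace E] in
theorem integrableOn_smul_of_forall_ge {f : ℝ → E} {χ : ℝ → ℂ} (hχ : Continuous χ) {R : ℝ}
    (hR : ∀ t, R ≤ t → χ t = 0) (hf : ∀ b, IntegrableOn f (Ioc 0 b)) :
    IntegrableOn (fun t => χ t • f t) (Ioi 0) := by
  have hfI : IntegrableOn f (Icc 0 R) := (integrableOn_Icc_iff_integrableOn_Ioc (by simp)).2 (hf R)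
  refine (hfI.continuousOn_smul hχ.continuousOn isCompact_Icc).of_forall_sdiff_eq_zero
    measurableSet_Ioi fun t ht => ?_
  have ht0 : (0 : ℝ) < t := ht.1
  have : R ≤ t := by
    by_contra hlt
    exact ht.2 ⟨ht0.le, (not_le.1 hlt).le⟩
  rw [hR t this, zero_smul]

/-- The weak form of `κ' = f` on `(0, ∞)` with the initial condition `κ(0) = -q`, tested with
functions `χ` which need not vanish at `0`. -/
theorem exists_isPrim_of_forall_integral {f κ : ℝ → E} (hf : ∀ b, IntegrableOn f (Ioc 0 b))
    (hκ : LocallyIntegrableOn κ (Ioi 0)) {q : E}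
    (h : ∀ χ : ℝ → ℂ, ContDiff ℝ 1 χ → (∃ R, ∀ t, R ≤ t → χ t = 0) → HasCompactSupport (deriv χ) →
      tsupport (deriv χ) ⊆ Ioi 0 →
      (∫ t in Ioi (0 : ℝ), χ t • f t) + ∫ t in Ioi (0 : ℝ), deriv χ t • κ t = χ 0 • q) :
    ∃ P, IsPrim P f ∧ P =ᵐ[volume.restrict (Ioi 0)] κ ∧ Tendsto P (𝓝[>] 0) (𝓝 (-q)) := by
  obtain ⟨hP, hP0⟩ := isPrim_const_add_integral hf (-q)
  set P : ℝ → E := fun t => -q + ∫ τ in (0 : ℝ)..t, f τ with hPdef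
  have hPl : LocallyIntegrableOn P (Ioi 0) := hP.continuousOn.locallyIntegrableOn measurableSet_Ioi
  refine ⟨P, hP, ?_, hP0⟩
  have key : ∀ η : ℝ → ℝ, ContDiff ℝ ∞ η → HasCompactSupport η → tsupport η ⊆ Ioi 0 →
      ∫ t, η t • (P t - κ t) = 0 := by
    intro η hη hc hs
    -- the antiderivative of `η` that vanishes near infinity is an admissible test function
    obtain ⟨R, hR⟩ := exists_forall_ge_eq_zero hc
    let c : ℝ := ∫ τ in (0 : ℝ)..R, η τ
    let χ : ℝ → ℂ := fun t => ((∫ τ in (0 : ℝ)..t, η τ) - c : ℝ)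
    have hχ' : ∀ t, HasDerivAt χ (η t : ℂ) t := fun t =>
      ((hasDerivAt_integral_of_continuous hη.continuous t).sub_const c).ofReal_comp
    have hd : deriv χ = fun t => (η t : ℂ) := funext fun t => (hχ' t).deriv
    have hχ : ContDiff ℝ 1 χ := ofRealCLM.contDiff.comp
      (((contDiff_integral hη).of_le (by exact_mod_cast le_top)).sub contDiff_const)
    have hχR : ∀ t, R ≤ t → χ t = 0 := by
      intro t ht
      have : (∫ τ in (0 : ℝ)..t, η τ) - c = 0 := by
        rw [intervalIntegral.integral_interval_sub_left (hη.continuous.intervalIntegrable _ _)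
          (hη.continuous.intervalIntegrable _ _)]
        refine intervalIntegral.integral_zero_ae (Eventually.of_forall fun τ hτ => ?_)
        rw [uIoc_of_le ht] at hτ
        exact hR τ hτ.1.le
      simp only [χ, this, ofReal_zero]
    have hts : tsupport (deriv χ) ⊆ tsupport η := by
      rw [hd]
      exact closure_mono fun t ht hηt => ht (by simp [hηt])
    have hdc : HasCompactSupport (deriv χ) := by
      rw [hd]; exact hc.comp_left ofReal_zero
    have hdcont : Continuous (deriv χ) := hχ.continuous_deriv le_rfl
    have h1 := h χ hχ ⟨R, hχR⟩ hdc (hts.trans hs)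
    have i1 := (integrable_smul_of_tsupport_subset hdcont hdc (hts.trans hs) hPl)
    have i2 := (integrable_smul_of_tsupport_subset hdcont hdc (hts.trans hs) hκ)
    have i3 := integrableOn_smul_of_forall_ge hχ.continuous hχR hf
    have i4 : IntegrableOn (fun t => χ t • P t) (Ioi 1) := by
      have hPI : IntegrableOn (fun t => χ t • P t) (Icc 1 R) :=
        (hχ.continuous.continuousOn.smul
          (hP.continuousOn.mono fun t ht => zero_lt_one.trans_le ht.1)).integrableOn_compact
          isCompact_Icc
      refine hPI.of_forall_sdiff_eq_zero measurableSet_Ioi fun t ht => ?_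
      have ht1 : (1 : ℝ) < t := ht.1
      have : R ≤ t := by
        by_contra hlt
        exact ht.2 ⟨ht1.le, (not_le.1 hlt).le⟩
      rw [hχR t this, zero_smul]
    have hl : Tendsto (fun t => χ t • P t) (𝓝[>] 0) (𝓝 (χ 0 • -q)) :=
      (hχ.continuous.tendsto 0 |>.mono_left nhdsWithin_le_nhds).smul hP0
    have h2 := ((isPrim_of_contDiff hχ).bilinear hP
      (ContinuousLinearMap.lsmul ℝ ℂ : ℂ →L[ℝ] E →L[ℝ] E)).integral_Ioi
      (i1.integrableOn.add i3) i4 hl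
    simp only [ContinuousLinearMap.lsmul_apply] at h2
    rw [integral_add i1.integrableOn i3, smul_neg, neg_neg, ← h1, add_comm, add_right_inj] at h2
    rw [← setIntegral_eq_integral_of_forall_compl_eq_zero (s := Ioi 0)]
    · have : ∀ t, η t • (P t - κ t) = deriv χ t • P t - deriv χ t • κ t := fun t => by
        rw [hd, coe_smul, coe_smul, smul_sub]
      simp only [this]
      rw [integral_sub i1.integrableOn i2.integrableOn, h2, sub_self]
    · intro t ht
      rw [image_eq_zero_of_notMem_tsupport fun h => ht (hs h), zero_smul]
  have := isOpen_Ioi.ae_eq_zero_of_integral_contDiff_smul_eq_zero (hPl.sub hκ) key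
  rw [EventuallyEq, ae_restrict_iff' measurableSet_Ioi]
  filter_upwards [this] with t ht ht0
  exact sub_eq_zero.1 (ht ht0)

end WeakEquation

/-! ### Existence for the equation on the pivot space -/

section Existence

variable {H : Type*} [NormedAddCommGroup H] [InnerProductSpace ℂ H] [CompleteSpace H]
  {T : H →L[ℂ] H}

instance (T : H →L[ℂ] H) (s : ℝ) : CompleteSpace (sobolevPairs T s) :=
  Submodule.instOrthogonalCompleteSpace _

omit [CompleteSpace H] in
theorem mul_norm_sq_le_re_inner_compLpL (A : H →L[ℂ] H) {μ : ℝ}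
    (hA : ∀ x, μ * ‖x‖ ^ 2 ≤ (⟪x, A x⟫_ℂ).re) (F : Lp H 2 haarIoi) :
    μ * ‖F‖ ^ 2 ≤ (⟪F, A.compLpL 2 haarIoi F⟫_ℂ).re := by
  have e1 : ‖F‖ ^ 2 = ∫ t, ‖F t‖ ^ 2 ∂haarIoi := by
    have h : (⟪F, F⟫_ℂ).re = ∫ t, (⟪F t, F t⟫_ℂ).re ∂haarIoi := by
      rw [L2.inner_def]
      exact (reCLM.integral_comp_comm (L2.integrable_inner F F)).symm
    have h' : ∀ (E : Type _) [NormedAddCommGroup E] [InnerProductSpace ℂ E] (x : E),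
        (⟪x, x⟫_ℂ).re = ‖x‖ ^ 2 := fun E _ _ x => by
      rw [inner_self_eq_norm_sq_to_K]; norm_cast
    rw [← h' _ F, h]
    exact integral_congr_ae (Eventually.of_forall fun t => h' _ _)
  have e2 : (⟪F, A.compLpL 2 haarIoi F⟫_ℂ).re =
      ∫ t, (⟪F t, A.compLpL 2 haarIoi F t⟫_ℂ).re ∂haarIoi := by
    rw [L2.inner_def]
    exact (reCLM.integral_comp_comm (L2.integrable_inner F _)).symm
  have i1 : Integrable (fun t => ‖F t‖ ^ 2) haarIoi := (Lp.memLp F).integrable_norm_pow (by simp)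
  rw [e1, e2, ← integral_const_mul]
  refine integral_mono_ae (i1.const_mul μ) (reCLM.integrable_comp (L2.integrable_inner F _)) ?_
  filter_upwards [A.coeFn_compLpL (p := 2) (μ := haarIoi) F] with t ht
  simp only [ht]
  exact hA _

/-- The form `∫ (⟪·, A v⟫ + ⟪·, g⟫) t ^ (2 - 2 s) dt / t` on the space of pairs is coercive, so that
the abstract trace problem can be solved in `sobolevPairs T s`. -/
theorem exists_equiv_sobolevPairs (A : H →L[ℂ] H) {μ : ℝ} (hμ : 0 < μ)
    (hA : ∀ x, μ * ‖x‖ ^ 2 ≤ (⟪x, A x⟫_ℂ).re) {s : ℝ} {τ : PairSpace H →L[ℂ] H}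
    {e : H →L[ℂ] PairSpace H} (he : ∀ h, e h ∈ sobolevPairs T s) (hτ : ∀ h, τ (e h) = h) :
    ∃ D : H ≃L[ℂ] H, ∀ h, ∃ z ∈ sobolevPairs T s, τ z = h ∧ ∀ p ∈ sobolevPairs T s,
      ⟪p.fst, A.compLpL 2 haarIoi z.fst⟫_ℂ + ⟪p.snd, z.snd⟫_ℂ = ⟪τ p, D h⟫_ℂ := by
  let B : PairSpace H →L[ℂ] PairSpace H :=
    (WithLp.prodContinuousLinearEquiv 2 ℂ _ _).symm.toContinuousLinearMap ∘L
      ((A.compLpL 2 haarIoi ∘L WithLp.fstL 2 ℂ _ _).prod (WithLp.sndL 2 ℂ _ _))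
  have hB : ∀ p z, ⟪p, B z⟫_ℂ = ⟪p.fst, A.compLpL 2 haarIoi z.fst⟫_ℂ + ⟪p.snd, z.snd⟫_ℂ :=
    fun p z => WithLp.prod_inner_apply p (B z)
  have hcoer : ∀ z, min μ 1 * ‖z‖ ^ 2 ≤ (⟪z, B z⟫_ℂ).re := by
    intro z
    have h2 : ‖z.snd‖ ^ 2 = (⟪z.snd, z.snd⟫_ℂ).re := by
      rw [inner_self_eq_norm_sq_to_K]; norm_cast
    rw [hB, add_re, WithLp.prod_norm_sq_eq_of_L2, mul_add, ← h2]
    refine add_le_add (le_trans ?_ (mul_norm_sq_le_re_inner_compLpL A hA z.fst)) ?_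
    · gcongr; exact min_le_left _ _
    · exact mul_le_of_le_one_left (by positivity) (min_le_right _ _)
  obtain ⟨D, hD⟩ := exists_equiv_trace_submodule (sobolevPairs T s) τ e he hτ B
    (lt_min hμ one_pos) hcoer
  refine ⟨D, fun h => ?_⟩
  obtain ⟨z, hz, hzh, hz'⟩ := hD h
  exact ⟨z, hz, hzh, fun p hp => by rw [← hB, hz' p hp]⟩

/-- The pair `χ ⊗ ψ`, where `χ` need not vanish at `0`. -/
theorem exists_tensor_mem_sobolevPairs (hT : 0 ≤ T) (hinj : Function.Injective T) {s : ℝ}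
    (hs : s ∈ Ioo (0 : ℝ) 1) {τ : PairSpace H →L[ℂ] H}
    (hτ : ∀ z ∈ sobolevPairs T s, ∃ w, IsPrim w (fun t => t ^ (s - 1) • z.snd t) ∧
      w =ᵐ[volume.restrict (Ioi 0)] (fun t => T (t ^ (s - 1) • z.fst t)) ∧
      Tendsto w (𝓝[>] 0) (𝓝 (pw T s (τ z))))
    {χ : ℝ → ℂ} (hχ : ContDiff ℝ 1 χ) (hR : ∃ R, ∀ t, R ≤ t → χ t = 0)
    (hc : HasCompactSupport (deriv χ)) (ψ : H) :
    ∃ p ∈ sobolevPairs T s, p.fst =ᵐ[haarIoi] (fun t => t ^ (1 - s) • χ t • ψ) ∧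
      p.snd =ᵐ[haarIoi] (fun t => t ^ (1 - s) • deriv χ t • T ψ) ∧
      τ p = χ 0 • pw T (1 - s) ψ := by
  have hs1 : 0 < 1 - s := by linarith [hs.2]
  have hχc : Continuous χ := hχ.continuous
  have hχ' : Continuous (deriv χ) := hχ.continuous_deriv le_rfl
  obtain ⟨R, hR⟩ := hR
  obtain ⟨R', hR'⟩ := exists_forall_ge_eq_zero hc
  have m1 : MemLp (fun t => t ^ (1 - s) • χ t • ψ) 2 haarIoi :=
    memLp_of_continuousOn hs1 (by fun_prop) fun t ht => by rw [hR t ht, zero_smul]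
  have m2 : MemLp (fun t => t ^ (1 - s) • deriv χ t • T ψ) 2 haarIoi :=
    memLp_of_continuousOn hs1 (by fun_prop) fun t ht => by rw [hR' t ht, zero_smul]
  let p : PairSpace H := WithLp.toLp 2 (m1.toLp _, m2.toLp _)
  have h1 : p.fst =ᵐ[haarIoi] (fun t => t ^ (1 - s) • χ t • ψ) := m1.coeFn_toLp
  have h2 : p.snd =ᵐ[haarIoi] (fun t => t ^ (1 - s) • deriv χ t • T ψ) := m2.coeFn_toLp
  have hprim : IsPrim (fun t => χ t • T ψ) (fun t => deriv χ t • T ψ) :=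
    (isPrim_of_contDiff hχ).map ((ContinuousLinearMap.id ℂ ℂ).smulRight (T ψ))
  have e1 : (fun t => χ t • T ψ) =ᵐ[volume.restrict (Ioi 0)]
      fun t => T (t ^ (s - 1) • p.fst t) := by
    filter_upwards [ae_haarIoi_iff.1 h1, ae_restrict_mem measurableSet_Ioi] with t ht ht0
    have ht0' : (0 : ℝ) < t := ht0
    rw [ht, smul_smul, ← Real.rpow_add ht0', sub_add_sub_cancel, sub_self, Real.rpow_zero, one_smul,
      map_smul]
  have e2 : (fun t => deriv χ t • T ψ) =ᵐ[volume.restrict (Ioi 0)]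
      fun t => t ^ (s - 1) • p.snd t := by
    filter_upwards [ae_haarIoi_iff.1 h2, ae_restrict_mem measurableSet_Ioi] with t ht ht0
    have ht0' : (0 : ℝ) < t := ht0
    rw [ht, smul_smul, ← Real.rpow_add ht0', sub_add_sub_cancel, sub_self, Real.rpow_zero, one_smul]
  have hp : p ∈ sobolevPairs T s :=
    (mem_sobolevPairs_iff hT hs).2 (hprim.hasWeakDeriv.congr e1 e2)
  refine ⟨p, hp, h1, h2, pw_injective hT hinj hs ?_⟩
  obtain ⟨w, hw, hwu, hl⟩ := hτ p hp
  have heq : EqOn w (fun t => χ t • T ψ) (Ioi 0) :=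
    Measure.eqOn_open_of_ae_eq (hwu.trans e1.symm) isOpen_Ioi hw.continuousOn hprim.continuousOn
  refine tendsto_nhds_unique (hl.congr' (eventually_nhdsWithin_of_forall heq)) ?_
  have hpw : pw T s (pw T (1 - s) ψ) = T ψ := by
    have := pw_add hT hs.1 hs1
    rw [add_sub_cancel, pw_one hT] at this
    exact (congrArg (fun A : H →L[ℂ] H => A ψ) this).symm
  rw [map_smul, hpw]
  exact (hχc.tendsto 0 |>.mono_left nhdsWithin_le_nhds).smul_const (T ψ)

/-- Existence on the pivot space: `w = T v` has the derivative `g` and the trace `T ^ s h`, while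
`P = T (t ^ (1 - 2 s) g)` has the derivative `t ^ (1 - 2 s) A v` and the trace `-T ^ (1 - s) D h`. -/
theorem exists_dirichletToNeumann (hT : 0 ≤ T) (hinj : Function.Injective T) (A : H →L[ℂ] H)
    {μ : ℝ} (hμ : 0 < μ) (hA : ∀ x, μ * ‖x‖ ^ 2 ≤ (⟪x, A x⟫_ℂ).re) {s : ℝ}
    (hs : s ∈ Ioo (0 : ℝ) 1) :
    ∃ D : H ≃L[ℂ] H, ∀ h, ∃ v g w P : ℝ → H,
      MemLp (fun t => t ^ (1 - s) • v t) 2 haarIoi ∧ MemLp (fun t => t ^ (1 - s) • g t) 2 haarIoi ∧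
      IsPrim w g ∧ w =ᵐ[volume.restrict (Ioi 0)] (fun t => T (v t)) ∧
      Tendsto w (𝓝[>] 0) (𝓝 (pw T s h)) ∧
      IsPrim P (fun t => t ^ (1 - 2 * s) • A (v t)) ∧
      P =ᵐ[volume.restrict (Ioi 0)] (fun t => T (t ^ (1 - 2 * s) • g t)) ∧
      Tendsto P (𝓝[>] 0) (𝓝 (-pw T (1 - s) (D h))) := by
  obtain ⟨τ, e, he, hτ, hτe⟩ := exists_trace_extension hT hinj hs
  obtain ⟨D, hD⟩ := exists_equiv_sobolevPairs A hμ hA he hτe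
  refine ⟨D, fun h => ?_⟩
  obtain ⟨z, hz, hzh, hzD⟩ := hD h
  obtain ⟨w, hw, hwu, hl⟩ := hτ z hz
  set v : ℝ → H := fun t => t ^ (s - 1) • z.fst t with hv
  set g : ℝ → H := fun t => t ^ (s - 1) • z.snd t with hg
  have hs' : s + (1 - 2 * s) = 1 - s := by ring
  have mf : MemLp (fun t => t ^ s • t ^ (1 - 2 * s) • A (v t)) 2 haarIoi :=
    (memLp_congr_ae (rpow_smul_rpow_smul_ae hs' _)).2
      (memLp_rpow_smul_clm A (memLp_unweight s z.fst))
  have mk : MemLp (fun t => t ^ s • t ^ (1 - 2 * s) • g t) 2 haarIoi :=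
    (memLp_congr_ae (rpow_smul_rpow_smul_ae hs' _)).2 (memLp_unweight s z.snd)
  have ef : mf.toLp _ = A.compLpL 2 haarIoi z.fst := by
    refine toLp_eq_of_ae _ ((rpow_smul_rpow_smul_ae hs' _).trans ?_)
    filter_upwards [A.coeFn_compLpL (p := 2) (μ := haarIoi) z.fst,
      rpow_smul_rpow_smul_ae_self (by ring : 1 - s + (s - 1) = 0) z.fst] with t h1 h2
    rw [h1, ← ContinuousLinearMap.map_smul_of_tower, hv, h2]
  have ek : mk.toLp _ = z.snd :=
    toLp_eq_of_ae _ ((rpow_smul_rpow_smul_ae hs' _).trans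
      (rpow_smul_rpow_smul_ae_self (by ring : 1 - s + (s - 1) = 0) z.snd))
  have lk : LocallyIntegrableOn (fun t => T (t ^ (1 - 2 * s) • g t)) (Ioi 0) :=
    locallyIntegrableOn_clm_comp (locallyIntegrableOn_of_memLp hs.2 mk) T
  have hf := integrableOn_Ioc_of_memLp hs.2 mf
  obtain ⟨P, hP, hPk, hP0⟩ := exists_isPrim_of_forall_integral (q := pw T (1 - s) (D h)) hf lk (by
    intro χ hχ hR hc hsupp
    -- the inner product is antilinear in the test pair
    let χ' : ℝ → ℂ := fun t => star (χ t)
    have hχ' : ContDiff ℝ 1 χ' := (starL' ℝ : ℂ ≃L[ℝ] ℂ).contDiff.comp hχ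
    have hd : deriv χ' = fun t => star (deriv χ t) := funext fun t => deriv.star
    obtain ⟨R, hR⟩ := hR
    have hχR : ∀ t, R ≤ t → χ' t = 0 := fun t ht => by simp only [χ', hR t ht, star_zero]
    have hc' : HasCompactSupport (deriv χ') := by
      rw [hd]; exact hc.comp_left (star_zero ℂ)
    have i2 := (integrable_smul_of_tsupport_subset (hχ.continuous_deriv le_rfl) hc hsupp
      lk).integrableOn (s := Ioi 0)
    have i1 := integrableOn_smul_of_forall_ge hχ.continuous hR hf
    refine ext_inner_left ℂ fun ψ => ?_
    obtain ⟨p, hp, h1, h2, hτp⟩ :=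
      exists_tensor_mem_sobolevPairs hT hinj hs hτ hχ' ⟨R, hχR⟩ hc' ψ
    have m1 : MemLp (fun t => t ^ (1 - s) • χ' t • ψ) 2 haarIoi :=
      (memLp_congr_ae h1).1 (Lp.memLp p.fst)
    have m2 : MemLp (fun t => t ^ (1 - s) • deriv χ' t • T ψ) 2 haarIoi :=
      (memLp_congr_ae h2).1 (Lp.memLp p.snd)
    have mf' : MemLp (fun t => t ^ (1 - (1 - s)) • t ^ (1 - 2 * s) • A (v t)) 2 haarIoi := by
      rwa [sub_sub_cancel]
    have mk' : MemLp (fun t => t ^ (1 - (1 - s)) • t ^ (1 - 2 * s) • g t) 2 haarIoi := by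
      rwa [sub_sub_cancel]
    have k1 := (integral_inner_of_memLp m1 mf').2
    have k2 := (integral_inner_of_memLp m2 mk').2
    simp only [sub_sub_cancel] at k1 k2
    rw [toLp_eq_of_ae m1 h1.symm, ef] at k1
    rw [toLp_eq_of_ae m2 h2.symm, ek] at k2
    have key := hzD p hp
    rw [← k1, ← k2, hτp, inner_smul_left, pw_inner] at key
    rw [inner_add_right, ← integral_inner i1, ← integral_inner i2, inner_smul_right]
    refine Eq.trans (congrArg₂ (· + ·) ?_ ?_) (key.trans (congrArg (· * _) (star_star (χ 0))))
    · refine integral_congr_ae (Eventually.of_forall fun t => ?_)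
      simp only
      rw [inner_smul_left, inner_smul_right]
      exact congrArg (· * _) (star_star (χ t)).symm
    · refine integral_congr_ae (Eventually.of_forall fun t => ?_)
      simp only [hd]
      rw [inner_smul_left, inner_smul_right, inner_of_nonneg hT]
      exact congrArg (· * _) (star_star (deriv χ t)).symm)
  exact ⟨v, g, w, P, memLp_unweight s z.fst, memLp_unweight s z.snd, hw, hwu, hzh ▸ hl, hP, hPk,
    hP0⟩

end Existence

/-! ### Uniqueness for the equation on the pivot space -/

section Uniqueness

variable {H : Type*} [NormedAddCommGroup H] [InnerProductSpace ℂ H] [CompleteSpace H]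
  {T : H →L[ℂ] H}

theorem tendsto_inner_compLpL_rs (hT : 0 ≤ T) (hinj : Function.Injective T)
    (F F' : Lp H 2 (haarIoi)) :
    Tendsto (fun ε => ⟪(T * rs T ε).compLpL 2 haarIoi F, F'⟫_ℂ) (𝓝[>] 0) (𝓝 ⟪F, F'⟫_ℂ) := by
  have h1 : ∀ ε, ⟪(T * rs T ε).compLpL 2 haarIoi F, F'⟫_ℂ =
      ∫ t, ⟪(T * rs T ε) (F t), F' t⟫_ℂ ∂haarIoi := fun ε => by
    rw [L2.inner_def]
    refine integral_congr_ae ?_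
    filter_upwards [(T * rs T ε).coeFn_compLpL (p := 2) (μ := haarIoi) F] with t ht
    rw [ht]
  simp only [h1]
  rw [L2.inner_def]
  refine tendsto_integral_filter_of_dominated_convergence (fun t => ‖F t‖ * ‖F' t‖)
    (Eventually.of_forall fun ε => ?_) ?_ ((Lp.memLp F).norm.integrable_mul (Lp.memLp F').norm) ?_
  · exact (((T * rs T ε).continuous.comp_aestronglyMeasurable
      (Lp.aestronglyMeasurable F)).inner (Lp.aestronglyMeasurable F'))
  · filter_upwards [self_mem_nhdsWithin] with ε hε
    refine Eventually.of_forall fun t => (norm_inner_le_norm _ _).trans ?_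
    gcongr
    exact ((T * rs T ε).le_of_opNorm_le (norm_T_rs_le hT hε) _).trans (one_mul _).le
  · exact Eventually.of_forall fun t => (tendsto_T_rs hT hinj (F t)).inner tendsto_const_nhds

/-- Uniqueness for the equation solved in `exists_dirichletToNeumann`: a solution `v` with vanishing
trace is zero. The equation is tested with `v` itself, smoothed by `T (T + ε)⁻¹`. -/
theorem ae_eq_zero_of_tendsto_zero (hT : 0 ≤ T) (hinj : Function.Injective T) (A : H →L[ℂ] H)
    {μ : ℝ} (hμ : 0 < μ) (hA : ∀ x, μ * ‖x‖ ^ 2 ≤ (⟪x, A x⟫_ℂ).re) {s : ℝ}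
    (hs : s ∈ Ioo (0 : ℝ) 1) {v g w P : ℝ → H}
    (mv : MemLp (fun t => t ^ (1 - s) • v t) 2 haarIoi)
    (mg : MemLp (fun t => t ^ (1 - s) • g t) 2 haarIoi)
    (hw : IsPrim w g) (hwv : w =ᵐ[volume.restrict (Ioi 0)] fun t => T (v t))
    (hw0 : Tendsto w (𝓝[>] 0) (𝓝 0)) (hP : IsPrim P (fun t => t ^ (1 - 2 * s) • A (v t)))
    (hPg : P =ᵐ[volume.restrict (Ioi 0)] fun t => T (t ^ (1 - 2 * s) • g t)) :
    v =ᵐ[volume.restrict (Ioi 0)] 0 := by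
  have hs' : 1 - (1 - s) + (1 - 2 * s) = 1 - s := by ring
  have eA : ∀ (B : H →L[ℂ] H) (u : ℝ → H) (hu : MemLp (fun t => t ^ (1 - s) • u t) 2 haarIoi),
      (memLp_rpow_smul_clm B hu).toLp _ = B.compLpL 2 haarIoi (hu.toLp _) := fun B u hu => by
    refine toLp_eq_of_ae _ ?_
    filter_upwards [B.coeFn_compLpL (p := 2) (μ := haarIoi) (hu.toLp _), hu.coeFn_toLp] with t h1 h2
    rw [h1, h2, ContinuousLinearMap.map_smul_of_tower]
  set f : ℝ → H := fun t => t ^ (1 - 2 * s) • A (v t)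
  set k : ℝ → H := fun t => t ^ (1 - 2 * s) • g t
  have mf : MemLp (fun t => t ^ (1 - (1 - s)) • f t) 2 haarIoi :=
    (memLp_congr_ae (rpow_smul_rpow_smul_ae hs' _)).2 (memLp_rpow_smul_clm A mv)
  have mk : MemLp (fun t => t ^ (1 - (1 - s)) • k t) 2 haarIoi :=
    (memLp_congr_ae (rpow_smul_rpow_smul_ae hs' _)).2 mg
  set V := mv.toLp _
  set G := mg.toLp _
  have ef : mf.toLp _ = A.compLpL 2 haarIoi V :=
    (MemLp.toLp_eq_toLp_iff mf (memLp_rpow_smul_clm A mv)).2 (rpow_smul_rpow_smul_ae hs' _)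
      |>.trans (eA A v mv)
  have ek : mk.toLp _ = G :=
    (MemLp.toLp_eq_toLp_iff mk mg).2 (rpow_smul_rpow_smul_ae hs' _)
  obtain ⟨x, hx⟩ := hP.exists_tendsto (integrableOn_Ioc_of_memLp (by linarith [hs.2]) mf)
  have key : ∀ ε > 0, ⟪(T * rs T ε).compLpL 2 haarIoi G, G⟫_ℂ +
      ⟪(T * rs T ε).compLpL 2 haarIoi V, A.compLpL 2 haarIoi V⟫_ℂ = 0 := by
    intro ε hε
    obtain ⟨i1, k1⟩ := integral_inner_of_memLp (memLp_rpow_smul_clm (T * rs T ε) mg) mk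
    obtain ⟨i2, k2⟩ := integral_inner_of_memLp (memLp_rpow_smul_clm (T * rs T ε) mv) mf
    have i3 := (integral_inner_of_memLp
      (memLp_rpow_smul_clm T (memLp_rpow_smul_clm (T * rs T ε) mv)) mk).1
    rw [eA, ek] at k1
    rw [eA, ef] at k2
    let L : H →L[ℝ] H →L[ℝ] ℂ := (isBoundedBilinearMap_inner (𝕜 := ℂ) (E := H)).toContinuousLinearMap
    -- integrate the derivative of `⟪(T + ε)⁻¹ w, P⟫`, which vanishes at `0` and is integrable
    have hQ := (hw.map (rs T ε)).bilinear hP L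
    have hD : (fun t => ⟪(T * rs T ε) (g t), k t⟫_ℂ + ⟪(T * rs T ε) (v t), f t⟫_ℂ)
        =ᵐ[volume.restrict (Ioi 0)] fun t => L (rs T ε (g t)) (P t) + L (rs T ε (w t)) (f t) := by
      filter_upwards [hwv, hPg] with t h1 h2
      change ⟪T (rs T ε (g t)), k t⟫_ℂ + ⟪T (rs T ε (v t)), f t⟫_ℂ =
        ⟪rs T ε (g t), P t⟫_ℂ + ⟪rs T ε (w t), f t⟫_ℂ
      rw [h1, h2, ← T_comm_rs hT, inner_of_nonneg hT]
    have hQi : IntegrableOn (fun t => L (rs T ε (w t)) (P t)) (Ioi 1) := by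
      refine IntegrableOn.mono_set (i3.congr ?_) (Ioi_subset_Ioi zero_le_one)
      filter_upwards [hwv, hPg] with t h1 h2
      change ⟪T (T (rs T ε (v t))), k t⟫_ℂ = ⟪rs T ε (w t), P t⟫_ℂ
      rw [h1, h2, ← T_comm_rs hT, inner_of_nonneg hT]
    have hl : Tendsto (fun t => L (rs T ε (w t)) (P t)) (𝓝[>] 0) (𝓝 ⟪rs T ε 0, x⟫_ℂ) :=
      (((rs T ε).continuous.tendsto 0).comp hw0).inner hx
    have key := hQ.integral_Ioi ((i1.add i2).congr hD) hQi hl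
    rwa [← integral_congr_ae hD, integral_add i1 i2, k1, k2, map_zero, inner_zero_left,
      neg_zero] at key
  have hlim : ⟪G, G⟫_ℂ + ⟪V, A.compLpL 2 haarIoi V⟫_ℂ = 0 := by
    refine tendsto_nhds_unique ((tendsto_inner_compLpL_rs hT hinj G G).add
      (tendsto_inner_compLpL_rs hT hinj V (A.compLpL 2 haarIoi V))) ?_
    refine tendsto_const_nhds.congr' ?_
    filter_upwards [self_mem_nhdsWithin] with ε hε using (key ε hε).symm
  have hV : V = 0 := by
    have h1 := mul_norm_sq_le_re_inner_compLpL A hA V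
    have h2 := congrArg re hlim
    have h3 : (⟪G, G⟫_ℂ).re = ‖G‖ ^ 2 := by
      rw [inner_self_eq_norm_sq_to_K]; norm_cast
    rw [add_re, zero_re, h3] at h2
    by_contra hV
    have := norm_pos_iff.2 hV
    have : 0 < μ * ‖V‖ ^ 2 := by positivity
    nlinarith [sq_nonneg ‖G‖]
  have h0 : (fun t => t ^ (1 - s) • v t) =ᵐ[haarIoi] 0 := (MemLp.toLp_eq_toLp_iff mv MemLp.zero).1
    (hV.trans (MemLp.toLp_zero _).symm)
  filter_upwards [ae_haarIoi_iff.1 h0, ae_restrict_mem measurableSet_Ioi] with t ht ht0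
  exact (smul_eq_zero.1 ht).resolve_left (Real.rpow_pos_of_pos ht0 _).ne'

end Uniqueness

/-! ### Polar decomposition of the Gelfand triple -/

section GelfandTriple

variable {V H : Type*} [NormedAddCommGroup V] [InnerProductSpace ℂ V] [CompleteSpace V]
  [NormedAddCommGroup H] [InnerProductSpace ℂ H] [CompleteSpace H]

/-- The Riesz isomorphism of a complex Hilbert space with its antidual is linear. -/
theorem exists_riesz_antidual (V : Type*) [NormedAddCommGroup V] [InnerProductSpace ℂ V]
    [CompleteSpace V] : ∃ R : V ≃ₗᵢ[ℂ] Antidual V, ∀ x v, R x v = ⟪v, x⟫_ℂ := by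
  let R : V →ₗᵢ[ℂ] Antidual V :=
    { toLinearMap := (innerSL ℂ : V →L⋆[ℂ] V →L[ℂ] ℂ).flip
      norm_map' := fun x => by
        refine le_antisymm (ContinuousLinearMap.opNorm_le_bound _ (norm_nonneg x) fun v => ?_) ?_
        · exact (norm_inner_le_norm v x).trans (mul_comm _ _).le
        · rcases eq_or_ne x 0 with rfl | hx
          · rw [norm_zero]; exact norm_nonneg _
          refine le_of_mul_le_mul_right ?_ (norm_pos_iff.2 hx)
          refine le_trans (le_of_eq ?_)
            (((innerSL ℂ : V →L⋆[ℂ] V →L[ℂ] ℂ).flip x).le_opNorm x)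
          change _ = ‖⟪x, x⟫_ℂ‖
          rw [inner_self_eq_norm_sq_to_K, norm_pow, RCLike.norm_ofReal, abs_norm, pow_two] }
  have hR : ∀ x v, R x v = ⟪v, x⟫_ℂ := fun x v => rfl
  refine ⟨LinearIsometryEquiv.ofSurjective R fun y => ?_, hR⟩
  let y' : StrongDual ℂ V := (starL ℂ : ℂ ≃L⋆[ℂ] ℂ).toContinuousLinearMap.comp y
  refine ⟨(InnerProductSpace.toDual ℂ V).symm y', ?_⟩
  ext v
  rw [hR, ← inner_conj_symm, InnerProductSpace.toDual_symm_apply]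
  exact star_star (y v)

/-- The polar decomposition `ι = T U⁻¹` of the embedding, where `T = (ι ι†) ^ (1 / 2)`. It
identifies the Gelfand triple `V ⊆ H ⊆ V'` with the triple `H → H → H` given by `T` twice. -/
theorem exists_polar (ι : V →L[ℂ] H) (hι : Function.Injective ι) (hι' : DenseRange ι) :
    ∃ (T : H →L[ℂ] H) (U : H ≃ₗᵢ[ℂ] V) (Λ : H ≃ₗᵢ[ℂ] Antidual V), 0 ≤ T ∧ Function.Injective T ∧
      (∀ h, ι (U h) = T h) ∧ (∀ h, pivot ι h = Λ (T h)) ∧ ∀ h b, Λ h (U b) = ⟪b, h⟫_ℂ := by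
  let K : H →L[ℂ] H := ι ∘L ι.adjoint
  have hK : 0 ≤ K :=
    (ContinuousLinearMap.nonneg_iff_isPositive K).2 (ContinuousLinearMap.isPositive_self_comp_adjoint ι)
  set T : H →L[ℂ] H := CFC.sqrt K
  have hT : 0 ≤ T := CFC.sqrt_nonneg K
  have hTT : T * T = K := CFC.sqrt_mul_sqrt_self K hK
  have hnorm : ∀ h, ‖ι.adjoint h‖ = ‖T h‖ := by
    intro h
    have h1 : ⟪ι.adjoint h, ι.adjoint h⟫_ℂ = ⟪T h, T h⟫_ℂ := by
      rw [ContinuousLinearMap.adjoint_inner_left, inner_of_nonneg hT]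
      exact congrArg (fun A : H →L[ℂ] H => ⟪h, A h⟫_ℂ) hTT.symm
    rw [inner_self_eq_norm_sq_to_K, inner_self_eq_norm_sq_to_K] at h1
    have h2 : ‖ι.adjoint h‖ ^ 2 = ‖T h‖ ^ 2 := by exact_mod_cast h1
    exact (sq_eq_sq₀ (norm_nonneg _) (norm_nonneg _)).1 h2
  have hinj' : ∀ h, ι.adjoint h = 0 → h = 0 := by
    intro h hh
    refine hι'.eq_zero_of_inner_left ℂ fun v => ?_
    rw [← ContinuousLinearMap.adjoint_inner_left, hh, inner_zero_left]
  have hinj : Function.Injective T := (injective_iff_map_eq_zero T).2 fun h hh => by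
    refine hinj' h (norm_eq_zero.1 ?_)
    rw [hnorm, hh, norm_zero]
  have hdense : DenseRange T := denseRange_of_symmetric (inner_of_nonneg hT) hinj
  have hdense' : DenseRange ι.adjoint := by
    have h : ι.adjoint.range.topologicalClosure = ⊤ := by
      rw [Submodule.topologicalClosure_eq_top_iff, ContinuousLinearMap.orthogonal_range,
        ContinuousLinearMap.adjoint_adjoint]
      exact LinearMap.ker_eq_bot.2 hι
    exact (Submodule.dense_iff_topologicalClosure_eq_top).2 h
  let U : H ≃ₗᵢ[ℂ] V := (LinearEquiv.refl ℂ H).extendOfIsometry (T : H →ₗ[ℂ] H)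
    (ι.adjoint : H →ₗ[ℂ] V) hdense hdense' hnorm
  have hU : ∀ h, U (T h) = ι.adjoint h := fun h =>
    (LinearEquiv.refl ℂ H).extendOfIsometry_eq (T : H →ₗ[ℂ] H) (ι.adjoint : H →ₗ[ℂ] V) hdense
      hdense' hnorm h
  have hιU : ∀ h, ι (U h) = T h := by
    refine fun h => congrFun (hdense.equalizer (g := fun h => ι (U h)) (h := T)
      (ι.continuous.comp U.continuous) T.continuous (funext fun h => ?_)) h
    change ι (U (T h)) = T (T h)
    rw [hU]
    exact congrArg (fun A : H →L[ℂ] H => A h) hTT.symm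
  obtain ⟨R, hR⟩ := exists_riesz_antidual V
  refine ⟨T, U, U.trans R, hT, hinj, hιU, fun h => ?_, fun h b => ?_⟩
  · ext v
    rw [pivot_apply, LinearIsometryEquiv.trans_apply, hR, hU, ContinuousLinearMap.adjoint_inner_right]
  · rw [LinearIsometryEquiv.trans_apply, hR, U.inner_map_map]

end GelfandTriple

/-! ### Isomorphisms of interpolation spaces -/

section Interpolation

variable {H X₀ X₁ Z : Type*} [NormedAddCommGroup H] [NormedSpace ℂ H]
  [NormedAddCommGroup X₀] [NormedSpace ℂ X₀]
  [NormedAddCommGroup X₁] [NormedSpace ℂ X₁] [NormedAddCommGroup Z] [NormedSpace ℂ Z]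
  {j₀ : X₀ →L[ℂ] Z} {j₁ : X₁ →L[ℂ] Z} {θ : Ioo (0 : ℝ) 1}

/-- If `S` maps `H` injectively onto the interpolation space, with bounds on the norms in both
directions, then it is a topological isomorphism. -/
theorem exists_equiv_complexInterp (S : H →L[ℂ] Z) (hS : Function.Injective S) {C : ℝ}
    (h₁ : ∀ M f, IsCalderon j₀ j₁ M f → ∃ h, ‖h‖ ≤ C * M ∧ S h = f (θ : ℝ))
    (h₂ : ∀ h, ∃ f, IsCalderon j₀ j₁ ‖h‖ f ∧ f (θ : ℝ) = S h) :
    ∃ e : ComplexInterp j₀ j₁ θ ≃L[ℂ] H, ∀ x, S (e x) = ComplexInterp.incl j₀ j₁ θ x := by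
  let E : H →ₗ[ℂ] ComplexInterp j₀ j₁ θ := LinearMap.codRestrict (interpSubmodule j₀ j₁ θ)
    (S : H →ₗ[ℂ] Z) fun h => ⟨‖h‖, h₂ h⟩
  have hE : ∀ h, ComplexInterp.incl j₀ j₁ θ (E h) = S h := fun h => rfl
  have hbij : Function.Bijective E := by
    refine ⟨fun a b hab => hS ?_, fun x => ?_⟩
    · rw [← hE, ← hE, hab]
    · obtain ⟨M, f, hf, hfx⟩ := x.2
      obtain ⟨h, -, hh⟩ := h₁ M f hf
      exact ⟨h, ComplexInterp.incl_injective (by rw [hE, hh, hfx]; rfl)⟩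
  have b₁ : ∀ h, ‖E h‖ ≤ 1 * ‖h‖ := fun h => by
    rw [one_mul]
    obtain ⟨f, hf, hfh⟩ := h₂ h
    exact csInf_le (ComplexInterp.normSet_bddBelow _) ⟨f, hf, hfh⟩
  let e := LinearEquiv.ofBijective E hbij
  have he : ∀ x, S (e.symm x) = ComplexInterp.incl j₀ j₁ θ x := fun x => by
    rw [← hE]; exact congrArg _ (e.apply_symm_apply x)
  have b₂ : ∀ x, ‖e.symm x‖ ≤ max C 0 * ‖x‖ := fun x => by
    refine le_of_forall_pos_le_add fun ε hε => ?_
    obtain ⟨M, ⟨f, hf, hfx⟩, hM⟩ := exists_lt_of_csInf_lt (ComplexInterp.normSet_nonempty x)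
      (show sInf (ComplexInterp.normSet x) < ‖x‖ + ε / (max C 0 + 1) by
        have : 0 < ε / (max C 0 + 1) := by positivity
        rw [← ComplexInterp.norm_def]; linarith)
    obtain ⟨h, hh, hSh⟩ := h₁ M f hf
    have : e.symm x = h := hS (by rw [he, hSh, hfx])
    rw [this]
    calc ‖h‖ ≤ C * M := hh
      _ ≤ max C 0 * M := by gcongr; exacts [hf.nonneg, le_max_left _ _]
      _ ≤ max C 0 * (‖x‖ + ε / (max C 0 + 1)) := by gcongr
      _ = max C 0 * ‖x‖ + max C 0 / (max C 0 + 1) * ε := by ring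
      _ ≤ max C 0 * ‖x‖ + 1 * ε := by
        gcongr
        rw [div_le_one (by positivity)]
        linarith
      _ = _ := by rw [one_mul]
  exact ⟨e.symm.toContinuousLinearEquivOfBounds _ _ b₂ b₁, he⟩

end Interpolation

/-! ### The interpolation spaces of the Gelfand triple -/

section InterpolationSpaces

variable {V H : Type*} [NormedAddCommGroup V] [InnerProductSpace ℂ V] [CompleteSpace V]
  [NormedAddCommGroup H] [InnerProductSpace ℂ H] [CompleteSpace H] {ι : V →L[ℂ] H} {T : H →L[ℂ] H}

omit [CompleteSpace V] in
/-- `[H, V]_s` is the range of `T ^ s`. -/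
theorem exists_equiv_interpHV (hT : 0 ≤ T) (hinj : Function.Injective T) (U : H ≃ₗᵢ[ℂ] V)
    (hU : ∀ h, ι (U h) = T h) (s : Ioo (0 : ℝ) 1) :
    ∃ e : InterpHV ι s ≃L[ℂ] H, ∀ x, pw T s (e x) = x.toH := by
  refine exists_equiv_complexInterp (pw T s) (pw_injective hT hinj s.2) (C := 2)
    (fun M f hf => ?_) fun h => ?_
  · exact (hf.map (k₀ := ContinuousLinearMap.id ℂ H) (k₁ := T) (ContinuousLinearMap.id ℂ H)
      U.symm.toContinuousLinearEquiv.toContinuousLinearMap (ContinuousLinearMap.id ℂ H)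
      (fun x => rfl) (fun v => ((congrArg ι (U.apply_symm_apply v)).symm.trans (hU _)))
      ContinuousLinearMap.norm_id_le U.symm.toLinearIsometry.norm_toContinuousLinearMap_le).exists_pw
      hT hinj s.2
  · obtain ⟨f, hf, hfs⟩ := exists_isCalderon_pw hT hinj h s.2
    exact ⟨f, hf.map (ContinuousLinearMap.id ℂ H) U.toContinuousLinearEquiv.toContinuousLinearMap
      (ContinuousLinearMap.id ℂ H) (fun x => rfl) (fun x => (hU x).symm)
      ContinuousLinearMap.norm_id_le U.toLinearIsometry.norm_toContinuousLinearMap_le, hfs⟩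

omit [CompleteSpace V] in
/-- `[H, V']_s` is the image of the range of `T ^ (1 - s)` in `V'`. -/
theorem exists_equiv_interpHV' (hT : 0 ≤ T) (hinj : Function.Injective T) (Λ : H ≃ₗᵢ[ℂ] Antidual V)
    (hΛ : ∀ h, pivot ι h = Λ (T h)) (s : Ioo (0 : ℝ) 1) :
    ∃ e : InterpHV' ι s ≃L[ℂ] H, ∀ y, Λ (pw T (1 - s) (e y)) = y.toAntidual := by
  have hs : (1 - s : ℝ) ∈ Ioo (0 : ℝ) 1 := ⟨by linarith [s.2.2], by linarith [s.2.1]⟩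
  refine exists_equiv_complexInterp (Λ.toContinuousLinearEquiv.toContinuousLinearMap ∘L
    pw T (1 - s)) (Λ.injective.comp (pw_injective hT hinj hs)) (C := 2) (fun M f hf => ?_) fun h => ?_
  · obtain ⟨h, hh, hhf⟩ := (hf.swap.map (k₀ := ContinuousLinearMap.id ℂ H) (k₁ := T)
      Λ.symm.toContinuousLinearEquiv.toContinuousLinearMap (ContinuousLinearMap.id ℂ H)
      Λ.symm.toContinuousLinearEquiv.toContinuousLinearMap (fun x => rfl)
      (fun x => Λ.symm_apply_eq.2 (hΛ x)) Λ.symm.toLinearIsometry.norm_toContinuousLinearMap_le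
      ContinuousLinearMap.norm_id_le).exists_pw hT hinj hs
    refine ⟨h, hh, ?_⟩
    change Λ (pw T (1 - s) h) = _
    rw [hhf]
    refine (Λ.apply_symm_apply _).trans ?_
    rw [ofReal_sub, ofReal_one, sub_sub_cancel]
  · obtain ⟨f, hf, hfs⟩ := exists_isCalderon_pw hT hinj h hs
    refine ⟨_, (hf.map (k₀ := ContinuousLinearMap.id ℂ (Antidual V)) (k₁ := pivot ι)
      Λ.toContinuousLinearEquiv.toContinuousLinearMap (ContinuousLinearMap.id ℂ H)
      Λ.toContinuousLinearEquiv.toContinuousLinearMap (fun x => rfl) (fun x => (hΛ x).symm)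
      Λ.toLinearIsometry.norm_toContinuousLinearMap_le ContinuousLinearMap.norm_id_le).swap, ?_⟩
    rw [← ofReal_one, ← ofReal_sub, hfs]
    rfl

end InterpolationSpaces

/-! ### Harmonic functions and the Dirichlet-to-Neumann operator -/

section Harmonic

variable {X Y : Type*} [NormedAddCommGroup X] [NormedSpace ℂ X] [CompleteSpace X]
  [NormedAddCommGroup Y] [NormedSpace ℂ Y]

theorem MemSobolev.sub {s : ℝ} {j : Y →L[ℂ] X} {u u₂ : ℝ → Y} {u' u₂' : ℝ → X}
    (h : MemSobolev s j u u') (h₂ : MemSobolev s j u₂ u₂') :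
    MemSobolev s j (fun t => u t - u₂ t) (fun t => u' t - u₂' t) where
  locallyIntegrableOn := h.locallyIntegrableOn.sub h₂.locallyIntegrableOn
  hasWeakDeriv := by simpa only [map_sub] using h.hasWeakDeriv.sub h₂.hasWeakDeriv
  memLp := by simpa only [smul_sub] using! h.memLp.sub h₂.memLp
  memLp_deriv := by simpa only [smul_sub] using! h.memLp_deriv.sub h₂.memLp_deriv

omit [NormedSpace ℂ X] in
omit [CompleteSpace X] in
theorem HasTrace.sub {u u₂ : ℝ → X} {x x₂ : X} (h : HasTrace u x) (h₂ : HasTrace u₂ x₂) :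
    HasTrace (fun t => u t - u₂ t) (x - x₂) := by
  obtain ⟨c, hc, hcu, hcl⟩ := h
  obtain ⟨c₂, hc₂, hcu₂, hcl₂⟩ := h₂
  exact ⟨fun t => c t - c₂ t, hc.sub hc₂, hcu.sub hcu₂, hcl.sub hcl₂⟩

variable {V H : Type*} [NormedAddCommGroup V] [InnerProductSpace ℂ V]
  [NormedAddCommGroup H] [InnerProductSpace ℂ H] [CompleteSpace H]
  {ι : V →L[ℂ] H} {ℰ : V →L[ℂ] V →L⋆[ℂ] ℂ}

theorem IsHarmonic.sub {s : ℝ} {u u₂ : ℝ → V} (h : IsHarmonic ι ℰ s u) (h₂ : IsHarmonic ι ℰ s u₂) :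
    IsHarmonic ι ℰ s (fun t => u t - u₂ t) := by
  obtain ⟨u', w', h1, h2, h3⟩ := h
  obtain ⟨u₂', w₂', k1, k2, k3⟩ := h₂
  refine ⟨_, _, h1.sub k1, by simpa only [smul_sub] using h2.sub k2, ?_⟩
  filter_upwards [h3, k3] with t h k
  have := congrArg₂ (· - ·) h k
  simp only [sub_zero] at this
  rw [← this, map_sub, smul_sub]
  abel

variable {T : H →L[ℂ] H}

/-- A harmonic function with vanishing trace is zero. -/
theorem IsHarmonic.ae_eq_zero (hT : 0 ≤ T) (hinj : Function.Injective T) (U : H ≃ₗᵢ[ℂ] V)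
    (Λ : H ≃ₗᵢ[ℂ] Antidual V) (hU : ∀ h, ι (U h) = T h) (hΛ : ∀ h, pivot ι h = Λ (T h))
    {A : H →L[ℂ] H} (hΛA : ∀ h, Λ (A h) = ℰ (U h)) {μ : ℝ} (hμ : 0 < μ)
    (hA : ∀ x, μ * ‖x‖ ^ 2 ≤ (⟪x, A x⟫_ℂ).re) {s : ℝ} (hs : s ∈ Ioo (0 : ℝ) 1) {u : ℝ → V}
    (hu : IsHarmonic ι ℰ s u) (hu0 : HasTrace (fun t => ι (u t)) 0) :
    u =ᵐ[volume.restrict (Ioi 0)] 0 := by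
  obtain ⟨u', w', h1, h2, h3⟩ := hu
  obtain ⟨w, hwu, hw⟩ := h1.hasWeakDeriv.exists_isPrim
  obtain ⟨c, hc, hcu, hc0⟩ := hu0
  have hw0 : Tendsto w (𝓝[>] 0) (𝓝 0) := by
    refine hc0.congr' (eventually_nhdsWithin_of_forall ?_)
    exact Measure.eqOn_open_of_ae_eq (hcu.trans hwu.symm) isOpen_Ioi hc hw.continuousOn
  have hw' : w' =ᵐ[volume.restrict (Ioi 0)] fun t => ((t ^ (1 - 2 * s) : ℝ) : ℂ) • ℰ (u t) := by
    filter_upwards [h3] with t ht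
    exact neg_add_eq_zero.1 ht
  obtain ⟨p, hpu, hp⟩ := (h2.hasWeakDeriv.congr EventuallyEq.rfl hw').exists_isPrim
  let Λi : Antidual V →L[ℂ] H := Λ.symm.toContinuousLinearEquiv.toContinuousLinearMap
  have hΛi : ∀ h, Λi (Λ h) = h := Λ.symm_apply_apply
  have hA' : ∀ t, Λi (((t ^ (1 - 2 * s) : ℝ) : ℂ) • ℰ (u t)) =
      t ^ (1 - 2 * s) • A (U.symm (u t)) := fun t => by
    rw [map_smul, coe_smul, ← hΛi (A _), hΛA, U.apply_symm_apply]
  have hP := hp.map Λi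
  simp only [hA'] at hP
  have mv : MemLp (fun t => t ^ (1 - s) • U.symm (u t)) 2 haarIoi :=
    memLp_rpow_smul_clm U.symm.toContinuousLinearEquiv.toContinuousLinearMap h1.memLp
  have key := ae_eq_zero_of_tendsto_zero hT hinj A hμ hA hs mv h1.memLp_deriv hw
    (hwu.mono fun t ht => by simp only [ht, ← hU, U.apply_symm_apply]) hw0 hP
    (hpu.mono fun t ht => by simp only [ht, hΛ, hΛi])
  filter_upwards [key] with t ht
  exact (map_eq_zero_iff U.symm U.symm.injective).1 ht

/-- A solution of the equation on `H` gives a harmonic function, together with its trace and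
its normal derivative. -/
theorem exists_isHarmonic (U : H ≃ₗᵢ[ℂ] V) (Λ : H ≃ₗᵢ[ℂ] Antidual V) (hU : ∀ h, ι (U h) = T h)
    (hΛ : ∀ h, pivot ι h = Λ (T h)) {A : H →L[ℂ] H} (hΛA : ∀ h, Λ (A h) = ℰ (U h)) {s : ℝ}
    (hs : s ∈ Ioo (0 : ℝ) 1) {v g w P : ℝ → H} {x y : H}
    (mv : MemLp (fun t => t ^ (1 - s) • v t) 2 haarIoi)
    (mg : MemLp (fun t => t ^ (1 - s) • g t) 2 haarIoi)
    (hw : IsPrim w g) (hwv : w =ᵐ[volume.restrict (Ioi 0)] fun t => T (v t))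
    (hw0 : Tendsto w (𝓝[>] 0) (𝓝 x)) (hP : IsPrim P (fun t => t ^ (1 - 2 * s) • A (v t)))
    (hPg : P =ᵐ[volume.restrict (Ioi 0)] fun t => T (t ^ (1 - 2 * s) • g t))
    (hP0 : Tendsto P (𝓝[>] 0) (𝓝 (-y))) :
    IsHarmonic ι ℰ s (fun t => U (v t)) ∧ HasTrace (fun t => ι (U (v t))) x ∧
      HasNormalDeriv ι s (fun t => U (v t)) (Λ y) := by
  let U' : H →L[ℂ] V := U.toContinuousLinearEquiv.toContinuousLinearMap
  let Λ' : H →L[ℂ] Antidual V := Λ.toContinuousLinearEquiv.toContinuousLinearMap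
  have hs1 : 1 - s < 1 := by linarith [hs.1]
  have hs' : s + (1 - 2 * s) = 1 - s := by ring
  have hwu : w =ᵐ[volume.restrict (Ioi 0)] fun t => ι (U (v t)) := by simpa only [hU] using hwv
  have hd : HasWeakDeriv (fun t => ι (U (v t))) g := hw.hasWeakDeriv.congr hwu EventuallyEq.rfl
  have hPu : (fun t => Λ' (P t)) =ᵐ[volume.restrict (Ioi 0)]
      fun t => pivot ι (t ^ (1 - 2 * s) • g t) := hPg.mono fun t ht => by
    simp only [hΛ, ht]; rfl
  have hP' := hP.map Λ'
  have mk : MemLp (fun t => t ^ s • t ^ (1 - 2 * s) • g t) 2 haarIoi :=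
    (memLp_congr_ae (rpow_smul_rpow_smul_ae hs' _)).2 mg
  have mf : MemLp (fun t => t ^ s • t ^ (1 - 2 * s) • A (v t)) 2 haarIoi :=
    (memLp_congr_ae (rpow_smul_rpow_smul_ae hs' _)).2 (memLp_rpow_smul_clm A mv)
  have mu : MemLp (fun t => t ^ (1 - s) • U (v t)) 2 haarIoi := memLp_rpow_smul_clm U' mv
  refine ⟨⟨g, fun t => Λ' (t ^ (1 - 2 * s) • A (v t)),
    ⟨locallyIntegrableOn_of_memLp hs1 mu, hd, mu, mg⟩,
    ⟨locallyIntegrableOn_of_memLp hs.2 mk, hP'.hasWeakDeriv.congr hPu EventuallyEq.rfl, mk,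
      memLp_rpow_smul_clm Λ' mf⟩, Eventually.of_forall fun t => ?_⟩,
    ⟨w, hw.continuousOn, hwu, hw0⟩, g, hd, fun t => -Λ' (P t), hP'.continuousOn.neg, hPu.neg, ?_⟩
  · have h : Λ' (t ^ (1 - 2 * s) • A (v t)) = ((t ^ (1 - 2 * s) : ℝ) : ℂ) • Λ' (A (v t)) := by
      rw [← coe_smul, map_smul]
    exact neg_add_eq_zero.2 (h.trans (congrArg _ (hΛA _)))
  · have := ((Λ'.continuous.tendsto (-y)).comp hP0).neg
    rw [map_neg, neg_neg] at this
    exact this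

end Harmonic

end DtN

theorem mainTheorem3 {V H : Type*}
    [NormedAddCommGroup V] [InnerProductSpace ℂ V] [CompleteSpace V]
    [NormedAddCommGroup H] [InnerProductSpace ℂ H] [CompleteSpace H]
    (ι : V →L[ℂ] H) (hι : Function.Injective ι) (hι' : DenseRange ι)
    (ℰ : V →L[ℂ] V →L⋆[ℂ] ℂ)
    (hℰ : ∃ μ : ℝ, 0 < μ ∧ ∀ v : V, μ * ‖v‖ ^ 2 ≤ (ℰ v v).re)
    (s : Set.Ioo (0 : ℝ) 1) :
    ∃ D : DtN.InterpHV ι s ≃L[ℂ] DtN.InterpHV' ι s, ∀ x : DtN.InterpHV ι s,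
      ∃ u : ℝ → V,
        (DtN.IsHarmonic ι ℰ s u ∧ DtN.HasTrace (fun t => ι (u t)) x.toH) ∧
        (∀ v : ℝ → V, DtN.IsHarmonic ι ℰ s v → DtN.HasTrace (fun t => ι (v t)) x.toH →
          v =ᵐ[MeasureTheory.volume.restrict (Set.Ioi 0)] u) ∧
        DtN.HasNormalDeriv ι s u (D x).toAntidual := by
  obtain ⟨μ, hμ, hμℰ⟩ := hℰ
  obtain ⟨T, U, Λ, hT, hinj, hU, hΛ, hΛU⟩ := DtN.exists_polar ι hι hι'
  let A : H →L[ℂ] H := Λ.symm.toContinuousLinearEquiv.toContinuousLinearMap ∘L ℰ ∘L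
    U.toContinuousLinearEquiv.toContinuousLinearMap
  have hΛA : ∀ h, Λ (A h) = ℰ (U h) := fun h => Λ.apply_symm_apply _
  have hA : ∀ x, μ * ‖x‖ ^ 2 ≤ (inner ℂ x (A x)).re := fun x => by
    rw [← hΛU, hΛA, ← U.norm_map]
    exact hμℰ (U x)
  obtain ⟨e₁, he₁⟩ := DtN.exists_equiv_interpHV hT hinj U hU s
  obtain ⟨e₂, he₂⟩ := DtN.exists_equiv_interpHV' hT hinj Λ hΛ s
  obtain ⟨D, hD⟩ := DtN.exists_dirichletToNeumann hT hinj A hμ hA s.2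
  refine ⟨e₁.trans (D.trans e₂.symm), fun x => ?_⟩
  obtain ⟨v, g, w, P, mv, mg, hw, hwv, hw0, hP, hPg, hP0⟩ := hD (e₁ x)
  obtain ⟨hu, hux, huy⟩ := DtN.exists_isHarmonic U Λ hU hΛ hΛA s.2 mv mg hw hwv hw0 hP hPg hP0
  rw [he₁] at hux
  refine ⟨fun t => U (v t), ⟨hu, hux⟩, fun u₂ hu₂ hux₂ => ?_, ?_⟩
  · have h0 := hux₂.sub hux
    simp only [sub_self, ← map_sub] at h0
    filter_upwards [(hu₂.sub hu).ae_eq_zero hT hinj U Λ hU hΛ hΛA hμ hA s.2 h0] with t ht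
    exact sub_eq_zero.1 ht
  · rw [← he₂]
    simpa using huy
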